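/- **Theorem (Bias expansion and MSE decomposition).** Let $\|Z\|_q=(\mathbb{E}|Z|^q)^{1/q}$. Fix $M\in\mathbb{N}$, $M\ge 1$, constants $C\ge 0$, $D$, and weights $\chi_i\ge 0$ with $\chi_i=O(i^{-2-\varepsilon})$ for some $\varepsilon>0$; put $|x|_\chi=\sum_i\chi_i|x_i|$. A function $f:\mathbb{R}^{\mathbb{N}}\to\mathbb{R}$ is in $\mathcal{H}(M,\chi,C)$ if $|f(x)-f(y)|\le C|x-y|_\chi(1+|x|_\chi^{M-1}+|y|_\chi^{M-1})$ for all $x,y$ with $|x|_\chi,|y|_\chi<\infty$. Suppose: 1. (Local stationarity, $q=2M$.) $X_{t,n}$ ($1\le t\le n$) are random variables and, for each $u\in[0,1]$, $(\tilde X_t(u))_{t\in\mathbb{Z}}$ is a strictly stationary process on the same probability space such that, for all $1\le t\le n$ and $u,u'\in[0,1]$, $\|\tilde X_0(u)\|_{q}\le D$, $\|X_{t,n}\|_{q}\le D$, $\|X_{t,n}-\tilde X_t(t/n)\|_{q}\le Dn^{-1}$ and $\|\tilde X_0(u)-\tilde X_0(u')\|_{q}\le D|u-u'|$. 2. (Smooth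 approximations.) For each $t\in\mathbb{Z}$, almost surely $u\mapsto\tilde X_t(u)$ is $C^2$ on $[0,1]$, with $\|\sup_{u\in[0,1]}|\partial_u\tilde X_t(u)|\|_{\max\{M,2\}}\le D$ and $\|\sup_{u\in[0,1]}|\partial_u^2\tilde X_t(u)|\|_M\le D$. 3. (Smooth $g$.) $g:\mathbb{R}^{\mathbb{N}}\to\mathbb{R}^d$ is measurable, each component lies in $\mathcal{H}(M,\chi,C)$ and has first and second partial derivatives where $|x|_\chi<\infty$, and componentwise $\partial_{x_i}g\in\mathcal{H}(\max\{M-1,1\},\chi,C\chi_i)$ and $\partial^2_{x_ix_j}g\in\mathcal{H}(\max\{M-2,1\},\chi,C\chi_i\chi_j)$ for all $i,j$. 4. (Kernel.) $K:\mathbb{R}\to[0,\infty)$ is Lipschitz continuous, symmetric, zero outside $[-\frac12,\frac12]$, and $\int K=1$. Let $\tilde Y_t(u)=(\tilde X_t(u),\tilde X_{t-1}(u),\dots)$, $Y_{t,n}=(X_{t,n},\dots,X_{1,n},0,0,\dots)$, $G(u)=\mathbb{E}g(\tilde Y_0(u))$, $K_h(x)=h^{-1}K(x/h)$, $\hat G_h(u)=\frac1n\sum_{t=1}^nK_h(t/n-u)\,g(Y_{t,n})$,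 $\sigma_K^2=\int K(x)^2dx$ and $\mu_K=\int K(x)x^2dx$. Then $g(\tilde Y_t(u))$ ($u\in[0,1]$, $t\in\mathbb{Z}$) and $\hat G_h(u)$ are square integrable, $G$ is twice continuously differentiable on $[0,1]$, and, as $h\to0$, $nh\to\infty$, uniformly in $u\in[\frac h2,1-\frac h2]$, (i) $\displaystyle\Big|\mathbb{E}\hat G_h(u)-G(u)-\frac{h^2}{2}\mu_K\,\partial_u^2G(u)\Big|_2=O((nh)^{-1})+o(h^2).$ (ii) Suppose in addition that $\tilde X_t(u)=H(\mathcal{F}_t,u)$ almost surely for all $t\in\mathbb{Z}$, $u\in[0,1]$, where $\mathcal{F}_t=(\zeta_t,\zeta_{t-1},\dots)$ for i.i.d. $(\zeta_t)_{t\in\mathbb{Z}}$ and $H(\cdot,u)$ is measurable, and that $\sum_{k\ge0}\sup_{u\in[0,1]}\|H(\mathcal{F}_k,u)-H(\mathcal{F}_k^*,u)\|_{2M}<\infty$, where $\mathcal{F}_k^*$ is $\mathcal{F}_k$ with $\zeta_0$ replaced by an independent copy $\zeta_0^*$. Then, for every $u\in[0,1]$, the series $\Sigma(u)=\sum_{k\in\mathbb{Z}}\mathrm{Cov}(g(\tilde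 Y_0(u)),g(\tilde Y_k(u)))$ (the long-run variance) converges absolutely and, in the same asymptotic regime and with the same uniformity in $u$ as in (i), $$\mathbb{E}|\hat G_h(u)-G(u)|_2^2=\frac{\sigma_K^2}{nh}\mathrm{tr}\,\Sigma(u)+\frac{h^4}{4}\mu_K^2|\partial_u^2G(u)|_2^2+o((nh)^{-1}+h^4).$$ -/

import Mathlib

open MeasureTheory ProbabilityTheory Filter Topology Asymptotics
open scoped ENNReal NNReal

namespace LocStat

noncomputable section

/-- A nonnegative, symmetric, Lipschitz continuous kernel on the real line which vanishes outside
`[-1/2, 1/2]` and has integral one. -/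
structure IsKernel (K : ℝ → ℝ) : Prop where
  nonneg : ∀ x, 0 ≤ K x
  lipschitz : ∃ L : ℝ≥0, LipschitzWith L K
  support : ∀ x, x ∉ Set.Icc (-1 / 2 : ℝ) (1 / 2) → K x = 0
  integral_eq_one : ∫ x, K x = 1
  symm : ∀ x, K (-x) = K x

/-- The rescaled kernel `K_h(x) = h⁻¹ K(x / h)`. -/
def scaledKernel (K : ℝ → ℝ) (h x : ℝ) : ℝ := h⁻¹ * K (x / h)

/-- `σ_K² = ∫ K(x)² dx`. -/
def kernelSq (K : ℝ → ℝ) : ℝ := ∫ x, K x ^ 2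

/-- `μ_K = ∫ K(x) x² dx`. -/
def kernelSecondMoment (K : ℝ → ℝ) : ℝ := ∫ x, K x * x ^ 2

/-- The sequence `x` has finite weighted norm `|x|_χ`. -/
def WFinite (χ x : ℕ → ℝ) : Prop := Summable fun i => χ i * |x i|

/-- The weighted norm `|x|_χ = ∑ᵢ χᵢ |xᵢ|` (meaningful for `WFinite χ x`). -/
def wnorm (χ x : ℕ → ℝ) : ℝ := ∑' i, χ i * |x i|

/-- The class `H(M, χ, C)` of real functions on the sequence space which are Lipschitz with
respect to `|·|_χ`, with polynomially growing constants. Sequences with `|x|_χ = ∞` impose no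
condition. The natural subtraction `M - 1` is only used for `1 ≤ M`. -/
structure ClassH (M : ℕ) (χ : ℕ → ℝ) (C : ℝ) (f : (ℕ → ℝ) → ℝ) : Prop where
  one_le : 1 ≤ M
  const_nonneg : 0 ≤ C
  weight_nonneg : ∀ i, 0 ≤ χ i
  weight_decay : ∃ ε : ℝ, 0 < ε ∧ χ =O[atTop] fun i : ℕ => (i : ℝ) ^ (-2 - ε)
  bound : ∀ x y, WFinite χ x → WFinite χ y →
    |f x - f y| ≤ C * wnorm χ (x - y) * (1 + wnorm χ x ^ (M - 1) + wnorm χ y ^ (M - 1))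

/-- The partial derivative `∂f/∂xᵢ` at `x`. -/
def pderiv (i : ℕ) (f : (ℕ → ℝ) → ℝ) (x : ℕ → ℝ) : ℝ :=
  deriv (fun s => f (Function.update x i s)) (x i)

/-- `f ∈ H(M, χ, C)` is twice continuously differentiable (in the sense of partial derivatives, on
the set where `|·|_χ` is finite), with `∂ᵢf ∈ H(max(M-1,1), χ, C χᵢ)` and
`∂ᵢ∂ⱼf ∈ H(max(M-2,1), χ, C χᵢ χⱼ)`. The membership in these classes contains the continuity of
the partial derivatives with respect to `|·|_χ`. -/
structure SmoothClassH (M : ℕ) (χ : ℕ → ℝ) (C : ℝ) (f : (ℕ → ℝ) → ℝ) : Prop where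
  mem : ClassH M χ C f
  diff : ∀ x, WFinite χ x → ∀ i, DifferentiableAt ℝ (fun s => f (Function.update x i s)) (x i)
  diff_diff : ∀ x, WFinite χ x → ∀ i j,
    DifferentiableAt ℝ (fun s => pderiv i f (Function.update x j s)) (x j)
  mem_deriv : ∀ i, ClassH (max (M - 1) 1) χ (C * χ i) (pderiv i f)
  mem_deriv_deriv : ∀ i j,
    ClassH (max (M - 2) 1) χ (C * χ i * χ j) (pderiv j (pderiv i f))

section process

variable {Ω : Type*} [MeasurableSpace Ω]

/-- Local stationarity of the triangular array `X n t` (`1 ≤ t ≤ n`) with moments of order `q`,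
constant `D`, and stationary approximations `Xs u t` (`u ∈ [0,1]`, `t ∈ ℤ`). -/
structure IsLocallyStationary (μ : Measure Ω) (q : ℝ≥0∞) (D : ℝ)
    (X : ℕ → ℕ → Ω → ℝ) (Xs : ℝ → ℤ → Ω → ℝ) : Prop where
  measurable_array : ∀ n t, 1 ≤ t → t ≤ n → Measurable (X n t)
  measurable_approx : ∀ u ∈ Set.Icc (0 : ℝ) 1, ∀ t, Measurable (Xs u t)
  stationary : ∀ u ∈ Set.Icc (0 : ℝ) 1, ∀ s : ℤ,
    μ.map (fun ω (t : ℤ) => Xs u (t + s) ω) = μ.map (fun ω (t : ℤ) => Xs u t ω)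
  moment_approx : ∀ u ∈ Set.Icc (0 : ℝ) 1, eLpNorm (Xs u 0) q μ ≤ ENNReal.ofReal D
  moment_array : ∀ n t, 1 ≤ t → t ≤ n → eLpNorm (X n t) q μ ≤ ENNReal.ofReal D
  approx : ∀ n t : ℕ, 1 ≤ t → t ≤ n →
    eLpNorm (fun ω => X n t ω - Xs ((t : ℝ) / n) t ω) q μ ≤ ENNReal.ofReal (D * (n : ℝ)⁻¹)
  lipschitz : ∀ u ∈ Set.Icc (0 : ℝ) 1, ∀ v ∈ Set.Icc (0 : ℝ) 1,
    eLpNorm (fun ω => Xs u 0 ω - Xs v 0 ω) q μ ≤ ENNReal.ofReal (D * |u - v|)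

/-- `sup_{u ∈ [0,1]} |∂_u^k X̃_t(u)|`, with one-sided derivatives at the end points. -/
def supDeriv (Xs : ℝ → ℤ → Ω → ℝ) (k : ℕ) (t : ℤ) (ω : Ω) : ℝ≥0∞ :=
  ⨆ u ∈ Set.Icc (0 : ℝ) 1, ‖iteratedDerivWithin k (fun v => Xs v t ω) (Set.Icc 0 1) u‖ₑ

/-- The paths `u ↦ X̃_t(u)` are almost surely twice continuously differentiable on `[0,1]`, with
moment bounds on the suprema of the first two derivatives. -/
structure HasSmoothPaths (μ : Measure Ω) (M : ℕ) (D : ℝ) (Xs : ℝ → ℤ → Ω → ℝ) : Prop where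
  contDiff : ∀ t, ∀ᵐ ω ∂μ, ContDiffOn ℝ 2 (fun u => Xs u t ω) (Set.Icc 0 1)
  moment_deriv : ∀ t, eLpNorm (supDeriv Xs 1 t) (max M 2 : ℕ) μ ≤ ENNReal.ofReal D
  moment_deriv_deriv : ∀ t, eLpNorm (supDeriv Xs 2 t) M μ ≤ ENNReal.ofReal D

/-- `Y_{t,n} = (X_{t,n}, X_{t-1,n}, …, X_{1,n}, 0, 0, …)`. -/
def obsPast (X : ℕ → ℕ → Ω → ℝ) (n t : ℕ) (ω : Ω) : ℕ → ℝ :=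
  fun i => if i < t then X n (t - i) ω else 0

/-- `Ỹ_t(u) = (X̃_t(u), X̃_{t-1}(u), …)`. -/
def statPast (Xs : ℝ → ℤ → Ω → ℝ) (u : ℝ) (t : ℤ) (ω : Ω) : ℕ → ℝ :=
  fun i => Xs u (t - i) ω

variable {d : ℕ}

/-- `G(u) = E g(Ỹ_0(u))` (by stationarity this is `E g(Ỹ_t(u))` for every `t`). -/
def target (μ : Measure Ω) (Xs : ℝ → ℤ → Ω → ℝ) (g : (ℕ → ℝ) → EuclideanSpace ℝ (Fin d))
    (u : ℝ) : EuclideanSpace ℝ (Fin d) :=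
  ∫ ω, g (statPast Xs u 0 ω) ∂μ

/-- The second derivative of `G` on `[0,1]`. -/
def targetDeriv2 (μ : Measure Ω) (Xs : ℝ → ℤ → Ω → ℝ)
    (g : (ℕ → ℝ) → EuclideanSpace ℝ (Fin d)) (u : ℝ) : EuclideanSpace ℝ (Fin d) :=
  iteratedDerivWithin 2 (target μ Xs g) (Set.Icc 0 1) u

/-- The localized moment estimator `Ĝ_h(u) = n⁻¹ ∑_{t=1}^n K_h(t/n - u) g(Y_{t,n})`. -/
def estimator (K : ℝ → ℝ) (X : ℕ → ℕ → Ω → ℝ) (g : (ℕ → ℝ) → EuclideanSpace ℝ (Fin d))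
    (n : ℕ) (h u : ℝ) (ω : Ω) : EuclideanSpace ℝ (Fin d) :=
  (n : ℝ)⁻¹ • ∑ t ∈ Finset.Icc 1 n,
    scaledKernel K h ((t : ℝ) / n - u) • g (obsPast X n t ω)

/-- `Cov(g_i(Ỹ_0(u)), g_j(Ỹ_k(u)))`. -/
def lagCov (μ : Measure Ω) (Xs : ℝ → ℤ → Ω → ℝ) (g : (ℕ → ℝ) → EuclideanSpace ℝ (Fin d))
    (u : ℝ) (i j : Fin d) (k : ℤ) : ℝ :=
  covariance (fun ω => g (statPast Xs u 0 ω) i) (fun ω => g (statPast Xs u k ω) j) μ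

/-- The long-run covariance matrix `Σ(u) = ∑_{k ∈ ℤ} Cov(g(Ỹ_0(u)), g(Ỹ_k(u)))`. -/
def longRunCov (μ : Measure Ω) (Xs : ℝ → ℤ → Ω → ℝ)
    (g : (ℕ → ℝ) → EuclideanSpace ℝ (Fin d)) (u : ℝ) : Matrix (Fin d) (Fin d) ℝ :=
  Matrix.of fun i j => ∑' k : ℤ, lagCov μ Xs g u i j k

variable {E : Type*}

/-- `F_t = (ζ_t, ζ_{t-1}, …)`. -/
def innovPast (ζ : ℤ → Ω → E) (t : ℤ) (ω : Ω) : ℕ → E := fun i => ζ (t - i) ω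

/-- `F_k^* = (ζ_k, …, ζ_1, ζ_0^*, ζ_{-1}, …)`, realized on `Ω × Ω`: the second factor carries the
independent copy `ζ^*`. -/
def coupledPast (ζ : ℤ → Ω → E) (k : ℕ) (p : Ω × Ω) : ℕ → E :=
  fun i => if i = k then ζ 0 p.2 else ζ ((k : ℤ) - i) p.1

/-- The functional dependence measure `δ_q(k) = ‖H(F_k, u) - H(F_k^*, u)‖_q`. -/
def depMeasure (μ : Measure Ω) (q : ℝ≥0∞) (ζ : ℤ → Ω → E) (H : ℝ → (ℕ → E) → ℝ)
    (u : ℝ) (k : ℕ) : ℝ≥0∞ :=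
  eLpNorm (fun p : Ω × Ω => H u (innovPast ζ k p.1) - H u (coupledPast ζ k p)) q (μ.prod μ)

/-- `X̃_t(u) = H(F_t, u)` is a causal Bernoulli shift in i.i.d. innovations whose functional
dependence measure of order `q` is summable uniformly in `u ∈ [0,1]`. -/
structure IsShortRangeShift [MeasurableSpace E] (μ : Measure Ω) (q : ℝ≥0∞)
    (Xs : ℝ → ℤ → Ω → ℝ) (ζ : ℤ → Ω → E) (H : ℝ → (ℕ → E) → ℝ) : Prop where
  measurable_innov : ∀ t, Measurable (ζ t)
  indep : iIndepFun ζ μ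
  ident : ∀ t, IdentDistrib (ζ t) (ζ 0) μ μ
  measurable_shift : ∀ u ∈ Set.Icc (0 : ℝ) 1, Measurable (H u)
  shift : ∀ u ∈ Set.Icc (0 : ℝ) 1, ∀ t, Xs u t =ᵐ[μ] fun ω => H u (innovPast ζ t ω)
  summable : ∑' k : ℕ, ⨆ u ∈ Set.Icc (0 : ℝ) 1, depMeasure μ q ζ H u k < ∞

end process

end

end LocStat

/-!
Write `w_t = n⁻¹ K_h(t/n - u)`, so that the estimator is `∑ w_t g(Y_{t,n})`. The proof compares
each `g(Y_{t,n})` with `g(Ỹ_t(t/n))` and studies the latter separately in mean and in covariance.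

*Comparison.* The Lipschitz condition of the class `H(M, χ, C)` and Hölder's inequality give
`‖f(x) - f(y)‖_m ≤ 3 C ∑ᵢ χᵢ ‖xᵢ - yᵢ‖_{mM} (1 + ⋯)^{M-1}` (`ClassH.eLpNorm_comp_sub_le`). Hence
`‖g(Y_{t,n}) - g(Ỹ_t(t/n))‖_m = O(1/n + ∑_{i ≥ t} χᵢ)`, and the sum over `t` of the tails
is `∑ᵢ i χᵢ < ∞` because `χᵢ = O(i^{-2-ε})`. As the weights are `O(1/(nh))`, the replacement costs
`O(1/(nh))`. For the mean (`m = 1`) the increments of `u ↦ X̃_t(u)` at a general time `t` are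
controlled by the derivatives of the paths; for the variance (`m = 2`) by the representation
`X̃_t(u) = H(F_t, u)`, whose increments have the same law at all times.

*Bias.* Along almost every path `u ↦ g(Ỹ_0(u))` is `C²` with derivatives given by the chain rule
in infinitely many variables (`SmoothClassH.comp_path`), which rests on a quadratic expansion of
`g` in the weighted norm. Domination of these derivatives allows differentiation under the
expectation, so that `G` is `C²` on `[0, 1]`. A second order Taylor expansion of `G`, uniform in
`u`, is then integrated against the kernel; the Riemann sums of the compactly supported Lipschitz
functions `K(x)`, `x K(x)`, `x² K(x)` and `K(x)²` have relative errors `O(1/(nh))`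
(`IsKernel.exists_bounds`), and the first order term vanishes by symmetry.

*Variance.* Square integrable functions `a`, `b` of i.i.d. innovations satisfy
`|Cov(a, b)| ≤ ∑_j I_j(a) I_j(b)`, where `I_j(a)` is the `L²` distance between `a` and its version
with the `j`-th innovation renewed (`enorm_covariance_le_tsum_influence`). It follows from
telescoping `E[a(x) b(x)] - E[a(x) b(x')]` along the replacement of the innovations one at a time:
in each step, exchanging the coordinate `j` of the two independent sequences reverses the sign of
the increment of `b`. The influences of `g(Ỹ_t(v))` are dominated by a convolution of `χ` with the
functional dependence measure, which is summable. So there is a summable `ρ` with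
`|Cov(g_i(Ỹ_s(v)), g_j(Ỹ_t(v')))| ≤ ρ(t - s)` for all `v, v'` (`exists_covariance_bound`); in
particular the long-run variance converges. In `∑ w_s w_t Cov(g(Ỹ_s(s/n)), g(Ỹ_t(t/n)))` one may
replace `w_t` by `w_s` and the covariance by its value at `u`, at a relative cost
`∑_k min(2 ρ(k), (b + |k| ρ(k)) (h + 1/(nh)))`, which tends to zero by dominated convergence. What
remains is `∑ w_s²` times the long-run variance, and `∑ w_s² = σ_K² / (nh) + O((nh)^{-2})`.
-/

namespace LocStat

/-! ### The weighted sequence space -/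

section weighted

variable {χ x y : ℕ → ℝ}

theorem wnorm_nonneg (hχ : ∀ i, 0 ≤ χ i) (x : ℕ → ℝ) : 0 ≤ wnorm χ x :=
  tsum_nonneg fun i => mul_nonneg (hχ i) (abs_nonneg _)

theorem WFinite.mono (hχ : ∀ i, 0 ≤ χ i) (hy : WFinite χ y) (h : ∀ i, |x i| ≤ |y i|) :
    WFinite χ x :=
  Summable.of_nonneg_of_le (fun i => mul_nonneg (hχ i) (abs_nonneg _))
    (fun i => mul_le_mul_of_nonneg_left (h i) (hχ i)) hy

theorem wnorm_mono (hχ : ∀ i, 0 ≤ χ i) (hy : WFinite χ y) (h : ∀ i, |x i| ≤ |y i|) :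
    wnorm χ x ≤ wnorm χ y :=
  (hy.mono hχ h).tsum_le_tsum (fun i => mul_le_mul_of_nonneg_left (h i) (hχ i)) hy

theorem WFinite.add (hχ : ∀ i, 0 ≤ χ i) (hx : WFinite χ x) (hy : WFinite χ y) :
    WFinite χ (x + y) := by
  refine Summable.of_nonneg_of_le (fun i => mul_nonneg (hχ i) (abs_nonneg _)) (fun i => ?_)
    (Summable.add hx hy)
  rw [← mul_add]
  exact mul_le_mul_of_nonneg_left (abs_add_le _ _) (hχ i)

theorem wnorm_add_le (hχ : ∀ i, 0 ≤ χ i) (hx : WFinite χ x) (hy : WFinite χ y) :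
    wnorm χ (x + y) ≤ wnorm χ x + wnorm χ y := by
  unfold wnorm
  rw [← hx.tsum_add hy]
  refine (hx.add hχ hy).tsum_le_tsum (fun i => ?_) (Summable.add hx hy)
  rw [← mul_add]
  exact mul_le_mul_of_nonneg_left (abs_add_le _ _) (hχ i)

theorem WFinite.neg (hx : WFinite χ x) : WFinite χ (-x) := by
  simpa [WFinite] using hx

theorem WFinite.sub (hχ : ∀ i, 0 ≤ χ i) (hx : WFinite χ x) (hy : WFinite χ y) :
    WFinite χ (x - y) := by
  rw [sub_eq_add_neg]; exact hx.add hχ hy.neg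

theorem wnorm_single (i : ℕ) (c : ℝ) : wnorm χ (Pi.single i c) = χ i * |c| := by
  unfold wnorm
  rw [tsum_eq_single i]
  · simp
  · intro j hj; simp [hj]

theorem wFinite_single (i : ℕ) (c : ℝ) : WFinite χ (Pi.single i c) := by
  refine summable_of_ne_finset_zero (s := {i}) fun j hj => ?_
  have : j ≠ i := by simpa using hj
  simp [this]

theorem update_eq_add_single (x : ℕ → ℝ) (i : ℕ) (s : ℝ) :
    Function.update x i s = x + Pi.single i (s - x i) := by
  ext j
  by_cases h : j = i
  · subst h; simp
  · simp [h]

theorem WFinite.update (hχ : ∀ i, 0 ≤ χ i) (hx : WFinite χ x) (i : ℕ) (s : ℝ) :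
    WFinite χ (Function.update x i s) := by
  rw [update_eq_add_single]; exact hx.add hχ (wFinite_single _ _)

theorem wnorm_update_le (hχ : ∀ i, 0 ≤ χ i) (hx : WFinite χ x) (i : ℕ) (s : ℝ) :
    wnorm χ (Function.update x i s) ≤ wnorm χ x + χ i * |s - x i| := by
  rw [update_eq_add_single, ← wnorm_single]; exact wnorm_add_le hχ hx (wFinite_single _ _)

end weighted

/-! ### Functions of the class `H(M, χ, C)` and their partial derivatives -/

section classH

variable {m m' : ℕ} {χ : ℕ → ℝ} {C C' : ℝ} {f : (ℕ → ℝ) → ℝ}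

theorem ClassH.abs_sub_le (hf : ClassH m χ C f) {x y : ℕ → ℝ} (hx : WFinite χ x)
    (hy : WFinite χ y) :
    |f x - f y| ≤ 3 * C * wnorm χ (x - y) * (1 + wnorm χ x + wnorm χ y) ^ (m - 1) := by
  have h1 := wnorm_nonneg hf.weight_nonneg x
  have h2 := wnorm_nonneg hf.weight_nonneg y
  have h3 := wnorm_nonneg hf.weight_nonneg (x - y)
  have h0 := hf.const_nonneg
  have e1 : (1 : ℝ) ≤ (1 + wnorm χ x + wnorm χ y) ^ (m - 1) := one_le_pow₀ (by linarith)
  have e2 : wnorm χ x ^ (m - 1) ≤ (1 + wnorm χ x + wnorm χ y) ^ (m - 1) :=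
    pow_le_pow_left₀ h1 (by linarith) _
  have e3 : wnorm χ y ^ (m - 1) ≤ (1 + wnorm χ x + wnorm χ y) ^ (m - 1) :=
    pow_le_pow_left₀ h2 (by linarith) _
  calc |f x - f y| ≤ _ := hf.bound x y hx hy
    _ ≤ C * wnorm χ (x - y) * (3 * (1 + wnorm χ x + wnorm χ y) ^ (m - 1)) :=
        mul_le_mul_of_nonneg_left (by linarith) (by positivity)
    _ = _ := by ring

/-- The Lipschitz bound in the direction of one coordinate bounds the partial derivatives. -/
theorem ClassH.abs_pderiv_le (hf : ClassH m χ C f) {x : ℕ → ℝ} (hx : WFinite χ x) (i : ℕ) :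
    |pderiv i f x| ≤ 3 * C * χ i * (2 + 2 * wnorm χ x) ^ (m - 1) := by
  have hχ := hf.weight_nonneg
  have h1 := wnorm_nonneg hχ x
  have h0 := hf.const_nonneg
  have hi := hχ i
  refine norm_deriv_le_of_lip' (f := fun s => f (Function.update x i s)) (by positivity) ?_
  have : ∀ᶠ s in 𝓝 (x i), χ i * |s - x i| < 1 := by
    have : Tendsto (fun s => χ i * |s - x i|) (𝓝 (x i)) (𝓝 (χ i * |x i - x i|)) :=
      Continuous.tendsto (by fun_prop) _
    simp only [sub_self, abs_zero, mul_zero] at this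
    exact this.eventually_lt_const one_pos
  filter_upwards [this] with s hs
  rw [Function.update_eq_self, Real.norm_eq_abs, Real.norm_eq_abs]
  have hxs := hx.update hχ i s
  have e : Function.update x i s - x = Pi.single i (s - x i) := by
    rw [update_eq_add_single]; simp
  have hb := hf.abs_sub_le hxs hx
  rw [e, wnorm_single] at hb
  have h2 := wnorm_update_le hχ hx i s
  have h3 := wnorm_nonneg hχ (Function.update x i s)
  calc _ ≤ _ := hb
    _ ≤ 3 * C * (χ i * |s - x i|) * (2 + 2 * wnorm χ x) ^ (m - 1) := by
        exact mul_le_mul_of_nonneg_left (pow_le_pow_left₀ (by positivity) (by linarith) _)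
          (by positivity)
    _ = _ := by ring

theorem ClassH.tendsto_of_wnorm_sub (hf : ClassH m χ C f) {x : ℕ → ℝ} (hx : WFinite χ x)
    {z : ℕ → ℕ → ℝ} (hz : ∀ n, WFinite χ (z n))
    (h : Tendsto (fun n => wnorm χ (z n - x)) atTop (𝓝 0)) :
    Tendsto (fun n => f (z n)) atTop (𝓝 (f x)) := by
  rw [tendsto_iff_norm_sub_tendsto_zero]
  have hχ := hf.weight_nonneg
  have lim : Tendsto (fun n => 3 * C * wnorm χ (z n - x) *
      (1 + (wnorm χ (z n - x) + wnorm χ x) + wnorm χ x) ^ (m - 1)) atTop (𝓝 0) := by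
    have := ((h.const_mul (3 * C)).mul
      ((((h.add_const (wnorm χ x)).const_add 1).add_const (wnorm χ x)).pow (m - 1)))
    simpa using this
  refine squeeze_zero (fun n => norm_nonneg _) (fun n => ?_) lim
  refine (hf.abs_sub_le (hz n) hx).trans ?_
  have h1 : wnorm χ (z n) ≤ wnorm χ (z n - x) + wnorm χ x := by
    have := wnorm_add_le hχ ((hz n).sub hχ hx) hx
    simpa using this
  have := wnorm_nonneg hχ (z n - x)
  have := wnorm_nonneg hχ x
  have := wnorm_nonneg hχ (z n)
  have := hf.const_nonneg
  gcongr

/-- The sequence which agrees with `y` below `k` and with `x` from `k` on. -/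
def splice (x y : ℕ → ℝ) (k : ℕ) : ℕ → ℝ := fun i => if i < k then y i else x i

theorem splice_succ (x y : ℕ → ℝ) (k : ℕ) :
    splice x y (k + 1) = Function.update (splice x y k) k (y k) := by
  ext i
  rcases lt_trichotomy i k with h | h | h
  · simp [splice, h, h.ne, Nat.lt_succ_of_lt h]
  · subst h; simp [splice]
  · have : ¬ i < k + 1 := by omega
    simp [splice, h.ne', this, not_lt.2 h.le]

theorem splice_self_eq (x y : ℕ → ℝ) (k : ℕ) :
    Function.update (splice x y k) k (x k) = splice x y k := by
  have : x k = splice x y k k := by simp [splice]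
  rw [this, Function.update_eq_self]

/-- First order expansion in all coordinates, with a quadratic remainder. The coordinates are
exchanged one at a time; the mean value theorem applies to each exchange. -/
theorem ClassH.abs_sub_sub_tsum_le (hf : ClassH m χ C f)
    (hd : ∀ x, WFinite χ x → ∀ i, DifferentiableAt ℝ (fun s => f (Function.update x i s)) (x i))
    (hp : ∀ i, ClassH m' χ (C' * χ i) (pderiv i f)) (hC' : 0 ≤ C') {x y : ℕ → ℝ}
    (hx : WFinite χ x) (hy : WFinite χ y) :
    |f y - f x - ∑' i, pderiv i f x * (y i - x i)| ≤
      3 * C' * (1 + 2 * wnorm χ x + wnorm χ (y - x)) ^ (m' - 1) * wnorm χ (y - x) ^ 2 := by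
  have hχ := hf.weight_nonneg
  set δ := y - x with hδ
  have hδf : WFinite χ δ := hy.sub hχ hx
  set B := 3 * C' * (1 + 2 * wnorm χ x + wnorm χ δ) ^ (m' - 1) * wnorm χ δ with hB
  have hx0 := wnorm_nonneg hχ x
  have hδ0 := wnorm_nonneg hχ δ
  have hB0 : 0 ≤ B := by positivity
  have hC := hf.const_nonneg
  -- all points on the way from `x` to `y` are within `|y - x|_χ` of `x`
  have near : ∀ k s, |s - x k| ≤ |δ k| → ∀ i,
      |(Function.update (splice x y k) k s - x) i| ≤ |δ i| := by
    intro k s hs i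
    by_cases hi : i = k
    · subst hi; simpa using hs
    · by_cases hik : i < k
      · simp [hi, splice, hik, hδ]
      · simp [hi, splice, hik]
  have nearF : ∀ k s, |s - x k| ≤ |δ k| → WFinite χ (Function.update (splice x y k) k s) := by
    intro k s hs
    have := (hδf.mono hχ (near k s hs)).add hχ hx
    simpa using this
  have step : ∀ k, |f (splice x y (k + 1)) - f (splice x y k) - pderiv k f x * δ k| ≤
      B * (χ k * |δ k|) := by
    intro k
    set I := Set.uIcc (x k) (y k)
    have hI : ∀ s ∈ I, |s - x k| ≤ |δ k| := fun s hs => by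
      simpa [hδ] using Set.abs_sub_left_of_mem_uIcc hs
    have hder : ∀ s ∈ I, HasDerivWithinAt
        (fun s => f (Function.update (splice x y k) k s) - pderiv k f x * s)
        (pderiv k f (Function.update (splice x y k) k s) - pderiv k f x) I s := by
      intro s hs
      have h1 := (hd _ (nearF k s (hI s hs)) k).hasDerivAt
      simp only [Function.update_idem, Function.update_self] at h1
      have h2 : HasDerivAt (fun s => f (Function.update (splice x y k) k s))
          (pderiv k f (Function.update (splice x y k) k s)) s := by
        simpa [pderiv] using h1
      have h3 := h2.sub ((hasDerivAt_id s).const_mul (pderiv k f x))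
      simp only [id, mul_one] at h3
      exact h3.hasDerivWithinAt
    have hbd : ∀ s ∈ I, ‖pderiv k f (Function.update (splice x y k) k s) - pderiv k f x‖ ≤
        B * χ k := by
      intro s hs
      have hn := nearF k s (hI s hs)
      have hw : wnorm χ (Function.update (splice x y k) k s - x) ≤ wnorm χ δ :=
        wnorm_mono hχ hδf (near k s (hI s hs))
      have hw2 : wnorm χ (Function.update (splice x y k) k s) ≤ wnorm χ x + wnorm χ δ := by
        have := wnorm_add_le hχ (hn.sub hχ hx) hx
        simp only [sub_add_cancel] at this
        linarith
      refine ((hp k).abs_sub_le hn hx).trans ?_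
      have := wnorm_nonneg hχ (Function.update (splice x y k) k s)
      have := wnorm_nonneg hχ (Function.update (splice x y k) k s - x)
      have := hχ k
      calc _ ≤ 3 * (C' * χ k) * wnorm χ δ * (1 + 2 * wnorm χ x + wnorm χ δ) ^ (m' - 1) := by
            refine mul_le_mul (by gcongr) (pow_le_pow_left₀ (by positivity) (by linarith) _)
              (by positivity) (by positivity)
        _ = _ := by rw [hB]; ring
    have := Convex.norm_image_sub_le_of_norm_hasDerivWithin_le hder hbd (convex_uIcc _ _)
      (Set.left_mem_uIcc) (Set.right_mem_uIcc)
    rw [← splice_succ, splice_self_eq, Real.norm_eq_abs, Real.norm_eq_abs] at this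
    have e : f (splice x y (k + 1)) - f (splice x y k) - pderiv k f x * δ k =
      f (splice x y (k + 1)) - pderiv k f x * y k -
        (f (splice x y k) - pderiv k f x * x k) := by
      simp only [hδ, Pi.sub_apply]; ring
    rw [e, ← mul_assoc]
    simpa [hδ] using this
  have sumle : ∀ n, |f (splice x y n) - f x - ∑ k ∈ Finset.range n, pderiv k f x * δ k| ≤
      B * wnorm χ δ := by
    intro n
    have h1 : f (splice x y n) - f x - ∑ k ∈ Finset.range n, pderiv k f x * δ k =
        ∑ k ∈ Finset.range n,
          (f (splice x y (k + 1)) - f (splice x y k) - pderiv k f x * δ k) := by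
      have h0 : splice x y 0 = x := by ext; simp [splice]
      rw [Finset.sum_sub_distrib, Finset.sum_range_sub (fun k => f (splice x y k)), h0]
    rw [h1]
    refine (Finset.abs_sum_le_sum_abs _ _).trans ((Finset.sum_le_sum fun k _ => step k).trans ?_)
    rw [← Finset.mul_sum]
    exact mul_le_mul_of_nonneg_left
      (hδf.sum_le_tsum _ fun i _ => mul_nonneg (hχ i) (abs_nonneg _)) hB0
  have splF : ∀ n, WFinite χ (splice x y n) := by
    intro n
    have : WFinite χ (splice x y n - x) := hδf.mono hχ fun i => by
      by_cases h : i < n <;> simp [splice, h, hδ]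
    simpa using this.add hχ hx
  have lim1 : Tendsto (fun n => f (splice x y n)) atTop (𝓝 (f y)) := by
    refine hf.tendsto_of_wnorm_sub hy splF ?_
    have e : ∀ n, wnorm χ (splice x y n - y) = ∑' i, χ (i + n) * |δ (i + n)| := by
      intro n
      have hs : WFinite χ (splice x y n - y) := (splF n).sub hχ hy
      unfold wnorm
      rw [← hs.sum_add_tsum_nat_add n, Finset.sum_eq_zero, zero_add]
      · refine tsum_congr fun i => ?_
        simp [splice, hδ, abs_sub_comm]
      · intro i hi
        have : i < n := by simpa using hi
        simp [splice, this]
    simp_rw [e]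
    exact tendsto_sum_nat_add fun i => χ i * |δ i|
  have hsum : Summable fun i => pderiv i f x * δ i := by
    refine Summable.of_norm_bounded
      (g := fun i => 3 * C * (2 + 2 * wnorm χ x) ^ (m - 1) * (χ i * |δ i|)) (hδf.mul_left _)
      fun i => ?_
    rw [norm_mul, Real.norm_eq_abs, Real.norm_eq_abs]
    refine (mul_le_mul_of_nonneg_right (hf.abs_pderiv_le hx i) (abs_nonneg _)).trans_eq (by ring)
  have lim2 := hsum.hasSum.tendsto_sum_nat
  have lim := ((lim1.sub_const (f x)).sub lim2).abs
  have := le_of_tendsto' lim sumle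
  refine this.trans_eq ?_
  rw [hB]; ring

end classH

/-! ### Twice differentiable paths -/

section calculus

variable {F : Type*} [NormedAddCommGroup F] [NormedSpace ℝ F]

theorem contDiffOn_two_of_hasDerivWithinAt {I : Set ℝ} (hI : UniqueDiffOn ℝ I) {f f₁ f₂ : ℝ → F}
    (h₁ : ∀ u ∈ I, HasDerivWithinAt f (f₁ u) I u) (h₂ : ∀ u ∈ I, HasDerivWithinAt f₁ (f₂ u) I u)
    (hc : ContinuousOn f₂ I) :
    ContDiffOn ℝ 2 f I ∧ Set.EqOn (iteratedDerivWithin 1 f I) f₁ I ∧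
      Set.EqOn (iteratedDerivWithin 2 f I) f₂ I := by
  have e₁ : Set.EqOn (derivWithin f I) f₁ I := fun u hu => (h₁ u hu).derivWithin (hI u hu)
  have e₂ : Set.EqOn (derivWithin f₁ I) f₂ I := fun u hu => (h₂ u hu).derivWithin (hI u hu)
  refine ⟨?_, ?_, ?_⟩
  · rw [show (2 : WithTop ℕ∞) = 1 + 1 by norm_num, contDiffOn_succ_iff_derivWithin hI]
    refine ⟨fun u hu => (h₁ u hu).differentiableWithinAt, by simp, ?_⟩
    refine ContDiffOn.congr ?_ e₁
    rw [show (1 : WithTop ℕ∞) = 0 + 1 by norm_num, contDiffOn_succ_iff_derivWithin hI]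
    refine ⟨fun u hu => (h₂ u hu).differentiableWithinAt, by simp, ?_⟩
    rw [contDiffOn_zero]
    exact hc.congr e₂
  · rw [iteratedDerivWithin_one]; exact e₁
  · intro u hu
    rw [show (2 : ℕ) = 1 + 1 by norm_num, iteratedDerivWithin_succ, iteratedDerivWithin_one,
      derivWithin_congr e₁ (e₁ hu)]
    exact e₂ hu

theorem _root_.ContDiffOn.hasDerivWithinAt_iteratedDerivWithin {I : Set ℝ}
    (hI : UniqueDiffOn ℝ I) {f : ℝ → F} (hf : ContDiffOn ℝ 2 f I) {u : ℝ} (hu : u ∈ I) :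
    HasDerivWithinAt f (iteratedDerivWithin 1 f I u) I u ∧
      HasDerivWithinAt (iteratedDerivWithin 1 f I) (iteratedDerivWithin 2 f I u) I u := by
  constructor
  · rw [iteratedDerivWithin_one]
    exact (hf.differentiableOn (by norm_num) u hu).hasDerivWithinAt
  · rw [show iteratedDerivWithin 2 f I = derivWithin (iteratedDerivWithin 1 f I) I from
      iteratedDerivWithin_succ]
    exact (hf.differentiableOn_iteratedDerivWithin (m := 1) (by norm_num) hI u hu).hasDerivWithinAt

/-- Termwise differentiation within a convex set, by dominated convergence of the slopes. -/
theorem hasDerivWithinAt_tsum_of_abs_le {I : Set ℝ} (hI : Convex ℝ I) {f f' : ℕ → ℝ → ℝ}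
    {c : ℕ → ℝ} (hc : Summable c) (hf : ∀ n, ∀ u ∈ I, HasDerivWithinAt (f n) (f' n u) I u)
    (hb : ∀ n, ∀ u ∈ I, |f' n u| ≤ c n) (hs : ∀ u ∈ I, Summable fun n => f n u) {u : ℝ}
    (hu : u ∈ I) :
    HasDerivWithinAt (fun v => ∑' n, f n v) (∑' n, f' n u) I u := by
  rw [hasDerivWithinAt_iff_tendsto_slope]
  have key : Tendsto (fun v => ∑' n, slope (f n) u v) (𝓝[I \ {u}] u) (𝓝 (∑' n, f' n u)) := by
    refine tendsto_tsum_of_dominated_convergence hc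
      (fun n => hasDerivWithinAt_iff_tendsto_slope.1 (hf n u hu)) ?_
    filter_upwards [self_mem_nhdsWithin] with v hv n
    have h := Convex.norm_image_sub_le_of_norm_hasDerivWithin_le (hf n) (hb n) hI hu hv.1
    have hne : v - u ≠ 0 := sub_ne_zero.2 hv.2
    rw [slope_def_field, norm_div, div_le_iff₀ (norm_pos_iff.2 hne)]
    exact h
  refine key.congr' ?_
  filter_upwards [self_mem_nhdsWithin] with v hv
  simp only [slope_def_field]
  rw [tsum_div_const, (hs v hv.1).tsum_sub (hs u hu)]

end calculus

section path

variable {m m' M : ℕ} {χ : ℕ → ℝ} {C C' : ℝ} {f : (ℕ → ℝ) → ℝ} {I : Set ℝ} {y y₁ : ℝ → ℕ → ℝ}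
  {a b c : ℕ → ℝ}

theorem wFinite_of_abs_le {x : ℕ → ℝ} (hχ : ∀ i, 0 ≤ χ i) (ha : Summable fun i => χ i * a i)
    (h : ∀ i, |x i| ≤ a i) : WFinite χ x :=
  Summable.of_nonneg_of_le (fun i => mul_nonneg (hχ i) (abs_nonneg _))
    (fun i => mul_le_mul_of_nonneg_left (h i) (hχ i)) ha

theorem wnorm_le_of_abs_le {x : ℕ → ℝ} (hχ : ∀ i, 0 ≤ χ i) (ha : Summable fun i => χ i * a i)
    (h : ∀ i, |x i| ≤ a i) : wnorm χ x ≤ ∑' i, χ i * a i :=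
  (wFinite_of_abs_le hχ ha h).tsum_le_tsum (fun i => mul_le_mul_of_nonneg_left (h i) (hχ i)) ha

theorem wnorm_path_sub_le (hI : Convex ℝ I) (hχ : ∀ i, 0 ≤ χ i)
    (hy : ∀ i, ∀ u ∈ I, HasDerivWithinAt (fun u => y u i) (y₁ u i) I u)
    (hb : ∀ i, ∀ u ∈ I, |y₁ u i| ≤ b i) (hbs : Summable fun i => χ i * b i) {u v : ℝ}
    (hu : u ∈ I) (hv : v ∈ I) :
    wnorm χ (y v - y u) ≤ (∑' i, χ i * b i) * |v - u| := by
  have h : ∀ i, |(y v - y u) i| ≤ b i * |v - u| := fun i =>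
    Convex.norm_image_sub_le_of_norm_hasDerivWithin_le (hy i) (hb i) hI hu hv
  have hs : Summable fun i => χ i * (b i * |v - u|) := by
    simpa [mul_assoc] using hbs.mul_right |v - u|
  refine (wnorm_le_of_abs_le hχ hs h).trans_eq ?_
  rw [← tsum_mul_right]
  simp [mul_assoc]

/-- The chain rule along a path in the weighted sequence space. -/
theorem ClassH.hasDerivWithinAt_comp (hI : Convex ℝ I) (hf : ClassH m χ C f)
    (hd : ∀ x, WFinite χ x → ∀ i, DifferentiableAt ℝ (fun s => f (Function.update x i s)) (x i))
    (hp : ∀ i, ClassH m' χ (C' * χ i) (pderiv i f)) (hC' : 0 ≤ C')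
    (hyF : ∀ u ∈ I, WFinite χ (y u))
    (hy : ∀ i, ∀ u ∈ I, HasDerivWithinAt (fun u => y u i) (y₁ u i) I u)
    (hb : ∀ i, ∀ u ∈ I, |y₁ u i| ≤ b i) (hbs : Summable fun i => χ i * b i) {u : ℝ}
    (hu : u ∈ I) :
    HasDerivWithinAt (fun v => f (y v)) (∑' i, pderiv i f (y u) * y₁ u i) I u := by
  have hχ := hf.weight_nonneg
  have hC := hf.const_nonneg
  set x := y u with hx
  have hx0 := wnorm_nonneg hχ x
  set A := 3 * C * (2 + 2 * wnorm χ x) ^ (m - 1) with hA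
  have hpb : ∀ i, |pderiv i f x| ≤ A * χ i := fun i =>
    (hf.abs_pderiv_le (hyF u hu) i).trans_eq (by rw [hA]; ring)
  have hlinS : ∀ v ∈ I, Summable fun i => pderiv i f x * (y v i - x i) := by
    intro v hv
    refine Summable.of_norm_bounded (g := fun i => A * (χ i * |(y v - x) i|))
      (Summable.mul_left _ ((hyF v hv).sub hχ (hyF u hu))) fun i => ?_
    rw [norm_mul, Real.norm_eq_abs, Real.norm_eq_abs, ← mul_assoc]
    exact mul_le_mul_of_nonneg_right (hpb i) (abs_nonneg _)
  -- the linear part is differentiated term by term; the remainder is quadratic in `v - u`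
  have hlin : HasDerivWithinAt (fun v => ∑' i, pderiv i f x * (y v i - x i))
      (∑' i, pderiv i f x * y₁ u i) I u := by
    refine hasDerivWithinAt_tsum_of_abs_le hI (f := fun i v => pderiv i f x * (y v i - x i))
      (f' := fun i v => pderiv i f x * y₁ v i) (c := fun i => A * (χ i * b i)) (hbs.mul_left _)
      (fun i v hv => ((hy i v hv).sub_const _).const_mul _) (fun i v hv => ?_) hlinS hu
    rw [abs_mul, ← mul_assoc]
    exact mul_le_mul (hpb i) (hb i v hv) (abs_nonneg _) (by have := hχ i; positivity)
  set B := ∑' i, χ i * b i with hB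
  have hB0 : 0 ≤ B := tsum_nonneg fun i => mul_nonneg (hχ i) ((abs_nonneg _).trans (hb i u hu))
  have hrem : HasDerivWithinAt
      (fun v => f (y v) - f x - ∑' i, pderiv i f x * (y v i - x i)) 0 I u := by
    rw [hasDerivWithinAt_iff_isLittleO]
    have hbig : (fun v => f (y v) - f x - ∑' i, pderiv i f x * (y v i - x i))
        =O[𝓝[I] u] fun v => (v - u) ^ 2 := by
      refine IsBigO.of_bound (3 * C' * (1 + 2 * wnorm χ x + B) ^ (m' - 1) * B ^ 2) ?_
      have h1 : ∀ᶠ v in 𝓝[I] u, |v - u| < 1 := by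
        refine nhdsWithin_le_nhds ?_
        have : Tendsto (fun v => |v - u|) (𝓝 u) (𝓝 |u - u|) := Continuous.tendsto (by fun_prop) _
        simp only [sub_self, abs_zero] at this
        exact this.eventually_lt_const one_pos
      filter_upwards [h1, self_mem_nhdsWithin] with v hv1 hv
      have hw : wnorm χ (y v - x) ≤ B * |v - u| := wnorm_path_sub_le hI hχ hy hb hbs hu hv
      have hw' : wnorm χ (y v - x) ≤ B := hw.trans (by nlinarith)
      have hw0 := wnorm_nonneg hχ (y v - x)
      refine (hf.abs_sub_sub_tsum_le hd hp hC' (hyF u hu) (hyF v hv)).trans ?_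
      rw [norm_pow, Real.norm_eq_abs, mul_assoc _ (B ^ 2), ← mul_pow]
      gcongr
    have hlit : (fun v : ℝ => (v - u) ^ 2) =o[𝓝[I] u] fun v => v - u := by
      have h0 : Tendsto (fun v : ℝ => v - u) (𝓝[I] u) (𝓝 0) := by
        refine tendsto_nhdsWithin_of_tendsto_nhds ?_
        have : Tendsto (fun v => v - u) (𝓝 u) (𝓝 (u - u)) := Continuous.tendsto (by fun_prop) _
        simpa using this
      have := (isLittleO_pow_id (one_lt_two)).comp_tendsto h0
      simpa [Function.comp_def] using this
    have := hbig.trans_isLittleO hlit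
    simpa [← hx] using this
  have := (hrem.add hlin).add_const (f x)
  simp only [zero_add] at this
  refine this.congr_of_mem (fun v _ => ?_) hu
  simp

end path

section path

variable {m M : ℕ} {χ : ℕ → ℝ} {C : ℝ} {f : (ℕ → ℝ) → ℝ} {I : Set ℝ} {y y₁ : ℝ → ℕ → ℝ}
  {a b c : ℕ → ℝ}

/-- Along a path with bounded coordinates and bounded derivatives, a function of class `H` is even
Lipschitz continuous. -/
theorem ClassH.continuousOn_comp (hI : Convex ℝ I) (hf : ClassH m χ C f)
    (ha : ∀ i, ∀ u ∈ I, |y u i| ≤ a i) (has : Summable fun i => χ i * a i)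
    (hy : ∀ i, ∀ u ∈ I, HasDerivWithinAt (fun u => y u i) (y₁ u i) I u)
    (hb : ∀ i, ∀ u ∈ I, |y₁ u i| ≤ b i) (hbs : Summable fun i => χ i * b i) :
    ContinuousOn (fun u => f (y u)) I := by
  have hχ := hf.weight_nonneg
  have hC := hf.const_nonneg
  set A := ∑' i, χ i * a i
  set B := ∑' i, χ i * b i with hB
  have hyF : ∀ u ∈ I, WFinite χ (y u) := fun u hu => wFinite_of_abs_le hχ has fun i => ha i u hu
  have hyA : ∀ u ∈ I, wnorm χ (y u) ≤ A := fun u hu => wnorm_le_of_abs_le hχ has fun i => ha i u hu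
  refine LipschitzOnWith.continuousOn
    (LipschitzOnWith.of_dist_le_mul (K := (3 * C * B * (1 + A + A) ^ (m - 1)).toNNReal)
      fun v hv u hu => ?_)
  have hB0 : 0 ≤ B := tsum_nonneg fun i => mul_nonneg (hχ i) ((abs_nonneg _).trans (hb i u hu))
  have hu0 := wnorm_nonneg hχ (y u)
  have hv0 := wnorm_nonneg hχ (y v)
  have hA0 : 0 ≤ A := hu0.trans (hyA u hu)
  rw [Real.coe_toNNReal _ (by positivity), Real.dist_eq, Real.dist_eq]
  calc _ ≤ _ := hf.abs_sub_le (hyF v hv) (hyF u hu)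
    _ ≤ 3 * C * (B * |v - u|) * (1 + A + A) ^ (m - 1) := by
        gcongr
        · exact wnorm_path_sub_le hI hχ hy hb hbs hu hv
        · exact hyA v hv
        · exact hyA u hu
    _ = _ := by ring

/-- A smooth function of class `H` is twice continuously differentiable along paths whose
coordinates are, and the weighted sums of the bounds of the coordinates control its derivatives. -/
theorem SmoothClassH.comp_path (hf : SmoothClassH M χ C f) (hIc : Convex ℝ I)
    (hI : UniqueDiffOn ℝ I) (hy : ∀ i, ContDiffOn ℝ 2 (fun u => y u i) I)
    (ha : ∀ i, ∀ u ∈ I, |y u i| ≤ a i)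
    (hb : ∀ i, ∀ u ∈ I, |iteratedDerivWithin 1 (fun u => y u i) I u| ≤ b i)
    (hc : ∀ i, ∀ u ∈ I, |iteratedDerivWithin 2 (fun u => y u i) I u| ≤ c i)
    (has : Summable fun i => χ i * a i) (hbs : Summable fun i => χ i * b i)
    (hcs : Summable fun i => χ i * c i) :
    ContDiffOn ℝ 2 (fun u => f (y u)) I ∧ ∀ u ∈ I,
      |iteratedDerivWithin 1 (fun u => f (y u)) I u| ≤
        3 * C * (2 + 2 * ∑' i, χ i * a i) ^ (M - 1) * ∑' i, χ i * b i ∧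
      |iteratedDerivWithin 2 (fun u => f (y u)) I u| ≤
        3 * C * (2 + 2 * ∑' i, χ i * a i) ^ (M - 2) * (∑' i, χ i * b i) ^ 2 +
        3 * C * (2 + 2 * ∑' i, χ i * a i) ^ (M - 1) * ∑' i, χ i * c i := by
  have hχ := hf.mem.weight_nonneg
  have hC := hf.mem.const_nonneg
  set A := ∑' i, χ i * a i
  set B := ∑' i, χ i * b i with hB
  set Γ := ∑' i, χ i * c i with hΓ
  set y₁ : ℝ → ℕ → ℝ := fun u i => iteratedDerivWithin 1 (fun u => y u i) I u with hy₁
  set y₂ : ℝ → ℕ → ℝ := fun u i => iteratedDerivWithin 2 (fun u => y u i) I u with hy₂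
  have hder₁ : ∀ i, ∀ u ∈ I, HasDerivWithinAt (fun u => y u i) (y₁ u i) I u := fun i u hu =>
    ((hy i).hasDerivWithinAt_iteratedDerivWithin hI hu).1
  have hder₂ : ∀ i, ∀ u ∈ I, HasDerivWithinAt (fun u => y₁ u i) (y₂ u i) I u := fun i u hu =>
    ((hy i).hasDerivWithinAt_iteratedDerivWithin hI hu).2
  have hyF : ∀ u ∈ I, WFinite χ (y u) := fun u hu => wFinite_of_abs_le hχ has fun i => ha i u hu
  have hyA : ∀ u ∈ I, wnorm χ (y u) ≤ A := fun u hu => wnorm_le_of_abs_le hχ has fun i => ha i u hu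
  set P₁ := 3 * C * (2 + 2 * A) ^ (M - 1) with hP₁
  set P₂ := 3 * C * (2 + 2 * A) ^ (M - 2) with hP₂
  rcases I.eq_empty_or_nonempty with rfl | ⟨u₀, hu₀⟩
  · simp
  have hA0 : 0 ≤ A := (wnorm_nonneg hχ _).trans (hyA u₀ hu₀)
  have ha0 : ∀ i, 0 ≤ a i := fun i => (abs_nonneg _).trans (ha i u₀ hu₀)
  have hb0 : ∀ i, 0 ≤ b i := fun i => (abs_nonneg _).trans (hb i u₀ hu₀)
  have hc0 : ∀ i, 0 ≤ c i := fun i => (abs_nonneg _).trans (hc i u₀ hu₀)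
  have hB0 : 0 ≤ B := tsum_nonneg fun i => mul_nonneg (hχ i) (hb0 i)
  have hΓ0 : 0 ≤ Γ := tsum_nonneg fun i => mul_nonneg (hχ i) (hc0 i)
  have hP₁0 : 0 ≤ P₁ := by positivity
  have hP₂0 : 0 ≤ P₂ := by positivity
  have hp₁ : ∀ k, ∀ u ∈ I, |pderiv k f (y u)| ≤ P₁ * χ k := by
    intro k u hu
    refine (hf.mem.abs_pderiv_le (hyF u hu) k).trans ?_
    have := wnorm_nonneg hχ (y u)
    have := hχ k
    calc _ ≤ 3 * C * χ k * (2 + 2 * A) ^ (M - 1) := by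
          have := hyA u hu
          gcongr
      _ = _ := by rw [hP₁]; ring
  have hp₂ : ∀ k l, ∀ u ∈ I, |pderiv l (pderiv k f) (y u)| ≤ P₂ * χ k * χ l := by
    intro k l u hu
    have h := (hf.mem_deriv k).abs_pderiv_le (hyF u hu) l
    rw [show max (M - 1) 1 - 1 = M - 2 by omega] at h
    refine h.trans ?_
    have := wnorm_nonneg hχ (y u)
    have := hχ k
    have := hχ l
    calc _ ≤ 3 * (C * χ k) * χ l * (2 + 2 * A) ^ (M - 2) := by
          have := hyA u hu
          gcongr
      _ = _ := by rw [hP₂]; ring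
  -- the first derivative `φ₁`, the derivative `ψ k` of `∂f/∂x_k` along the path,
  -- and the second derivative `φ₂`
  set φ₁ : ℝ → ℝ := fun u => ∑' k, pderiv k f (y u) * y₁ u k with hφ₁
  set ψ : ℕ → ℝ → ℝ := fun k u => ∑' l, pderiv l (pderiv k f) (y u) * y₁ u l with hψ
  set φ₂ : ℝ → ℝ := fun u => ∑' k, (ψ k u * y₁ u k + pderiv k f (y u) * y₂ u k) with hφ₂
  have h₁ : ∀ u ∈ I, HasDerivWithinAt (fun u => f (y u)) (φ₁ u) I u := fun u hu =>
    hf.mem.hasDerivWithinAt_comp hIc hf.diff hf.mem_deriv hC hyF hder₁ hb hbs hu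
  have hpd : ∀ k, ∀ u ∈ I, HasDerivWithinAt (fun u => pderiv k f (y u)) (ψ k u) I u :=
    fun k u hu => (hf.mem_deriv k).hasDerivWithinAt_comp hIc
      (fun x hx l => hf.diff_diff x hx k l) (hf.mem_deriv_deriv k)
      (mul_nonneg hC (hχ k)) hyF hder₁ hb hbs hu
  have hψterm : ∀ k l, ∀ u ∈ I, |pderiv l (pderiv k f) (y u) * y₁ u l| ≤
      P₂ * χ k * (χ l * b l) := by
    intro k l u hu
    rw [abs_mul, ← mul_assoc]
    exact mul_le_mul (hp₂ k l u hu) (hb l u hu) (abs_nonneg _)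
      (by have := hχ k; have := hχ l; positivity)
  have hψb : ∀ k, ∀ u ∈ I, |ψ k u| ≤ P₂ * χ k * B := by
    intro k u hu
    rw [hB, ← tsum_mul_left]
    exact tsum_of_norm_bounded (f := fun l => pderiv l (pderiv k f) (y u) * y₁ u l)
      (hbs.mul_left _).hasSum fun l => hψterm k l u hu
  -- a summable bound for the terms of `φ₂`
  set e : ℕ → ℝ := fun k => P₂ * B * (χ k * b k) + P₁ * (χ k * c k) with he
  have hes : Summable e := (hbs.mul_left _).add (hcs.mul_left _)
  have hterm : ∀ k, ∀ u ∈ I, |ψ k u * y₁ u k + pderiv k f (y u) * y₂ u k| ≤ e k := by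
    intro k u hu
    have := hχ k
    refine (abs_add_le _ _).trans (add_le_add ?_ ?_)
    · rw [abs_mul]
      refine (mul_le_mul (hψb k u hu) (hb k u hu) (abs_nonneg _) (by positivity)).trans_eq ?_
      ring
    · rw [abs_mul, ← mul_assoc]
      exact mul_le_mul (hp₁ k u hu) (hc k u hu) (abs_nonneg _) (by positivity)
  have hterm₁ : ∀ k, ∀ u ∈ I, |pderiv k f (y u) * y₁ u k| ≤ P₁ * (χ k * b k) := by
    intro k u hu
    have := hχ k
    rw [abs_mul, ← mul_assoc]
    exact mul_le_mul (hp₁ k u hu) (hb k u hu) (abs_nonneg _) (by positivity)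
  have h₂ : ∀ u ∈ I, HasDerivWithinAt φ₁ (φ₂ u) I u := by
    intro u hu
    refine hasDerivWithinAt_tsum_of_abs_le hIc (f := fun k u => pderiv k f (y u) * y₁ u k)
      (f' := fun k u => ψ k u * y₁ u k + pderiv k f (y u) * y₂ u k) hes
      (fun k v hv => (hpd k v hv).mul (hder₂ k v hv)) hterm (fun v hv => ?_) hu
    exact Summable.of_norm_bounded (hbs.mul_left P₁) fun k => hterm₁ k v hv
  have hy₁c : ∀ k, ContinuousOn (fun u => y₁ u k) I := fun k =>
    (hy k).continuousOn_iteratedDerivWithin (m := 1) (by norm_num) hI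
  have hy₂c : ∀ k, ContinuousOn (fun u => y₂ u k) I := fun k =>
    (hy k).continuousOn_iteratedDerivWithin (m := 2) (by norm_num) hI
  have hcont : ContinuousOn φ₂ I := by
    refine continuousOn_tsum (fun k => ?_) hes hterm
    refine ContinuousOn.add (ContinuousOn.mul ?_ (hy₁c k)) (ContinuousOn.mul ?_ (hy₂c k))
    · refine continuousOn_tsum (fun l => ContinuousOn.mul ?_ (hy₁c l))
        (hbs.mul_left (P₂ * χ k)) (fun l u hu => hψterm k l u hu)
      exact (hf.mem_deriv_deriv k l).continuousOn_comp hIc ha has hder₁ hb hbs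
    · exact (hf.mem_deriv k).continuousOn_comp hIc ha has hder₁ hb hbs
  obtain ⟨r₀, r₁, r₂⟩ := contDiffOn_two_of_hasDerivWithinAt hI h₁ h₂ hcont
  refine ⟨r₀, fun u hu => ⟨?_, ?_⟩⟩
  · rw [r₁ hu, hB, ← tsum_mul_left]
    exact tsum_of_norm_bounded (f := fun k => pderiv k f (y u) * y₁ u k)
      (hbs.mul_left _).hasSum fun k => hterm₁ k u hu
  · rw [r₂ hu]
    have : P₂ * B ^ 2 + P₁ * Γ = ∑' k, e k := by
      rw [(hbs.mul_left (P₂ * B)).tsum_add (hcs.mul_left P₁), tsum_mul_left, tsum_mul_left]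
      ring
    rw [this]
    exact tsum_of_norm_bounded (f := fun k => ψ k u * y₁ u k + pderiv k f (y u) * y₂ u k)
      hes.hasSum fun k => hterm k u hu

end path

/-! ### Differentiation under the integral sign within a set -/

section integral

variable {Ω F : Type*} [MeasurableSpace Ω] {μ : Measure Ω} [NormedAddCommGroup F] [NormedSpace ℝ F]
  {I : Set ℝ} {φ φ' : ℝ → Ω → F}

theorem aestronglyMeasurable_of_hasDerivWithinAt (hI : UniqueDiffOn ℝ I)
    (hm : ∀ u ∈ I, AEStronglyMeasurable (φ u) μ) {u : ℝ} (hu : u ∈ I)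
    (hd : ∀ᵐ ω ∂μ, HasDerivWithinAt (fun u => φ u ω) (φ' u ω) I u) :
    AEStronglyMeasurable (φ' u) μ := by
  classical
  have : NeBot (𝓝[I \ {u}] u) := by
    have := accPt_principal_iff_nhdsWithin.1 (uniqueDiffWithinAt_iff_accPt.1 (hI u hu))
    exact this
  refine aestronglyMeasurable_of_tendsto_ae (𝓝[I \ {u}] u)
    (f := fun v ω => if v ∈ I then slope (fun u => φ u ω) u v else 0) (fun v => ?_) ?_
  · by_cases hv : v ∈ I
    · simp only [hv, if_true, slope_def_module]
      exact ((hm v hv).sub (hm u hu)).const_smul _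
    · simpa only [hv, if_false] using aestronglyMeasurable_const
  · filter_upwards [hd] with ω hω
    refine (hasDerivWithinAt_iff_tendsto_slope.1 hω).congr' ?_
    filter_upwards [self_mem_nhdsWithin] with v hv
    simp [hv.1]

theorem hasDerivWithinAt_integral_of_norm_le (hIc : Convex ℝ I)
    (hint : ∀ u ∈ I, Integrable (φ u) μ) {b : Ω → ℝ} (hb : Integrable b μ)
    (hd : ∀ᵐ ω ∂μ, ∀ u ∈ I, HasDerivWithinAt (fun u => φ u ω) (φ' u ω) I u)
    (hφb : ∀ᵐ ω ∂μ, ∀ u ∈ I, ‖φ' u ω‖ ≤ b ω) {u : ℝ} (hu : u ∈ I) :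
    HasDerivWithinAt (fun u => ∫ ω, φ u ω ∂μ) (∫ ω, φ' u ω ∂μ) I u := by
  rw [hasDerivWithinAt_iff_tendsto_slope]
  have key : Tendsto (fun v => ∫ ω, slope (fun u => φ u ω) u v ∂μ) (𝓝[I \ {u}] u)
      (𝓝 (∫ ω, φ' u ω ∂μ)) := by
    refine tendsto_integral_filter_of_dominated_convergence b ?_ ?_ hb ?_
    · filter_upwards [self_mem_nhdsWithin] with v hv
      simp only [slope_def_module]
      exact ((hint v hv.1).1.sub (hint u hu).1).const_smul _
    · filter_upwards [self_mem_nhdsWithin] with v hv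
      filter_upwards [hd, hφb] with ω hω hbω
      have h := Convex.norm_image_sub_le_of_norm_hasDerivWithin_le hω hbω hIc hu hv.1
      have hne : v - u ≠ 0 := sub_ne_zero.2 hv.2
      rw [slope_def_module, norm_smul, norm_inv, inv_mul_le_iff₀ (norm_pos_iff.2 hne), mul_comm]
      exact h
    · filter_upwards [hd] with ω hω
      exact hasDerivWithinAt_iff_tendsto_slope.1 (hω u hu)
  refine key.congr' ?_
  filter_upwards [self_mem_nhdsWithin] with v hv
  simp only [slope_def_module]
  rw [integral_smul, integral_sub (hint v hv.1) (hint u hu)]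

/-- The expectation of a random path is twice continuously differentiable if the path is and its
derivatives are dominated. -/
theorem contDiffOn_two_integral (hIc : Convex ℝ I) (hI : UniqueDiffOn ℝ I)
    (hint : ∀ u ∈ I, Integrable (φ u) μ)
    (hφ : ∀ᵐ ω ∂μ, ContDiffOn ℝ 2 (fun u => φ u ω) I) {b₁ b₂ : Ω → ℝ} (hb₁ : Integrable b₁ μ)
    (hb₂ : Integrable b₂ μ)
    (h₁ : ∀ᵐ ω ∂μ, ∀ u ∈ I, ‖iteratedDerivWithin 1 (fun u => φ u ω) I u‖ ≤ b₁ ω)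
    (h₂ : ∀ᵐ ω ∂μ, ∀ u ∈ I, ‖iteratedDerivWithin 2 (fun u => φ u ω) I u‖ ≤ b₂ ω) :
    ContDiffOn ℝ 2 (fun u => ∫ ω, φ u ω ∂μ) I := by
  set φ₁ : ℝ → Ω → F := fun u ω => iteratedDerivWithin 1 (fun u => φ u ω) I u
  set φ₂ : ℝ → Ω → F := fun u ω => iteratedDerivWithin 2 (fun u => φ u ω) I u
  have d₁ : ∀ᵐ ω ∂μ, ∀ u ∈ I, HasDerivWithinAt (fun u => φ u ω) (φ₁ u ω) I u := by
    filter_upwards [hφ] with ω hω u hu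
    exact (hω.hasDerivWithinAt_iteratedDerivWithin hI hu).1
  have d₂ : ∀ᵐ ω ∂μ, ∀ u ∈ I, HasDerivWithinAt (fun u => φ₁ u ω) (φ₂ u ω) I u := by
    filter_upwards [hφ] with ω hω u hu
    exact (hω.hasDerivWithinAt_iteratedDerivWithin hI hu).2
  have m₁ : ∀ u ∈ I, AEStronglyMeasurable (φ₁ u) μ := fun u hu =>
    aestronglyMeasurable_of_hasDerivWithinAt hI (fun v hv => (hint v hv).1) hu
      (d₁.mono fun ω h => h u hu)
  have m₂ : ∀ u ∈ I, AEStronglyMeasurable (φ₂ u) μ := fun u hu =>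
    aestronglyMeasurable_of_hasDerivWithinAt hI m₁ hu (d₂.mono fun ω h => h u hu)
  have i₁ : ∀ u ∈ I, Integrable (φ₁ u) μ := fun u hu =>
    hb₁.mono' (m₁ u hu) (h₁.mono fun ω h => h u hu)
  refine (contDiffOn_two_of_hasDerivWithinAt hI (f₁ := fun u => ∫ ω, φ₁ u ω ∂μ)
    (f₂ := fun u => ∫ ω, φ₂ u ω ∂μ)
    (fun u hu => hasDerivWithinAt_integral_of_norm_le hIc hint hb₁ d₁ h₁ hu)
    (fun u hu => hasDerivWithinAt_integral_of_norm_le hIc i₁ hb₂ d₂ h₂ hu) ?_).1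
  refine continuousOn_of_dominated m₂ (fun u hu => h₂.mono fun ω h => h u hu) hb₂ ?_
  filter_upwards [hφ] with ω hω
  exact hω.continuousOn_iteratedDerivWithin (m := 2) (by norm_num) hI

end integral

/-! ### Inequalities of Minkowski and Hölder -/

section norms

variable {Ω : Type*} [MeasurableSpace Ω] {μ : Measure Ω}

theorem eLpNorm_natCast_pow {ε : Type*} [ENorm ε] {p : ℕ} (hp : p ≠ 0) (f : Ω → ε) :
    eLpNorm f p μ ^ p = ∫⁻ ω, ‖f ω‖ₑ ^ p ∂μ := by
  have := eLpNorm_nnreal_pow_eq_lintegral (μ := μ) (f := f) (p := (p : ℝ≥0)) (by exact_mod_cast hp)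
  simpa using this

theorem ennreal_le_of_pow_le_pow {p : ℕ} (hp : p ≠ 0) {a b : ℝ≥0∞} (h : a ^ p ≤ b ^ p) : a ≤ b :=
  (ENNReal.pow_right_strictMono hp).le_iff_le.1 h

/-- Minkowski's inequality for infinite sums of nonnegative functions. -/
theorem eLpNorm_tsum_le {p : ℕ} (hp : p ≠ 0) {f : ℕ → Ω → ℝ≥0∞}
    (hf : ∀ i, AEMeasurable (f i) μ) :
    eLpNorm (fun ω => ∑' i, f i ω) p μ ≤ ∑' i, eLpNorm (f i) p μ := by
  refine ennreal_le_of_pow_le_pow hp ?_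
  rw [eLpNorm_natCast_pow hp]
  simp only [enorm_eq_self, ENNReal.tsum_eq_iSup_nat, ENNReal.iSup_pow]
  rw [lintegral_iSup']
  · refine iSup_mono fun n => ?_
    have h := eLpNorm_sum_le (p := (p : ℝ≥0∞)) (s := Finset.range n) (f := f) (μ := μ)
      (fun i _ => (hf i).aestronglyMeasurable) (by exact_mod_cast Nat.one_le_iff_ne_zero.2 hp)
    have e := eLpNorm_natCast_pow (μ := μ) hp (∑ i ∈ Finset.range n, f i)
    simp only [enorm_eq_self, Finset.sum_apply] at e
    rw [← e]
    exact pow_le_pow_left' h p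
  · intro n
    exact (Finset.aemeasurable_fun_sum _ fun i _ => hf i).pow_const _
  · refine ae_of_all _ fun ω n k hnk => ?_
    exact pow_le_pow_left' (Finset.sum_le_sum_of_subset (Finset.range_mono hnk)) p

/-- Hölder's inequality in the form `‖f w^(M-1)‖_m ≤ ‖f‖_{mM} ‖w‖_{mM}^(M-1)`. -/
theorem eLpNorm_mul_pow_le {m M : ℕ} (hm : m ≠ 0) (hM : 1 ≤ M) {f w : Ω → ℝ≥0∞}
    (hf : AEMeasurable f μ) (hw : AEMeasurable w μ) :
    eLpNorm (fun ω => f ω * w ω ^ (M - 1)) m μ ≤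
      eLpNorm f (m * M : ℕ) μ * eLpNorm w (m * M : ℕ) μ ^ (M - 1) := by
  have hM0 : M ≠ 0 := by omega
  have hmM : m * M ≠ 0 := mul_ne_zero hm hM0
  refine ennreal_le_of_pow_le_pow hmM ?_
  rw [mul_pow, ← pow_mul, mul_comm (M - 1), pow_mul _ (m * M), eLpNorm_natCast_pow hmM,
    eLpNorm_natCast_pow hmM, pow_mul, eLpNorm_natCast_pow hm]
  simp only [enorm_eq_self]
  have hMr : (M : ℝ) ≠ 0 := by exact_mod_cast hM0
  have h := ENNReal.lintegral_mul_norm_pow_le (μ := μ) (hf.pow_const (m * M))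
    (hw.pow_const (m * M)) (p := 1 / M) (q := ((M - 1 : ℕ) : ℝ) / M) (by positivity)
    (by positivity) (by rw [← add_div, Nat.cast_sub hM]; field_simp; push_cast; ring)
  have e : ∀ ω, (f ω ^ (m * M)) ^ (1 / M : ℝ) * (w ω ^ (m * M)) ^ (((M - 1 : ℕ) : ℝ) / M) =
      (f ω * w ω ^ (M - 1)) ^ m := by
    intro ω
    rw [mul_pow, ← ENNReal.rpow_natCast (f ω), ← ENNReal.rpow_natCast (w ω) (m * M),
      ← ENNReal.rpow_mul, ← ENNReal.rpow_mul]
    have e1 : ((m * M : ℕ) : ℝ) * (1 / M) = (m : ℕ) := by push_cast; field_simp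
    have e2 : ((m * M : ℕ) : ℝ) * (((M - 1 : ℕ) : ℝ) / M) = ((M - 1) * m : ℕ) := by
      rw [Nat.cast_mul, Nat.cast_mul]; field_simp
    rw [e1, e2, ENNReal.rpow_natCast, ENNReal.rpow_natCast, pow_mul]
  simp only [e] at h
  calc _ ≤ ((∫⁻ ω, f ω ^ (m * M) ∂μ) ^ (1 / M : ℝ) *
        (∫⁻ ω, w ω ^ (m * M) ∂μ) ^ (((M - 1 : ℕ) : ℝ) / M)) ^ M := pow_le_pow_left' h M
    _ = _ := by
      rw [mul_pow, ← ENNReal.rpow_mul_natCast, ← ENNReal.rpow_mul_natCast,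
        one_div_mul_cancel hMr, div_mul_cancel₀ _ hMr, ENNReal.rpow_one, ENNReal.rpow_natCast]

end norms

/-! ### Functions of class `H` of random sequences -/

section ewnorm

variable {χ x : ℕ → ℝ}

/-- The weighted norm with values in `[0, ∞]`. -/
noncomputable def ewnorm (χ x : ℕ → ℝ) : ℝ≥0∞ := ∑' i, ENNReal.ofReal (χ i) * ‖x i‖ₑ

theorem ewnorm_eq_ofReal (hχ : ∀ i, 0 ≤ χ i) (hx : WFinite χ x) :
    ewnorm χ x = ENNReal.ofReal (wnorm χ x) := by
  rw [wnorm, ENNReal.ofReal_tsum_of_nonneg (fun i => mul_nonneg (hχ i) (abs_nonneg _)) hx]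
  refine tsum_congr fun i => ?_
  rw [ENNReal.ofReal_mul (hχ i), Real.enorm_eq_ofReal_abs]

theorem wFinite_of_ewnorm_ne_top (hχ : ∀ i, 0 ≤ χ i) (h : ewnorm χ x ≠ ∞) : WFinite χ x := by
  have := ENNReal.summable_toReal h
  refine this.congr fun i => ?_
  rw [ENNReal.toReal_mul, ENNReal.toReal_ofReal (hχ i), toReal_enorm, Real.norm_eq_abs]

theorem ClassH.enorm_sub_le {m : ℕ} {C : ℝ} {f : (ℕ → ℝ) → ℝ} (hf : ClassH m χ C f)
    {x y : ℕ → ℝ} (hx : WFinite χ x) (hy : WFinite χ y) :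
    ‖f x - f y‖ₑ ≤ ENNReal.ofReal (3 * C) *
      (ewnorm χ (x - y) * (1 + ewnorm χ x + ewnorm χ y) ^ (m - 1)) := by
  have hχ := hf.weight_nonneg
  have hC := hf.const_nonneg
  have h1 := wnorm_nonneg hχ x
  have h2 := wnorm_nonneg hχ y
  have h3 := wnorm_nonneg hχ (x - y)
  rw [ewnorm_eq_ofReal hχ hx, ewnorm_eq_ofReal hχ hy, ewnorm_eq_ofReal hχ (hx.sub hχ hy),
    ← ENNReal.ofReal_one, ← ENNReal.ofReal_add zero_le_one h1,
    ← ENNReal.ofReal_add (by positivity) h2, ← ENNReal.ofReal_pow (by positivity),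
    ← ENNReal.ofReal_mul h3, ← ENNReal.ofReal_mul (by positivity), Real.enorm_eq_ofReal_abs]
  refine ENNReal.ofReal_le_ofReal ?_
  rw [← mul_assoc]
  exact hf.abs_sub_le hx hy

end ewnorm

section random

variable {Ω : Type*} [MeasurableSpace Ω] {μ : Measure Ω} {χ : ℕ → ℝ}

/-- The weighted sum `∑ᵢ χᵢ ‖xᵢ‖_p` of the norms of the coordinates of a random sequence. -/
noncomputable def seqNorm (χ : ℕ → ℝ) (p : ℝ≥0∞) (μ : Measure Ω) (x : Ω → ℕ → ℝ) : ℝ≥0∞ :=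
  ∑' i, ENNReal.ofReal (χ i) * eLpNorm (fun ω => x ω i) p μ

theorem aemeasurable_ewnorm {x : Ω → ℕ → ℝ} (hx : ∀ i, AEMeasurable (fun ω => x ω i) μ) :
    AEMeasurable (fun ω => ewnorm χ (x ω)) μ :=
  AEMeasurable.tsum fun i => (hx i).enorm.const_mul _

theorem eLpNorm_const_mul_le {p : ℕ} {f : Ω → ℝ≥0∞} (hf : AEMeasurable f μ) (c : ℝ≥0∞) :
    eLpNorm (fun ω => c * f ω) p μ ≤ c * eLpNorm f p μ :=
  eLpNorm_le_mul_eLpNorm_of_ae_le_mul'' _ hf.aestronglyMeasurable (ae_of_all _ fun ω => by simp)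

theorem eLpNorm_ewnorm_le {p : ℕ} (hp : p ≠ 0) {x : Ω → ℕ → ℝ}
    (hx : ∀ i, AEMeasurable (fun ω => x ω i) μ) :
    eLpNorm (fun ω => ewnorm χ (x ω)) p μ ≤ seqNorm χ p μ x := by
  refine (eLpNorm_tsum_le hp fun i => (hx i).enorm.const_mul _).trans ?_
  refine ENNReal.tsum_le_tsum fun i => ?_
  refine (eLpNorm_const_mul_le (hx i).enorm _).trans_eq ?_
  rw [eLpNorm_enorm]

theorem ae_wFinite_of_seqNorm_ne_top (hχ : ∀ i, 0 ≤ χ i) {p : ℕ} (hp : p ≠ 0) {x : Ω → ℕ → ℝ}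
    (hx : ∀ i, AEMeasurable (fun ω => x ω i) μ) (h : seqNorm χ p μ x ≠ ∞) :
    ∀ᵐ ω ∂μ, WFinite χ (x ω) := by
  have h1 : eLpNorm (fun ω => ewnorm χ (x ω)) p μ ^ p ≠ ∞ :=
    ENNReal.pow_ne_top (ne_top_of_le_ne_top h (eLpNorm_ewnorm_le hp hx))
  rw [eLpNorm_natCast_pow hp] at h1
  filter_upwards [ae_lt_top' (((aemeasurable_ewnorm hx).enorm).pow_const p) h1] with ω hω
  refine wFinite_of_ewnorm_ne_top hχ fun hc => ?_
  simp [hc, hp] at hω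

theorem seqNorm_mono_exponent [IsProbabilityMeasure μ] {p q : ℝ≥0∞} (hpq : p ≤ q)
    {x : Ω → ℕ → ℝ} (hx : ∀ i, AEMeasurable (fun ω => x ω i) μ) :
    seqNorm χ p μ x ≤ seqNorm χ q μ x :=
  ENNReal.tsum_le_tsum fun i => by
    gcongr
    exact eLpNorm_le_eLpNorm_of_exponent_le hpq (hx i).aestronglyMeasurable

/-- The Lipschitz condition of the class `H(M, χ, C)`, read in `L^m` by means of Hölder's
inequality with exponents `M` and `M / (M - 1)`. -/
theorem ClassH.eLpNorm_comp_sub_le [IsProbabilityMeasure μ] {m M : ℕ} {C : ℝ}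
    {f : (ℕ → ℝ) → ℝ} (hf : ClassH M χ C f) (hm : m ≠ 0) {x y : Ω → ℕ → ℝ}
    (hx : ∀ i, AEMeasurable (fun ω => x ω i) μ) (hy : ∀ i, AEMeasurable (fun ω => y ω i) μ)
    (hxs : seqNorm χ (m * M : ℕ) μ x ≠ ∞) (hys : seqNorm χ (m * M : ℕ) μ y ≠ ∞) :
    eLpNorm (fun ω => f (x ω) - f (y ω)) m μ ≤ ENNReal.ofReal (3 * C) *
      (seqNorm χ (m * M : ℕ) μ (fun ω => x ω - y ω) *
        (1 + seqNorm χ (m * M : ℕ) μ x + seqNorm χ (m * M : ℕ) μ y) ^ (M - 1)) := by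
  have hχ := hf.weight_nonneg
  have hmM : m * M ≠ 0 := mul_ne_zero hm (by have := hf.one_le; omega)
  have hp1 : (1 : ℝ≥0∞) ≤ (m * M : ℕ) := by exact_mod_cast Nat.one_le_iff_ne_zero.2 hmM
  have hd : ∀ i, AEMeasurable (fun ω => (x ω - y ω) i) μ := fun i => (hx i).sub (hy i)
  have ax := aemeasurable_ewnorm (χ := χ) hx
  have ay := aemeasurable_ewnorm (χ := χ) hy
  have aw : AEMeasurable (fun ω => 1 + ewnorm χ (x ω) + ewnorm χ (y ω)) μ :=
    (ax.const_add 1).add ay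
  have ad := aemeasurable_ewnorm (χ := χ) hd
  have hw : eLpNorm (fun ω => 1 + ewnorm χ (x ω) + ewnorm χ (y ω)) (m * M : ℕ) μ ≤
      1 + seqNorm χ (m * M : ℕ) μ x + seqNorm χ (m * M : ℕ) μ y := by
    refine (eLpNorm_add_le (ax.const_add 1).aestronglyMeasurable ay.aestronglyMeasurable
      hp1).trans (add_le_add ((eLpNorm_add_le (f := fun _ => (1 : ℝ≥0∞))
        aestronglyMeasurable_const ax.aestronglyMeasurable hp1).trans
          (add_le_add ?_ (eLpNorm_ewnorm_le hmM hx))) (eLpNorm_ewnorm_le hmM hy))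
    rw [eLpNorm_const _ (by exact_mod_cast hmM) (IsProbabilityMeasure.ne_zero μ)]
    simp
  calc eLpNorm (fun ω => f (x ω) - f (y ω)) m μ
      ≤ ENNReal.ofReal (3 * C) * eLpNorm (fun ω => ewnorm χ (x ω - y ω) *
          (1 + ewnorm χ (x ω) + ewnorm χ (y ω)) ^ (M - 1)) m μ := by
        refine eLpNorm_le_mul_eLpNorm_of_ae_le_mul'' _
          (ad.mul (aw.pow_const _)).aestronglyMeasurable ?_
        filter_upwards [ae_wFinite_of_seqNorm_ne_top hχ hmM hx hxs,
          ae_wFinite_of_seqNorm_ne_top hχ hmM hy hys] with ω h1 h2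
        exact hf.enorm_sub_le h1 h2
    _ ≤ _ := by
        gcongr
        refine (eLpNorm_mul_pow_le hm hf.one_le ad aw).trans ?_
        gcongr
        exact eLpNorm_ewnorm_le hmM hd

theorem ClassH.memLp_comp [IsProbabilityMeasure μ] {m M : ℕ} {C : ℝ} {f : (ℕ → ℝ) → ℝ}
    (hf : ClassH M χ C f) (hm : m ≠ 0) {x : Ω → ℕ → ℝ}
    (hx : ∀ i, AEMeasurable (fun ω => x ω i) μ) (hfx : AEMeasurable (fun ω => f (x ω)) μ)
    (hxs : seqNorm χ (m * M : ℕ) μ x ≠ ∞) : MemLp (fun ω => f (x ω)) m μ := by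
  have h0 : seqNorm χ (m * M : ℕ) μ (fun _ => (0 : ℕ → ℝ)) = 0 := by simp [seqNorm]
  have h := hf.eLpNorm_comp_sub_le hm hx (y := fun _ => 0) (fun i => aemeasurable_const) hxs
    (by rw [h0]; exact ENNReal.zero_ne_top)
  have h2 : MemLp (fun ω => f (x ω) - f 0) m μ := by
    refine ⟨(hfx.sub_const _).aestronglyMeasurable, h.trans_lt ?_⟩
    simp only [sub_zero, h0, add_zero]
    exact ENNReal.mul_lt_top ENNReal.ofReal_lt_top (ENNReal.mul_lt_top hxs.lt_top
      (ENNReal.pow_lt_top (ENNReal.add_lt_top.2 ⟨ENNReal.one_lt_top, hxs.lt_top⟩)))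
  exact (h2.add (memLp_const (f 0))).ae_eq (ae_of_all _ fun ω => by simp)

theorem seqNorm_le_mul {p : ℝ≥0∞} {x : Ω → ℕ → ℝ} {c : ℝ≥0∞}
    (h : ∀ i, eLpNorm (fun ω => x ω i) p μ ≤ c) :
    seqNorm χ p μ x ≤ (∑' i, ENNReal.ofReal (χ i)) * c := by
  rw [← ENNReal.tsum_mul_right]
  exact ENNReal.tsum_le_tsum fun i => by gcongr; exact h i

end random

/-! ### Weights, stationarity and suprema of derivatives -/

section weights

variable {M : ℕ} {χ : ℕ → ℝ} {C : ℝ} {f : (ℕ → ℝ) → ℝ}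

theorem ClassH.summable_weight_mul (hf : ClassH M χ C f) : Summable fun i : ℕ => χ i * i := by
  obtain ⟨ε, hε, h⟩ := hf.weight_decay
  refine summable_of_isBigO_nat (g := fun i : ℕ => (i : ℝ) ^ (-1 - ε))
    (Real.summable_nat_rpow.2 (by linarith)) ?_
  refine (h.mul (isBigO_refl (fun i : ℕ => (i : ℝ)) atTop)).congr' EventuallyEq.rfl ?_
  filter_upwards [eventually_gt_atTop 0] with i hi
  have hi' : (0 : ℝ) < i := by exact_mod_cast hi
  rw [← Real.rpow_add_one hi'.ne']
  ring_nf

theorem ClassH.summable_weight (hf : ClassH M χ C f) : Summable χ := by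
  obtain ⟨ε, hε, h⟩ := hf.weight_decay
  exact summable_of_isBigO_nat (Real.summable_nat_rpow.2 (by linarith)) h

theorem ClassH.tsum_weight_ne_top (hf : ClassH M χ C f) : ∑' i, ENNReal.ofReal (χ i) ≠ ∞ := by
  rw [← ENNReal.ofReal_tsum_of_nonneg hf.weight_nonneg hf.summable_weight]
  exact ENNReal.ofReal_ne_top

end weights

theorem uniqueDiffOn_unitInterval : UniqueDiffOn ℝ (Set.Icc (0 : ℝ) 1) :=
  uniqueDiffOn_Icc_zero_one

theorem enorm_iteratedDerivWithin_le_supDeriv {Ω : Type*} {Xs : ℝ → ℤ → Ω → ℝ} (k : ℕ) (t : ℤ)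
    (ω : Ω) {u : ℝ}
    (hu : u ∈ Set.Icc (0 : ℝ) 1) :
    ‖iteratedDerivWithin k (fun v => Xs v t ω) (Set.Icc 0 1) u‖ₑ ≤ supDeriv Xs k t ω :=
  le_iSup₂_of_le u hu le_rfl

section process

variable {Ω : Type*} [MeasurableSpace Ω] {μ : Measure Ω} {q : ℝ≥0∞} {M : ℕ} {D : ℝ}
  {X : ℕ → ℕ → Ω → ℝ} {Xs : ℝ → ℤ → Ω → ℝ}

theorem IsLocallyStationary.identDistrib (hX : IsLocallyStationary μ q D X Xs) {u : ℝ}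
    (hu : u ∈ Set.Icc (0 : ℝ) 1) (s : ℤ) :
    IdentDistrib (fun ω (t : ℤ) => Xs u (t + s) ω) (fun ω (t : ℤ) => Xs u t ω) μ μ where
  aemeasurable_fst :=
    (measurable_pi_lambda _ fun t => hX.measurable_approx u hu (t + s)).aemeasurable
  aemeasurable_snd := (measurable_pi_lambda _ fun t => hX.measurable_approx u hu t).aemeasurable
  map_eq := hX.stationary u hu s

theorem IsLocallyStationary.identDistrib_statPast (hX : IsLocallyStationary μ q D X Xs) {u : ℝ}
    (hu : u ∈ Set.Icc (0 : ℝ) 1) (s t : ℤ) :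
    IdentDistrib (fun ω => (statPast Xs u s ω, statPast Xs u t ω))
      (fun ω => (statPast Xs u 0 ω, statPast Xs u (t - s) ω)) μ μ := by
  have h := (hX.identDistrib hu s).comp
    (u := fun x : ℤ → ℝ => ((fun i : ℕ => x (0 - i)), (fun i : ℕ => x (t - s - i))))
    (by fun_prop)
  convert h using 1
  · ext ω i
    · simp [statPast]; ring_nf
    · simp [statPast]; ring_nf
  · rfl

theorem IsLocallyStationary.moment (hX : IsLocallyStationary μ q D X Xs) {u : ℝ}
    (hu : u ∈ Set.Icc (0 : ℝ) 1) (t : ℤ) : eLpNorm (Xs u t) q μ ≤ ENNReal.ofReal D := by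
  refine le_trans (le_of_eq ?_) (hX.moment_approx u hu)
  have := ((hX.identDistrib hu t).comp (measurable_pi_apply (0 : ℤ))).eLpNorm_eq q
  simpa [Function.comp_def] using this

theorem measurable_statPast (hX : IsLocallyStationary μ q D X Xs) {u : ℝ}
    (hu : u ∈ Set.Icc (0 : ℝ) 1) (t : ℤ) : Measurable (statPast Xs u t) :=
  measurable_pi_lambda _ fun _ => hX.measurable_approx u hu _

/-- By continuity in `u` the supremum may be taken over a countable set. -/
theorem aemeasurable_iSup_of_continuousOn {I : Set ℝ} {ψ : ℝ → Ω → ℝ}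
    (hm : ∀ u ∈ I, AEMeasurable (ψ u) μ) (hc : ∀ᵐ ω ∂μ, ContinuousOn (fun u => ψ u ω) I) :
    AEMeasurable (fun ω => ⨆ u ∈ I, ‖ψ u ω‖ₑ) μ := by
  obtain ⟨S, hS, hd⟩ := TopologicalSpace.exists_countable_dense I
  have := hS.to_subtype
  refine (AEMeasurable.iSup (ι := S) (f := fun s ω => ‖ψ (s : I) ω‖ₑ) ?_).congr ?_
  · exact fun s => (hm _ (s : I).2).enorm
  · filter_upwards [hc] with ω hω
    refine le_antisymm (iSup_le fun s => le_iSup₂_of_le ((s : I) : ℝ) (s : I).2 le_rfl) ?_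
    refine iSup₂_le fun u hu => ?_
    have hcl : IsClosed {v : I | ‖ψ v ω‖ₑ ≤ ⨆ s : S, ‖ψ (s : I) ω‖ₑ} :=
      isClosed_le (continuous_enorm.comp (continuousOn_iff_continuous_domRestrict.1 hω))
        continuous_const
    have : closure S ⊆ {v : I | ‖ψ v ω‖ₑ ≤ ⨆ s : S, ‖ψ (s : I) ω‖ₑ} :=
      closure_minimal (fun s hs => le_iSup (fun s : S => ‖ψ (s : I) ω‖ₑ) ⟨s, hs⟩) hcl
    exact this (hd ⟨u, hu⟩)

theorem HasSmoothPaths.aemeasurable_supDeriv (hX : IsLocallyStationary μ q D X Xs)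
    (hpath : HasSmoothPaths μ M D Xs) (t : ℤ) :
    AEMeasurable (supDeriv Xs 1 t) μ ∧ AEMeasurable (supDeriv Xs 2 t) μ := by
  set I := Set.Icc (0 : ℝ) 1
  have hI := uniqueDiffOn_unitInterval
  have m₀ : ∀ u ∈ I, AEStronglyMeasurable (Xs u t) μ := fun u hu =>
    (hX.measurable_approx u hu t).aestronglyMeasurable
  have m₁ : ∀ u ∈ I,
      AEStronglyMeasurable (fun ω => iteratedDerivWithin 1 (fun v => Xs v t ω) I u) μ :=
    fun u hu => aestronglyMeasurable_of_hasDerivWithinAt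
      (φ' := fun u ω => iteratedDerivWithin 1 (fun v => Xs v t ω) I u) hI m₀ hu
      ((hpath.contDiff t).mono fun ω hω => (hω.hasDerivWithinAt_iteratedDerivWithin hI hu).1)
  have m₂ : ∀ u ∈ I,
      AEStronglyMeasurable (fun ω => iteratedDerivWithin 2 (fun v => Xs v t ω) I u) μ :=
    fun u hu => aestronglyMeasurable_of_hasDerivWithinAt
      (φ := fun u ω => iteratedDerivWithin 1 (fun v => Xs v t ω) I u)
      (φ' := fun u ω => iteratedDerivWithin 2 (fun v => Xs v t ω) I u) hI m₁ hu
      ((hpath.contDiff t).mono fun ω hω => (hω.hasDerivWithinAt_iteratedDerivWithin hI hu).2)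
  constructor
  · exact aemeasurable_iSup_of_continuousOn (fun u hu => (m₁ u hu).aemeasurable)
      ((hpath.contDiff t).mono fun ω hω =>
        hω.continuousOn_iteratedDerivWithin (m := 1) (by norm_num) hI)
  · exact aemeasurable_iSup_of_continuousOn (fun u hu => (m₂ u hu).aemeasurable)
      ((hpath.contDiff t).mono fun ω hω =>
        hω.continuousOn_iteratedDerivWithin (m := 2) (by norm_num) hI)

theorem HasSmoothPaths.ae_enorm_sub_le (hpath : HasSmoothPaths μ M D Xs) (t : ℤ) :
    ∀ᵐ ω ∂μ, ∀ u ∈ Set.Icc (0 : ℝ) 1, ∀ v ∈ Set.Icc (0 : ℝ) 1,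
      ‖Xs u t ω - Xs v t ω‖ₑ ≤ ENNReal.ofReal |u - v| * supDeriv Xs 1 t ω := by
  filter_upwards [hpath.contDiff t] with ω hω u hu v hv
  rcases eq_or_ne (supDeriv Xs 1 t ω) ∞ with h | h
  · rcases eq_or_ne u v with rfl | huv
    · simp
    · rw [h, ENNReal.mul_top]
      · exact le_top
      · simpa using sub_ne_zero.2 huv
  · have hb : ∀ w ∈ Set.Icc (0 : ℝ) 1,
        ‖iteratedDerivWithin 1 (fun v => Xs v t ω) (Set.Icc 0 1) w‖ ≤
          (supDeriv Xs 1 t ω).toReal := fun w hw => by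
      rw [← toReal_enorm]
      exact ENNReal.toReal_mono h (enorm_iteratedDerivWithin_le_supDeriv 1 t ω hw)
    have := Convex.norm_image_sub_le_of_norm_hasDerivWithin_le
      (fun w hw => (hω.hasDerivWithinAt_iteratedDerivWithin uniqueDiffOn_unitInterval hw).1)
      hb (convex_Icc _ _) hv hu
    rw [← ofReal_norm]
    refine (ENNReal.ofReal_le_ofReal this).trans_eq ?_
    rw [ENNReal.ofReal_mul ENNReal.toReal_nonneg, ENNReal.ofReal_toReal h, mul_comm,
      Real.norm_eq_abs]

/-- The paths are Lipschitz continuous in `L^M` at every time. -/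
theorem HasSmoothPaths.eLpNorm_sub_le [IsProbabilityMeasure μ]
    (hX : IsLocallyStationary μ q D X Xs)
    (hpath : HasSmoothPaths μ M D Xs) (t : ℤ) {u v : ℝ} (hu : u ∈ Set.Icc (0 : ℝ) 1)
    (hv : v ∈ Set.Icc (0 : ℝ) 1) :
    eLpNorm (fun ω => Xs u t ω - Xs v t ω) M μ ≤ ENNReal.ofReal |u - v| * ENNReal.ofReal D := by
  have hS := (hpath.aemeasurable_supDeriv hX t).1.aestronglyMeasurable
  refine (eLpNorm_le_mul_eLpNorm_of_ae_le_mul'' (g := supDeriv Xs 1 t)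
    (c := ENNReal.ofReal |u - v|) _ hS ?_).trans ?_
  · filter_upwards [hpath.ae_enorm_sub_le t] with ω hω
    simpa using hω u hu v hv
  · gcongr
    exact (eLpNorm_le_eLpNorm_of_exponent_le (by exact_mod_cast le_max_left M 2) hS).trans
      (hpath.moment_deriv t)

end process

/-! ### Smoothness of the target -/

section target

variable {Ω : Type*} [MeasurableSpace Ω] {μ : Measure Ω} {M : ℕ} {D C : ℝ} {χ : ℕ → ℝ}
  {X : ℕ → ℕ → Ω → ℝ} {Xs : ℝ → ℤ → Ω → ℝ} {f : (ℕ → ℝ) → ℝ}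

theorem IsLocallyStationary.seqNorm_statPast_le {q : ℝ≥0∞} (hX : IsLocallyStationary μ q D X Xs)
    {u : ℝ} (hu : u ∈ Set.Icc (0 : ℝ) 1) (t : ℤ) :
    seqNorm χ q μ (statPast Xs u t) ≤ (∑' i, ENNReal.ofReal (χ i)) * ENNReal.ofReal D :=
  seqNorm_le_mul fun i => hX.moment hu (t - i)

theorem ClassH.memLp_statPast [IsProbabilityMeasure μ]
    (hX : IsLocallyStationary μ (2 * M : ℕ) D X Xs) (hf : ClassH M χ C f) (hfm : Measurable f)
    {u : ℝ} (hu : u ∈ Set.Icc (0 : ℝ) 1) (t : ℤ) :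
    MemLp (fun ω => f (statPast Xs u t ω)) 2 μ := by
  have hm := measurable_statPast hX hu t
  refine hf.memLp_comp (m := 2) two_ne_zero
    (fun i => ((measurable_pi_apply i).comp hm).aemeasurable) (hfm.comp hm).aemeasurable ?_
  exact ne_top_of_le_ne_top (ENNReal.mul_ne_top hf.tsum_weight_ne_top ENNReal.ofReal_ne_top)
    (hX.seqNorm_statPast_le hu t)

theorem eLpNorm_tsum_weight_mul_le {p : ℕ} (hp : p ≠ 0) {F : ℕ → Ω → ℝ≥0∞}
    (hF : ∀ i, AEMeasurable (F i) μ) {c : ℝ≥0∞} (h : ∀ i, eLpNorm (F i) p μ ≤ c) :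
    eLpNorm (fun ω => ∑' i, ENNReal.ofReal (χ i) * F i ω) p μ ≤
      (∑' i, ENNReal.ofReal (χ i)) * c := by
  refine (eLpNorm_tsum_le hp fun i => (hF i).const_mul _).trans ?_
  rw [← ENNReal.tsum_mul_right]
  refine ENNReal.tsum_le_tsum fun i => (eLpNorm_const_mul_le (hF i) _).trans ?_
  gcongr
  exact h i

theorem ae_ne_top_of_eLpNorm_ne_top {p : ℕ} (hp : p ≠ 0) {F : Ω → ℝ≥0∞} (hF : AEMeasurable F μ)
    (h : eLpNorm F p μ ≠ ∞) : ∀ᵐ ω ∂μ, F ω ≠ ∞ := by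
  have h1 := ENNReal.pow_ne_top (n := p) h
  rw [eLpNorm_natCast_pow hp] at h1
  filter_upwards [ae_lt_top' (hF.enorm.pow_const p) h1] with ω hω hc
  simp [hc, hp] at hω

theorem summable_toReal_weight_mul (hχ : ∀ i, 0 ≤ χ i) {F : ℕ → ℝ≥0∞}
    (h : ∑' i, ENNReal.ofReal (χ i) * F i ≠ ∞) :
    (Summable fun i => χ i * (F i).toReal) ∧
      ∑' i, χ i * (F i).toReal = (∑' i, ENNReal.ofReal (χ i) * F i).toReal := by
  have e : ∀ i, (ENNReal.ofReal (χ i) * F i).toReal = χ i * (F i).toReal := fun i => by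
    rw [ENNReal.toReal_mul, ENNReal.toReal_ofReal (hχ i)]
  constructor
  · simpa only [e] using ENNReal.summable_toReal h
  · rw [ENNReal.tsum_toReal_eq fun i => ENNReal.ne_top_of_tsum_ne_top h i]
    simp only [e]

/-- The expectation `u ↦ E f(Ỹ_0(u))` is twice continuously differentiable. The chain rule along
paths bounds the derivatives of `u ↦ f(Ỹ_0(u))` by `W ^ M` and `W ^ max(M,2) + Γ W ^ (M-1)`, where
`W` and `Γ` are weighted sums of the suprema of the first and second derivatives of the
coordinates, which belong to `L^max(M,2)` and `L^M`. -/
theorem SmoothClassH.contDiffOn_integral_statPast [IsProbabilityMeasure μ]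
    (hX : IsLocallyStationary μ (2 * M : ℕ) D X Xs) (hpath : HasSmoothPaths μ M D Xs)
    (hf : SmoothClassH M χ C f) (hfm : Measurable f) :
    ContDiffOn ℝ 2 (fun u => ∫ ω, f (statPast Xs u 0 ω) ∂μ) (Set.Icc 0 1) := by
  have hχ := hf.mem.weight_nonneg
  have hC := hf.mem.const_nonneg
  have hM := hf.mem.one_le
  have h01 : (0 : ℝ) ∈ Set.Icc (0 : ℝ) 1 := by simp
  set I := Set.Icc (0 : ℝ) 1 with hI
  set p := max M 2 with hp
  have hp0 : p ≠ 0 := by omega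
  have hM0 : M ≠ 0 := by omega
  set K := ∑' i, ENNReal.ofReal (χ i) with hK
  have hKt : K ≠ ∞ := hf.mem.tsum_weight_ne_top
  set S₁ : ℕ → Ω → ℝ≥0∞ := fun i => supDeriv Xs 1 ((0 : ℤ) - i)
  set S₂ : ℕ → Ω → ℝ≥0∞ := fun i => supDeriv Xs 2 ((0 : ℤ) - i)
  -- `S₀ i` dominates `|X̃_{-i}(u)|` for all `u`, because the path varies by at most `S₁ i`
  set S₀ : ℕ → Ω → ℝ≥0∞ := fun i ω => ‖Xs 0 ((0 : ℤ) - i) ω‖ₑ + S₁ i ω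
  have mS₁ : ∀ i, AEMeasurable (S₁ i) μ := fun i => (hpath.aemeasurable_supDeriv hX _).1
  have mS₂ : ∀ i, AEMeasurable (S₂ i) μ := fun i => (hpath.aemeasurable_supDeriv hX _).2
  have mX : ∀ i : ℕ, AEMeasurable (Xs 0 ((0 : ℤ) - i)) μ := fun i =>
    (hX.measurable_approx 0 h01 _).aemeasurable
  have mS₀ : ∀ i, AEMeasurable (S₀ i) μ := fun i => (mX i).enorm.add (mS₁ i)
  have bS₁ : ∀ i, eLpNorm (S₁ i) p μ ≤ ENNReal.ofReal D := fun i => hpath.moment_deriv _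
  have bS₂ : ∀ i, eLpNorm (S₂ i) M μ ≤ ENNReal.ofReal D := fun i => hpath.moment_deriv_deriv _
  have bS₀ : ∀ i, eLpNorm (S₀ i) p μ ≤ ENNReal.ofReal D + ENNReal.ofReal D := by
    intro i
    refine (eLpNorm_add_le (mX i).enorm.aestronglyMeasurable (mS₁ i).aestronglyMeasurable
      (by exact_mod_cast Nat.one_le_iff_ne_zero.2 hp0)).trans (add_le_add ?_ (bS₁ i))
    rw [eLpNorm_enorm]
    exact (eLpNorm_le_eLpNorm_of_exponent_le (by exact_mod_cast (by omega : p ≤ 2 * M))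
      (mX i).aestronglyMeasurable).trans (hX.moment h01 _)
  set A : Ω → ℝ≥0∞ := fun ω => ∑' i, ENNReal.ofReal (χ i) * S₀ i ω
  set B : Ω → ℝ≥0∞ := fun ω => ∑' i, ENNReal.ofReal (χ i) * S₁ i ω
  set Γ : Ω → ℝ≥0∞ := fun ω => ∑' i, ENNReal.ofReal (χ i) * S₂ i ω
  have mA : AEMeasurable A μ := AEMeasurable.tsum fun i => (mS₀ i).const_mul _
  have mB : AEMeasurable B μ := AEMeasurable.tsum fun i => (mS₁ i).const_mul _
  have mΓ : AEMeasurable Γ μ := AEMeasurable.tsum fun i => (mS₂ i).const_mul _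
  have nA : eLpNorm A p μ ≠ ∞ := ne_top_of_le_ne_top
    (ENNReal.mul_ne_top hKt (by simp)) (eLpNorm_tsum_weight_mul_le hp0 mS₀ bS₀)
  have nB : eLpNorm B p μ ≠ ∞ := ne_top_of_le_ne_top
    (ENNReal.mul_ne_top hKt (by simp)) (eLpNorm_tsum_weight_mul_le hp0 mS₁ bS₁)
  have nΓ : eLpNorm Γ M μ ≠ ∞ := ne_top_of_le_ne_top
    (ENNReal.mul_ne_top hKt (by simp)) (eLpNorm_tsum_weight_mul_le hM0 mS₂ bS₂)
  -- the constants are those of the bounds in `SmoothClassH.comp_path`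
  set W : Ω → ℝ≥0∞ := fun ω => (2 + 2 * A ω) + B ω
  have mW : AEMeasurable W μ := ((mA.const_mul 2).const_add 2).add mB
  have nW : eLpNorm W p μ ≠ ∞ := by
    have hp1 : (1 : ℝ≥0∞) ≤ p := by exact_mod_cast Nat.one_le_iff_ne_zero.2 hp0
    refine ne_top_of_le_ne_top ?_ ((eLpNorm_add_le
      ((mA.const_mul 2).const_add 2).aestronglyMeasurable mB.aestronglyMeasurable hp1).trans
      (add_le_add_left (eLpNorm_add_le (f := fun _ => (2 : ℝ≥0∞)) aestronglyMeasurable_const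
        (mA.const_mul 2).aestronglyMeasurable hp1) _))
    refine ENNReal.add_ne_top.2 ⟨ENNReal.add_ne_top.2 ⟨?_, ?_⟩, nB⟩
    · rw [eLpNorm_const _ (by exact_mod_cast hp0) (IsProbabilityMeasure.ne_zero μ)]
      simp
    · exact ne_top_of_le_ne_top (ENNReal.mul_ne_top (by simp) nA) (eLpNorm_const_mul_le mA 2)
  have hW1 : ∀ ω, 1 ≤ W ω := fun ω => by
    have : (1 : ℝ≥0∞) ≤ 2 := by norm_num
    exact this.trans (le_add_right (le_add_right le_rfl))
  have iWp : ∫⁻ ω, W ω ^ p ∂μ ≠ ∞ := by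
    have := ENNReal.pow_ne_top (n := p) nW
    rw [eLpNorm_natCast_pow hp0] at this
    simpa using this
  have iWM : ∫⁻ ω, W ω ^ M ∂μ ≠ ∞ := ne_top_of_le_ne_top iWp
    (lintegral_mono fun ω => pow_le_pow_right₀ (hW1 ω) (by omega))
  have iΓW : ∫⁻ ω, Γ ω * W ω ^ (M - 1) ∂μ ≠ ∞ := by
    have h := eLpNorm_mul_pow_le (μ := μ) (m := 1) one_ne_zero hM mΓ mW
    rw [one_mul, Nat.cast_one, eLpNorm_one_eq_lintegral_enorm] at h
    simp only [enorm_eq_self] at h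
    refine ne_top_of_le_ne_top (ENNReal.mul_ne_top nΓ (ENNReal.pow_ne_top ?_)) h
    exact ne_top_of_le_ne_top nW (eLpNorm_le_eLpNorm_of_exponent_le
      (by exact_mod_cast le_max_left M 2) mW.aestronglyMeasurable)
  have mb₁ : AEMeasurable (fun ω => ENNReal.ofReal (3 * C) * W ω ^ M) μ :=
    (mW.pow_const M).const_mul _
  have mb₂ : AEMeasurable (fun ω => ENNReal.ofReal (3 * C) * (W ω ^ p + Γ ω * W ω ^ (M - 1))) μ :=
    ((mW.pow_const p).add (mΓ.mul (mW.pow_const _))).const_mul _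
  have ib₁ := integrable_toReal_of_lintegral_ne_top mb₁ (by
    rw [lintegral_const_mul' _ _ ENNReal.ofReal_ne_top]
    exact ENNReal.mul_ne_top ENNReal.ofReal_ne_top iWM)
  have ib₂ := integrable_toReal_of_lintegral_ne_top mb₂ (by
    rw [lintegral_const_mul' _ _ ENNReal.ofReal_ne_top, lintegral_add_left' (mW.pow_const p)]
    exact ENNReal.mul_ne_top ENNReal.ofReal_ne_top (ENNReal.add_ne_top.2 ⟨iWp, iΓW⟩))
  have main : ∀ᵐ ω ∂μ, ContDiffOn ℝ 2 (fun u => f (statPast Xs u 0 ω)) I ∧ ∀ u ∈ I,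
      ‖iteratedDerivWithin 1 (fun u => f (statPast Xs u 0 ω)) I u‖ ≤
        (ENNReal.ofReal (3 * C) * W ω ^ M).toReal ∧
      ‖iteratedDerivWithin 2 (fun u => f (statPast Xs u 0 ω)) I u‖ ≤
        (ENNReal.ofReal (3 * C) * (W ω ^ p + Γ ω * W ω ^ (M - 1))).toReal := by
    have fS₁ : ∀ᵐ ω ∂μ, ∀ i, S₁ i ω ≠ ∞ := ae_all_iff.2 fun i =>
      ae_ne_top_of_eLpNorm_ne_top hp0 (mS₁ i) (ne_top_of_le_ne_top (by simp) (bS₁ i))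
    have fS₂ : ∀ᵐ ω ∂μ, ∀ i, S₂ i ω ≠ ∞ := ae_all_iff.2 fun i =>
      ae_ne_top_of_eLpNorm_ne_top hM0 (mS₂ i) (ne_top_of_le_ne_top (by simp) (bS₂ i))
    have hcd : ∀ᵐ ω ∂μ, ∀ i : ℕ, ContDiffOn ℝ 2 (fun u => Xs u ((0 : ℤ) - i) ω) I :=
      ae_all_iff.2 fun i => hpath.contDiff _
    have hlip := ae_all_iff.2 fun i : ℕ => hpath.ae_enorm_sub_le ((0 : ℤ) - i)
    filter_upwards [fS₁, fS₂, hcd, hlip, ae_ne_top_of_eLpNorm_ne_top hp0 mA nA,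
      ae_ne_top_of_eLpNorm_ne_top hp0 mB nB, ae_ne_top_of_eLpNorm_ne_top hM0 mΓ nΓ]
      with ω f₁ f₂ hcd hlip fA fB fΓ
    have f₀ : ∀ i, S₀ i ω ≠ ∞ := fun i => ENNReal.add_ne_top.2 ⟨enorm_ne_top, f₁ i⟩
    obtain ⟨sA, eA⟩ := summable_toReal_weight_mul hχ fA
    obtain ⟨sB, eB⟩ := summable_toReal_weight_mul hχ fB
    obtain ⟨sΓ, eΓ⟩ := summable_toReal_weight_mul hχ fΓ
    obtain ⟨r₀, r₁⟩ := hf.comp_path (y := fun u => statPast Xs u 0 ω) (I := I)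
      (a := fun i => (S₀ i ω).toReal) (b := fun i => (S₁ i ω).toReal)
      (c := fun i => (S₂ i ω).toReal) (convex_Icc _ _) uniqueDiffOn_unitInterval hcd
      (fun i u hu => by
        rw [← Real.norm_eq_abs, ← toReal_enorm]
        refine ENNReal.toReal_mono (f₀ i) ?_
        have h1 := hlip i u hu 0 h01
        have h2 : ENNReal.ofReal |u - 0| ≤ 1 := by
          rw [sub_zero, abs_of_nonneg hu.1]; exact ENNReal.ofReal_le_one.2 hu.2
        calc ‖Xs u ((0 : ℤ) - i) ω‖ₑ = ‖Xs 0 ((0 : ℤ) - i) ω +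
              (Xs u ((0 : ℤ) - i) ω - Xs 0 ((0 : ℤ) - i) ω)‖ₑ := by simp
          _ ≤ _ := enorm_add_le _ _
          _ ≤ ‖Xs 0 ((0 : ℤ) - i) ω‖ₑ + 1 * S₁ i ω := by gcongr; exact h1.trans (by gcongr)
          _ = S₀ i ω := by rw [one_mul])
      (fun i u hu => by
        rw [← Real.norm_eq_abs, ← toReal_enorm]
        exact ENNReal.toReal_mono (f₁ i) (enorm_iteratedDerivWithin_le_supDeriv 1 _ ω hu))
      (fun i u hu => by
        rw [← Real.norm_eq_abs, ← toReal_enorm]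
        exact ENNReal.toReal_mono (f₂ i) (enorm_iteratedDerivWithin_le_supDeriv 2 _ ω hu))
      sA sB sΓ
    refine ⟨r₀, fun u hu => ?_⟩
    obtain ⟨q₁, q₂⟩ := r₁ u hu
    rw [eA, eB] at q₁
    rw [eA, eB, eΓ] at q₂
    have fW : W ω ≠ ∞ := ENNReal.add_ne_top.2
      ⟨ENNReal.add_ne_top.2 ⟨by simp, ENNReal.mul_ne_top (by simp) fA⟩, fB⟩
    set α := (A ω).toReal with hα
    set β := (B ω).toReal with hβ
    set γ := (Γ ω).toReal with hγ
    have eW : (W ω).toReal = 2 + 2 * α + β := by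
      simp only [W]
      rw [ENNReal.toReal_add (ENNReal.add_ne_top.2 ⟨by simp, ENNReal.mul_ne_top (by simp) fA⟩) fB,
        ENNReal.toReal_add (by simp) (ENNReal.mul_ne_top (by simp) fA), ENNReal.toReal_mul]
      simp [hα, hβ]
    have hα0 : 0 ≤ α := ENNReal.toReal_nonneg
    have hβ0 : 0 ≤ β := ENNReal.toReal_nonneg
    have hγ0 : 0 ≤ γ := ENNReal.toReal_nonneg
    set w := 2 + 2 * α + β with hw
    have hle : 2 + 2 * α ≤ w := by linarith
    have hβw : β ≤ w := by linarith
    constructor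
    · rw [ENNReal.toReal_mul, ENNReal.toReal_pow, eW, ENNReal.toReal_ofReal (by positivity)]
      refine q₁.trans ?_
      calc 3 * C * (2 + 2 * α) ^ (M - 1) * β ≤ 3 * C * w ^ (M - 1) * w := by gcongr
        _ = 3 * C * w ^ M := by rw [mul_assoc, ← pow_succ, Nat.sub_add_cancel hM]
    · rw [ENNReal.toReal_mul, ENNReal.toReal_add (ENNReal.pow_ne_top fW)
        (ENNReal.mul_ne_top fΓ (ENNReal.pow_ne_top fW)), ENNReal.toReal_mul, ENNReal.toReal_pow,
        ENNReal.toReal_pow, eW, ENNReal.toReal_ofReal (by positivity)]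
      refine q₂.trans ?_
      calc 3 * C * (2 + 2 * α) ^ (M - 2) * β ^ 2 + 3 * C * (2 + 2 * α) ^ (M - 1) * γ
          ≤ 3 * C * w ^ (M - 2) * w ^ 2 + 3 * C * w ^ (M - 1) * γ := by gcongr
        _ = 3 * C * (w ^ p + γ * w ^ (M - 1)) := by
          have : p = M - 2 + 2 := by omega
          rw [this, pow_add]; ring
  refine contDiffOn_two_integral (φ := fun u ω => f (statPast Xs u 0 ω)) (convex_Icc _ _)
    uniqueDiffOn_unitInterval
    (fun u hu => (hf.mem.memLp_statPast hX hfm hu 0).integrable one_le_two)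
    (main.mono fun ω h => h.1) ib₁ ib₂ (main.mono fun ω h u hu => (h.2 u hu).1)
    (main.mono fun ω h u hu => (h.2 u hu).2)

end target

/-! ### Riemann sums of compactly supported Lipschitz functions -/

section riemann

variable {φ ψ : ℝ → ℝ} {L : ℝ}

theorem eq_zero_at_left_end (hL : ∀ x y, |φ x - φ y| ≤ L * |x - y|)
    (hs : ∀ x, x ∉ Set.Icc (-1 / 2 : ℝ) (1 / 2) → φ x = 0) {x : ℝ} (hx : x ≤ -1 / 2) :
    φ x = 0 := by
  rcases hx.lt_or_eq with h | rfl
  · exact hs x fun hc => absurd hc.1 (not_le.2 h)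
  · have hcont : Continuous φ := by
      refine LipschitzWith.continuous (K := L.toNNReal) (LipschitzWith.of_dist_le_mul fun x y => ?_)
      rw [Real.dist_eq, Real.dist_eq]
      exact (hL x y).trans (mul_le_mul_of_nonneg_right (Real.le_coe_toNNReal L) (abs_nonneg _))
    have h1 : Tendsto φ (𝓝[<] (-1 / 2)) (𝓝 (φ (-1 / 2))) :=
      tendsto_nhdsWithin_of_tendsto_nhds hcont.continuousAt
    have h2 : Tendsto φ (𝓝[<] (-1 / 2)) (𝓝 0) := by
      refine tendsto_const_nhds.congr' ?_
      filter_upwards [self_mem_nhdsWithin] with y hy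
      exact (hs y fun hc => absurd hc.1 (not_le.2 hy)).symm
    exact tendsto_nhds_unique h1 h2

theorem abs_le_of_support (hL : ∀ x y, |φ x - φ y| ≤ L * |x - y|)
    (hs : ∀ x, x ∉ Set.Icc (-1 / 2 : ℝ) (1 / 2) → φ x = 0) (x : ℝ) : |φ x| ≤ L := by
  have hL0 : 0 ≤ L := by simpa using (abs_nonneg _).trans (hL 1 0)
  by_cases hx : x ∈ Set.Icc (-1 / 2 : ℝ) (1 / 2)
  · have h := hL x (-1 / 2)
    rw [eq_zero_at_left_end hL hs le_rfl, sub_zero] at h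
    refine h.trans (mul_le_of_le_one_right hL0 ?_)
    rw [abs_le]
    constructor <;> linarith [hx.1, hx.2]
  · rw [hs x hx]; simpa using hL0

theorem abs_mul_sub_mul_le (hL : ∀ x y, |φ x - φ y| ≤ L * |x - y|)
    (hs : ∀ x, x ∉ Set.Icc (-1 / 2 : ℝ) (1 / 2) → φ x = 0) {G L' : ℝ}
    (hG : ∀ x ∈ Set.Icc (-1 / 2 : ℝ) (1 / 2), |ψ x| ≤ G)
    (hL' : ∀ x ∈ Set.Icc (-1 / 2 : ℝ) (1 / 2), ∀ y ∈ Set.Icc (-1 / 2 : ℝ) (1 / 2),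
      |ψ x - ψ y| ≤ L' * |x - y|) (x y : ℝ) :
    |φ x * ψ x - φ y * ψ y| ≤ L * (G + L') * |x - y| := by
  have hL0 : 0 ≤ L := by simpa using (abs_nonneg _).trans (hL 1 0)
  have hL0' : 0 ≤ L' := by
    have h := (abs_nonneg _).trans (hL' (1 / 2) ⟨by norm_num, le_rfl⟩ 0 ⟨by norm_num, by norm_num⟩)
    rw [sub_zero, abs_of_pos (by norm_num)] at h
    linarith
  have hG0 : 0 ≤ G := (abs_nonneg _).trans (hG 0 (by norm_num))
  have main : ∀ x y, x ∈ Set.Icc (-1 / 2 : ℝ) (1 / 2) →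
      |φ x * ψ x - φ y * ψ y| ≤ L * (G + L') * |x - y| := by
    intro x y hx
    by_cases hy : y ∈ Set.Icc (-1 / 2 : ℝ) (1 / 2)
    · calc |φ x * ψ x - φ y * ψ y| = |(φ x - φ y) * ψ x + φ y * (ψ x - ψ y)| := by ring_nf
        _ ≤ |φ x - φ y| * |ψ x| + |φ y| * |ψ x - ψ y| := by
          rw [← abs_mul, ← abs_mul]; exact abs_add_le _ _
        _ ≤ L * |x - y| * G + L * (L' * |x - y|) := by
          gcongr
          · exact hL x y
          · exact hG x hx
          · exact abs_le_of_support hL hs y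
          · exact hL' x hx y hy
        _ = _ := by ring
    · have h := hL x y
      rw [hs y hy, sub_zero] at h
      rw [hs y hy, zero_mul, sub_zero, abs_mul]
      calc |φ x| * |ψ x| ≤ L * |x - y| * G := by gcongr; exact hG x hx
        _ ≤ _ := by nlinarith [mul_nonneg (mul_nonneg hL0 hL0') (abs_nonneg (x - y))]
  by_cases hx : x ∈ Set.Icc (-1 / 2 : ℝ) (1 / 2)
  · exact main x y hx
  · by_cases hy : y ∈ Set.Icc (-1 / 2 : ℝ) (1 / 2)
    · rw [abs_sub_comm, abs_sub_comm x]
      exact main y x hy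
    · rw [hs x hx, hs y hy]; simp; positivity

theorem sum_Icc_one_eq_sum_range {A : Type*} [AddCommMonoid A] (f : ℕ → A) (n : ℕ) :
    ∑ t ∈ Finset.Icc 1 n, f t = ∑ k ∈ Finset.range n, f (k + 1) := by
  induction n with
  | zero => simp
  | succ n ih => rw [Finset.sum_Icc_succ_top (by omega), ih, Finset.sum_range_succ]

/-- The Riemann sums with mesh `1 / (nh)` have error `O(1 / (nh))`. The integrand and its
discretization differ by at most `L / (nh)`, and only on an interval of length `1 + 1 / (nh)`. -/
theorem abs_riemann_sum_sub_integral_le (hL : ∀ x y, |φ x - φ y| ≤ L * |x - y|)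
    (hs : ∀ x, x ∉ Set.Icc (-1 / 2 : ℝ) (1 / 2) → φ x = 0) {n : ℕ} {h u : ℝ} (hn : 1 ≤ n)
    (hh : 0 < h) (hu : u ∈ Set.Icc (h / 2) (1 - h / 2)) :
    |1 / (n * h) * ∑ t ∈ Finset.Icc 1 n, φ (((t : ℝ) / n - u) / h) - ∫ x, φ x| ≤
      L * (1 / (n * h)) * (1 + 1 / (n * h)) := by
  have hL0 : 0 ≤ L := by simpa using (abs_nonneg _).trans (hL 1 0)
  have hcont : Continuous φ := by
    refine LipschitzWith.continuous (K := L.toNNReal) (LipschitzWith.of_dist_le_mul fun x y => ?_)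
    rw [Real.dist_eq, Real.dist_eq]
    exact (hL x y).trans (mul_le_mul_of_nonneg_right (Real.le_coe_toNNReal L) (abs_nonneg _))
  have hn0 : (0 : ℝ) < n := by exact_mod_cast hn
  -- in the variable `(t/n - u) / h` the grid points `a k` have distance `δ` and cover the support
  set δ := 1 / (n * h) with hδ
  have hδ0 : 0 < δ := by positivity
  set a : ℕ → ℝ := fun k => ((k : ℝ) / n - u) / h with ha
  have hstep : ∀ k, a (k + 1) = a k + δ := by
    intro k; simp only [ha, hδ]; push_cast; field_simp; ring
  have ha0 : a 0 ≤ -1 / 2 := by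
    simp only [ha]; rw [div_le_iff₀ hh]; push_cast; rw [zero_div]; linarith [hu.1]
  have han : 1 / 2 ≤ a n := by
    simp only [ha]; rw [div_self hn0.ne', le_div_iff₀ hh]; linarith [hu.2]
  have hint : ∫ x, φ x = ∑ k ∈ Finset.range n, ∫ x in a k..a (k + 1), φ x := by
    rw [intervalIntegral.sum_integral_adjacent_intervals
      (fun k _ => hcont.intervalIntegrable _ _),
      intervalIntegral.integral_eq_integral_of_support_subset]
    intro x hx
    rw [Function.mem_support] at hx
    refine ⟨lt_of_not_ge fun hc => hx (eq_zero_at_left_end hL hs (hc.trans ha0)), ?_⟩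
    by_contra hc
    exact hx (hs x fun hm => hc (hm.2.trans han))
  have hsum : δ * ∑ t ∈ Finset.Icc 1 n, φ (a t) =
      ∑ k ∈ Finset.range n, ∫ _x in a k..a (k + 1), φ (a (k + 1)) := by
    rw [sum_Icc_one_eq_sum_range (fun t => φ (a t)), Finset.mul_sum]
    refine Finset.sum_congr rfl fun k _ => ?_
    rw [intervalIntegral.integral_const, hstep, add_sub_cancel_left, smul_eq_mul]
  set S := Set.Icc (-1 / 2 - δ) (1 / 2 : ℝ) with hS
  set g : ℝ → ℝ := S.indicator fun _ => L * δ with hg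
  have hgi : Integrable g := by
    rw [hg, integrable_indicator_iff measurableSet_Icc]
    exact integrableOn_const (by simp)
  have hg0 : ∀ x, 0 ≤ g x := Set.indicator_nonneg fun _ _ => by positivity
  have hdiff : ∀ k, ∀ x ∈ Set.Icc (a k) (a (k + 1)), |φ (a (k + 1)) - φ x| ≤ g x := by
    intro k x hx
    by_cases hxS : x ∈ S
    · rw [hg, Set.indicator_of_mem hxS]
      refine (hL _ _).trans (mul_le_mul_of_nonneg_left ?_ hL0)
      rw [abs_of_nonneg (by linarith [hx.2])]
      linarith [hx.1, hstep k]
    · have h1 : φ x = 0 := hs x fun hm => hxS ⟨by linarith [hm.1], hm.2⟩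
      have h2 : φ (a (k + 1)) = 0 := hs _ fun hm => hxS
        ⟨by linarith [hm.1, hstep k, hx.1], hx.2.trans hm.2⟩
      rw [h1, h2]; simpa using hg0 x
  have hmono : ∀ k, a k ≤ a (k + 1) := fun k => by rw [hstep]; linarith
  calc _ = |∑ k ∈ Finset.range n, ((∫ _x in a k..a (k + 1), φ (a (k + 1))) -
        ∫ x in a k..a (k + 1), φ x)| := by
        rw [Finset.sum_sub_distrib, ← hsum, ← hint]
    _ ≤ ∑ k ∈ Finset.range n, ∫ x in a k..a (k + 1), g x := by
        refine (Finset.abs_sum_le_sum_abs _ _).trans (Finset.sum_le_sum fun k _ => ?_)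
        rw [← intervalIntegral.integral_sub (by simp) (hcont.intervalIntegrable _ _)]
        exact intervalIntegral.norm_integral_le_of_norm_le
          (f := fun x => φ (a (k + 1)) - φ x) (hmono k)
          (ae_of_all _ fun x hx => hdiff k x ⟨hx.1.le, hx.2⟩) hgi.intervalIntegrable
    _ = ∫ x in a 0..a n, g x :=
        intervalIntegral.sum_integral_adjacent_intervals fun k _ => hgi.intervalIntegrable
    _ ≤ ∫ x, g x := by
        rw [intervalIntegral.integral_of_le (by linarith)]
        exact setIntegral_le_integral hgi (ae_of_all _ hg0)
    _ = _ := by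
        rw [hg, integral_indicator_const _ measurableSet_Icc]
        simp only [Measure.real, Real.volume_Icc, smul_eq_mul]
        rw [ENNReal.toReal_ofReal (by linarith)]
        ring

end riemann

/-! ### Kernel weights -/

section kernel

variable {K : ℝ → ℝ}

/-- The weight `n⁻¹ K_h(t/n - u)` of the observation at time `t`, for all integers `t`. -/
noncomputable def kernelWeight (K : ℝ → ℝ) (n : ℕ) (h u : ℝ) (t : ℤ) : ℝ :=
  1 / (n * h) * K (((t : ℝ) / n - u) / h)

theorem inv_mul_scaledKernel (K : ℝ → ℝ) (n : ℕ) (h u : ℝ) (t : ℕ) :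
    (n : ℝ)⁻¹ * scaledKernel K h ((t : ℝ) / n - u) = kernelWeight K n h u t := by
  simp only [scaledKernel, kernelWeight, Int.cast_natCast]
  rw [← mul_assoc, one_div, mul_inv]

/-- The properties of the kernel weights used below: size, support, modulus of continuity, and
the first moments. -/
structure KernelWeightBounds (K : ℝ → ℝ) (c : ℝ) (n : ℕ) (h u : ℝ) : Prop where
  nonneg : ∀ t, 0 ≤ kernelWeight K n h u t
  le : ∀ t, kernelWeight K n h u t ≤ c / (n * h)
  near : ∀ t, kernelWeight K n h u t ≠ 0 → |(t : ℝ) / n - u| ≤ h / 2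
  range : ∀ t, kernelWeight K n h u t ≠ 0 → 1 ≤ t ∧ t ≤ n
  sub_le : ∀ s t, |kernelWeight K n h u t - kernelWeight K n h u s| ≤
    c / (n * h) * (|(t - s : ℤ)| / (n * h))
  sum_le : ∑ t ∈ Finset.Icc 1 n, kernelWeight K n h u t ≤ c
  sum_zero : |∑ t ∈ Finset.Icc 1 n, kernelWeight K n h u t - 1| ≤ c / (n * h)
  sum_one : |∑ t ∈ Finset.Icc 1 n, kernelWeight K n h u t * ((t : ℝ) / n - u)| ≤ c / (n * h) * h
  sum_two : |∑ t ∈ Finset.Icc 1 n, kernelWeight K n h u t * ((t : ℝ) / n - u) ^ 2 -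
    h ^ 2 * kernelSecondMoment K| ≤ c / (n * h) * h ^ 2
  sum_sq : |∑ t ∈ Finset.Icc 1 n, kernelWeight K n h u t ^ 2 - kernelSq K / (n * h)| ≤
    c / (n * h) / (n * h)

theorem IsKernel.exists_bounds (hK : IsKernel K) : ∃ c : ℝ, 1 ≤ c ∧ ∀ (n : ℕ) (h u : ℝ), 1 ≤ n →
    0 < h → 1 ≤ n * h → u ∈ Set.Icc (h / 2) (1 - h / 2) → KernelWeightBounds K c n h u := by
  obtain ⟨L₀, hL₀⟩ := hK.lipschitz
  set L : ℝ := NNReal.toReal L₀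
  have hL : ∀ x y, |K x - K y| ≤ L * |x - y| := fun x y => by
    simpa [Real.dist_eq] using hL₀.dist_le_mul x y
  have hs := hK.support
  have hL0 : 0 ≤ L := L₀.2
  have hKb : ∀ x, |K x| ≤ L := abs_le_of_support hL hs
  have hL₁ := abs_mul_sub_mul_le (ψ := fun x => x) (G := 1 / 2) (L' := 1) hL hs
    (fun x hx => by rw [abs_le]; constructor <;> linarith [hx.1, hx.2])
    (fun x _ y _ => by simp)
  have hL₂ := abs_mul_sub_mul_le (ψ := fun x => x ^ 2) (G := 1) (L' := 1) hL hs
    (fun x hx => by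
      rw [abs_of_nonneg (sq_nonneg x)]; nlinarith [hx.1, hx.2])
    (fun x hx y hy => by
      rw [show x ^ 2 - y ^ 2 = (x + y) * (x - y) by ring, abs_mul]
      refine mul_le_mul_of_nonneg_right ?_ (abs_nonneg _)
      rw [abs_le]; constructor <;> linarith [hx.1, hx.2, hy.1, hy.2])
  have hL₃ := abs_mul_sub_mul_le (ψ := K) (G := L) (L' := L) hL hs (fun x _ => hKb x)
    (fun x _ y _ => hL x y)
  have hodd : ∫ x, K x * x = 0 := by
    have h1 := integral_neg_eq_self (fun x => K x * x) volume
    simp only [hK.symm, mul_neg, integral_neg] at h1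
    linarith
  set c := 1 + 4 * L + 4 * L ^ 2 with hc
  have hc1 : 1 ≤ c := by rw [hc]; nlinarith
  refine ⟨c, hc1, fun n h u hn hh hnh hu => ?_⟩
  have hn0 : (0 : ℝ) < n := by exact_mod_cast hn
  have hnh0 : 0 < n * h := by positivity
  have hq : 1 / (n * h) ≤ 1 := by rw [div_le_one hnh0]; exact hnh
  have hq0 : 0 < 1 / (n * h) := by positivity
  have r₀ := abs_riemann_sum_sub_integral_le hL hs hn hh hu
  have r₁ := abs_riemann_sum_sub_integral_le hL₁ (fun x hx => by rw [hs x hx, zero_mul]) hn hh hu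
  have r₂ := abs_riemann_sum_sub_integral_le hL₂ (fun x hx => by rw [hs x hx, zero_mul]) hn hh hu
  have r₃ := abs_riemann_sum_sub_integral_le hL₃ (fun x hx => by rw [hs x hx, zero_mul]) hn hh hu
  have two : ∀ a : ℝ, 0 ≤ a → 2 * a ≤ c →
      a * (1 / (n * h)) * (1 + 1 / (n * h)) ≤ c / (n * h) := by
    intro a ha hac
    rw [div_eq_mul_one_div c]
    calc a * (1 / (n * h)) * (1 + 1 / (n * h)) ≤ a * (1 / (n * h)) * (1 + 1) := by gcongr
      _ = 2 * a * (1 / (n * h)) := by ring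
      _ ≤ _ := by gcongr
  have hzero : |∑ t ∈ Finset.Icc 1 n, kernelWeight K n h u t - 1| ≤ c / (n * h) := by
    rw [hK.integral_eq_one, Finset.mul_sum] at r₀
    simp only [kernelWeight, Int.cast_natCast]
    exact r₀.trans (two L hL0 (by rw [hc]; nlinarith))
  have hnear : ∀ t : ℤ, kernelWeight K n h u t ≠ 0 → |(t : ℝ) / n - u| ≤ h / 2 := by
    intro t ht
    by_contra hcon
    refine ht ?_
    rw [kernelWeight, hs, mul_zero]
    intro hm
    refine hcon ?_
    have h1 := hm.1
    have h2 := hm.2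
    rw [le_div_iff₀ hh] at h1
    rw [div_le_iff₀ hh] at h2
    rw [abs_le]; constructor <;> linarith
  refine ⟨?_, ?_, hnear, ?_, ?_, ?_, hzero, ?_, ?_, ?_⟩
  · intro t; exact mul_nonneg hq0.le (hK.nonneg _)
  · intro t
    rw [kernelWeight, div_eq_mul_one_div c, mul_comm c]
    refine mul_le_mul_of_nonneg_left ((le_abs_self _).trans ((hKb _).trans ?_)) hq0.le
    rw [hc]; nlinarith
  · intro t ht
    have hn' := abs_le.1 (hnear t ht)
    constructor
    · by_contra hcon
      refine ht ?_
      rw [kernelWeight, eq_zero_at_left_end hL hs, mul_zero]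
      rw [div_le_iff₀ hh]
      have : (t : ℝ) ≤ 0 := by exact_mod_cast (by omega : t ≤ 0)
      have : (t : ℝ) / n ≤ 0 := div_nonpos_of_nonpos_of_nonneg this hn0.le
      linarith [hu.1]
    · have : (t : ℝ) / n ≤ 1 := by linarith [hu.2]
      rw [div_le_one hn0] at this
      exact_mod_cast this
  · intro s t
    rw [kernelWeight, kernelWeight, ← mul_sub, abs_mul, abs_of_pos hq0, div_eq_mul_one_div c,
      mul_comm c, mul_assoc]
    refine mul_le_mul_of_nonneg_left ((hL _ _).trans ?_) hq0.le
    have e : ((t : ℝ) / n - u) / h - ((s : ℝ) / n - u) / h = ((t - s : ℤ) : ℝ) / (n * h) := by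
      push_cast; field_simp; ring
    rw [e, abs_div, abs_of_pos hnh0]
    push_cast
    refine mul_le_mul_of_nonneg_right ?_ (by positivity)
    rw [hc]; nlinarith
  · have h1 := (abs_le.1 r₀).2
    rw [hK.integral_eq_one, Finset.mul_sum] at h1
    simp only [kernelWeight, Int.cast_natCast]
    have h2 : L * (1 / (n * h)) * (1 + 1 / (n * h)) ≤ L * 1 * (1 + 1) := by gcongr
    rw [hc]; nlinarith
  · have e : ∑ t ∈ Finset.Icc 1 n, kernelWeight K n h u t * ((t : ℝ) / n - u) =
        (1 / (n * h) * ∑ t ∈ Finset.Icc 1 n,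
          K (((t : ℝ) / n - u) / h) * (((t : ℝ) / n - u) / h) - ∫ x, K x * x) * h := by
      rw [hodd, sub_zero, Finset.mul_sum, Finset.sum_mul]
      refine Finset.sum_congr rfl fun t _ => ?_
      simp only [kernelWeight, Int.cast_natCast]
      field_simp
    rw [e, abs_mul, abs_of_pos hh]
    exact mul_le_mul_of_nonneg_right (r₁.trans (two _ (by positivity) (by rw [hc]; nlinarith)))
      hh.le
  · have e : ∑ t ∈ Finset.Icc 1 n, kernelWeight K n h u t * ((t : ℝ) / n - u) ^ 2 -
        h ^ 2 * kernelSecondMoment K = (1 / (n * h) * ∑ t ∈ Finset.Icc 1 n,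
          K (((t : ℝ) / n - u) / h) * (((t : ℝ) / n - u) / h) ^ 2 - ∫ x, K x * x ^ 2) * h ^ 2 := by
      rw [sub_mul, kernelSecondMoment, mul_comm (h ^ 2), Finset.mul_sum, Finset.sum_mul]
      congr 1
      refine Finset.sum_congr rfl fun t _ => ?_
      simp only [kernelWeight, Int.cast_natCast]
      field_simp
    rw [e, abs_mul, abs_of_nonneg (sq_nonneg h)]
    exact mul_le_mul_of_nonneg_right (r₂.trans (two _ (by positivity) (by rw [hc]; nlinarith)))
      (sq_nonneg h)
  · have e : ∑ t ∈ Finset.Icc 1 n, kernelWeight K n h u t ^ 2 - kernelSq K / (n * h) =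
        (1 / (n * h) * ∑ t ∈ Finset.Icc 1 n,
          K (((t : ℝ) / n - u) / h) * K (((t : ℝ) / n - u) / h) - ∫ x, K x * K x) / (n * h) := by
      rw [sub_div, kernelSq, Finset.mul_sum, Finset.sum_div]
      simp only [← sq]
      congr 1
      refine Finset.sum_congr rfl fun t _ => ?_
      simp only [kernelWeight, Int.cast_natCast]
      rw [mul_pow]
      ring
    rw [e, abs_div, abs_of_pos hnh0]
    exact div_le_div_of_nonneg_right (r₃.trans (two _ (by positivity) (by rw [hc]; nlinarith)))
      hnh0.le

end kernel

/-! ### Approximation of the observed past by the stationary past -/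

section approximation

variable {Ω : Type*} [MeasurableSpace Ω] {μ : Measure Ω} {M : ℕ} {D C : ℝ} {χ : ℕ → ℝ}
  {X : ℕ → ℕ → Ω → ℝ} {Xs : ℝ → ℤ → Ω → ℝ} {f : (ℕ → ℝ) → ℝ}

/-- The tail sum `∑_{i ≥ t} χᵢ` of the weights. -/
noncomputable def weightTail (χ : ℕ → ℝ) (t : ℕ) : ℝ := ∑' i, if t ≤ i then χ i else 0

theorem summable_weightTail (hχ : ∀ i, 0 ≤ χ i) (hs : Summable χ) (t : ℕ) :
    Summable fun i => if t ≤ i then χ i else 0 :=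
  Summable.of_nonneg_of_le (fun i => by split_ifs <;> simp [hχ i])
    (fun i => by split_ifs <;> simp [hχ i]) hs

theorem weightTail_nonneg (hχ : ∀ i, 0 ≤ χ i) (t : ℕ) : 0 ≤ weightTail χ t :=
  tsum_nonneg fun i => by split_ifs <;> simp [hχ i]

theorem sum_weightTail_le (hχ : ∀ i, 0 ≤ χ i) (hs : Summable χ)
    (hs' : Summable fun i : ℕ => χ i * i) (n : ℕ) :
    ∑ t ∈ Finset.Icc 1 n, weightTail χ t ≤ ∑' i : ℕ, χ i * i := by
  unfold weightTail
  rw [← Summable.tsum_finsetSum fun t _ => summable_weightTail hχ hs t]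
  refine (summable_sum fun t _ => summable_weightTail hχ hs t).tsum_le_tsum (fun i => ?_) hs'
  rw [← Finset.sum_filter, Finset.sum_const, nsmul_eq_mul, mul_comm]
  refine mul_le_mul_of_nonneg_left ?_ (hχ i)
  have : (Finset.Icc 1 n).filter (fun t => t ≤ i) ⊆ Finset.Icc 1 i := by
    intro t ht
    simp only [Finset.mem_filter, Finset.mem_Icc] at ht ⊢
    exact ⟨ht.1.1, ht.2⟩
  have := Finset.card_le_card this
  rw [Nat.card_Icc, Nat.add_sub_cancel] at this
  exact_mod_cast this

theorem measurable_obsPast {q : ℝ≥0∞} (hX : IsLocallyStationary μ q D X Xs) {n t : ℕ}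
    (htn : t ≤ n) : Measurable (obsPast X n t) := by
  refine measurable_pi_lambda _ fun i => ?_
  by_cases hi : i < t
  · simp only [obsPast, hi, if_true]
    exact hX.measurable_array n (t - i) (by omega) (by omega)
  · simp only [obsPast, hi, if_false]
    exact measurable_const

theorem IsLocallyStationary.seqNorm_obsPast_le {q : ℝ≥0∞} (hX : IsLocallyStationary μ q D X Xs)
    {n t : ℕ} (htn : t ≤ n) :
    seqNorm χ q μ (obsPast X n t) ≤ (∑' i, ENNReal.ofReal (χ i)) * ENNReal.ofReal D := by
  refine seqNorm_le_mul fun i => ?_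
  by_cases hi : i < t
  · simp only [obsPast, hi, if_true]
    exact hX.moment_array n (t - i) (by omega) (by omega)
  · simp only [obsPast, hi, if_false]
    simp

theorem div_mem_unitInterval {n t : ℕ} (h : t ≤ n) : (t : ℝ) / n ∈ Set.Icc (0 : ℝ) 1 := by
  refine ⟨by positivity, ?_⟩
  rcases Nat.eq_zero_or_pos n with rfl | hn
  · simp
  · rw [div_le_one (by exact_mod_cast hn)]; exact_mod_cast h

/-- The observed and the stationary past at time `t` differ by `O((1 + i) / n)` in the coordinate
`i < t`, because of the local stationarity and of the shift of the rescaled time by `i / n`, and by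
`O(1)` in the truncated coordinates `i ≥ t`. -/
theorem IsLocallyStationary.seqNorm_obsPast_sub_le [IsProbabilityMeasure μ] {p q : ℝ≥0∞}
    (hp : 1 ≤ p) (hpq : p ≤ q) (hX : IsLocallyStationary μ q D X Xs)
    (hlip : ∀ t, ∀ u ∈ Set.Icc (0 : ℝ) 1, ∀ v ∈ Set.Icc (0 : ℝ) 1,
      eLpNorm (fun ω => Xs u t ω - Xs v t ω) p μ ≤ ENNReal.ofReal |u - v| * ENNReal.ofReal D)
    (hχ : ∀ i, 0 ≤ χ i) (hs : Summable χ) (hs' : Summable fun i : ℕ => χ i * i) {n t : ℕ}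
    (htn : t ≤ n) :
    seqNorm χ p μ (fun ω => obsPast X n t ω - statPast Xs ((t : ℝ) / n) t ω) ≤
      ENNReal.ofReal (((∑' i, χ i) * (1 / n) + (∑' i : ℕ, χ i * i) * (1 / n) + weightTail χ t)) *
        ENNReal.ofReal D := by
  have hu := div_mem_unitInterval htn
  have key : ∀ i, eLpNorm (fun ω => (obsPast X n t ω - statPast Xs ((t : ℝ) / n) t ω) i) p μ ≤
      ENNReal.ofReal (1 / n + i * (1 / n) + if t ≤ i then 1 else 0) * ENNReal.ofReal D := by
    intro i
    by_cases hi : i < t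
    · have hti : ¬ t ≤ i := by omega
      have hv := div_mem_unitInterval (show t - i ≤ n by omega)
      have mX := (hX.measurable_array n (t - i) (by omega) (by omega))
      have m₁ := hX.measurable_approx _ hu ((t : ℤ) - i)
      have m₂ := hX.measurable_approx _ hv ((t : ℤ) - i)
      have e : (fun ω => (obsPast X n t ω - statPast Xs ((t : ℝ) / n) t ω) i) =
          (fun ω => X n (t - i) ω - Xs (((t - i : ℕ) : ℝ) / n) ((t : ℤ) - i) ω) +
          (fun ω => Xs (((t - i : ℕ) : ℝ) / n) ((t : ℤ) - i) ω -
            Xs ((t : ℝ) / n) ((t : ℤ) - i) ω) := by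
        ext ω; simp [obsPast, statPast, hi]
      rw [e]
      refine (eLpNorm_add_le (mX.sub m₂).aestronglyMeasurable (m₂.sub m₁).aestronglyMeasurable
        hp).trans ?_
      have b₁ : eLpNorm (fun ω => X n (t - i) ω - Xs (((t - i : ℕ) : ℝ) / n) ((t : ℤ) - i) ω) p μ ≤
          ENNReal.ofReal (1 / n) * ENNReal.ofReal D := by
        refine (eLpNorm_le_eLpNorm_of_exponent_le hpq (mX.sub m₂).aestronglyMeasurable).trans ?_
        have h := hX.approx n (t - i) (by omega) (by omega)
        rw [Nat.cast_sub hi.le (R := ℤ)] at h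
        refine h.trans_eq ?_
        rw [mul_comm, ENNReal.ofReal_mul (by positivity), one_div]
      have b₂ := hlip ((t : ℤ) - i) _ hv _ hu
      have e₂ : |((t - i : ℕ) : ℝ) / n - (t : ℝ) / n| = i * (1 / n) := by
        rw [Nat.cast_sub hi.le, ← sub_div, sub_sub_cancel_left, neg_div, abs_neg,
          abs_of_nonneg (by positivity)]
        ring
      rw [e₂] at b₂
      refine (add_le_add b₁ b₂).trans_eq ?_
      rw [← add_mul, ← ENNReal.ofReal_add (by positivity) (by positivity)]
      simp [hti]
    · have hti : t ≤ i := by omega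
      have e : (fun ω => (obsPast X n t ω - statPast Xs ((t : ℝ) / n) t ω) i) =
          -(Xs ((t : ℝ) / n) ((t : ℤ) - i)) := by
        ext ω; simp [obsPast, statPast, hi]
      rw [e, eLpNorm_neg]
      refine (eLpNorm_le_eLpNorm_of_exponent_le hpq
        (hX.measurable_approx _ hu _).aestronglyMeasurable).trans ((hX.moment hu _).trans ?_)
      refine le_mul_of_one_le_left zero_le ?_
      rw [← ENNReal.ofReal_one]
      refine ENNReal.ofReal_le_ofReal ?_
      simp only [hti, if_true]
      have : (0 : ℝ) ≤ 1 / n + i * (1 / n) := by positivity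
      linarith
  calc _ ≤ ∑' i, ENNReal.ofReal (χ i) *
        (ENNReal.ofReal (1 / n + i * (1 / n) + if t ≤ i then 1 else 0) * ENNReal.ofReal D) :=
        ENNReal.tsum_le_tsum fun i => by gcongr; exact key i
    _ = (∑' i, ENNReal.ofReal (χ i * (1 / n) + χ i * i * (1 / n) + if t ≤ i then χ i else 0)) *
        ENNReal.ofReal D := by
        rw [← ENNReal.tsum_mul_right]
        refine tsum_congr fun i => ?_
        rw [← mul_assoc, ← ENNReal.ofReal_mul (hχ i)]
        congr 2
        split_ifs <;> ring
    _ = _ := by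
        have s₁ := hs.mul_right (1 / n : ℝ)
        have s₂ := hs'.mul_right (1 / n : ℝ)
        have s₃ := summable_weightTail hχ hs t
        rw [← ENNReal.ofReal_tsum_of_nonneg _ ((s₁.add s₂).add s₃), (s₁.add s₂).tsum_add s₃,
          s₁.tsum_add s₂, tsum_mul_right, tsum_mul_right]
        · rfl
        · intro i
          have := hχ i
          split_ifs <;> positivity

/-- The cost in `L^m` of replacing the observations by the stationary approximations, given the
Lipschitz continuity of the latter in `L^{mM}`. -/
theorem ClassH.exists_eLpNorm_obsPast_sub_le [IsProbabilityMeasure μ] {m : ℕ} (hm : m ≠ 0)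
    (hm2 : m ≤ 2) (hX : IsLocallyStationary μ (2 * M : ℕ) D X Xs)
    (hlip : ∀ t, ∀ u ∈ Set.Icc (0 : ℝ) 1, ∀ v ∈ Set.Icc (0 : ℝ) 1,
      eLpNorm (fun ω => Xs u t ω - Xs v t ω) (m * M : ℕ) μ ≤
        ENNReal.ofReal |u - v| * ENNReal.ofReal D)
    (hf : ClassH M χ C f) :
    ∃ c : ℝ, 0 ≤ c ∧ ∀ n t : ℕ, t ≤ n →
      eLpNorm (fun ω => f (obsPast X n t ω) - f (statPast Xs ((t : ℝ) / n) t ω)) m μ ≤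
        ENNReal.ofReal (c * (1 / n + weightTail χ t)) := by
  have hχ := hf.weight_nonneg
  have hM := hf.one_le
  have hmM : m * M ≠ 0 := mul_ne_zero hm (by omega)
  have hp1 : (1 : ℝ≥0∞) ≤ (m * M : ℕ) := by exact_mod_cast Nat.one_le_iff_ne_zero.2 hmM
  have hpq : ((m * M : ℕ) : ℝ≥0∞) ≤ (2 * M : ℕ) := by
    exact_mod_cast Nat.mul_le_mul_right M hm2
  set A := ∑' i, χ i
  set A' := ∑' i : ℕ, χ i * i
  have hA : 0 ≤ A := tsum_nonneg hχ
  have hA' : 0 ≤ A' := tsum_nonneg fun i => mul_nonneg (hχ i) (by positivity)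
  set K := (∑' i, ENNReal.ofReal (χ i)) * ENNReal.ofReal D with hK
  have hKt : K ≠ ∞ := ENNReal.mul_ne_top hf.tsum_weight_ne_top ENNReal.ofReal_ne_top
  set E := ENNReal.ofReal (3 * C) * (ENNReal.ofReal D * (1 + K + K) ^ (M - 1)) with hE
  have hEt : E ≠ ∞ := ENNReal.mul_ne_top ENNReal.ofReal_ne_top (ENNReal.mul_ne_top
    ENNReal.ofReal_ne_top (ENNReal.pow_ne_top (by simp [hKt])))
  refine ⟨(A + A' + 1) * E.toReal, by positivity, fun n t htn => ?_⟩
  have hu := div_mem_unitInterval htn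
  have mo := measurable_obsPast hX htn
  have ms := measurable_statPast hX hu t
  have mo' := fun i => ((measurable_pi_apply i).comp mo).aemeasurable (μ := μ)
  have ms' := fun i => ((measurable_pi_apply i).comp ms).aemeasurable (μ := μ)
  have so : seqNorm χ (m * M : ℕ) μ (obsPast X n t) ≤ K :=
    (seqNorm_mono_exponent hpq mo').trans (hX.seqNorm_obsPast_le htn)
  have ss : seqNorm χ (m * M : ℕ) μ (statPast Xs ((t : ℝ) / n) t) ≤ K :=
    (seqNorm_mono_exponent hpq ms').trans (hX.seqNorm_statPast_le hu t)
  refine (hf.eLpNorm_comp_sub_le (x := obsPast X n t) (y := statPast Xs ((t : ℝ) / n) t) hm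
    mo' ms' (ne_top_of_le_ne_top hKt so)
    (ne_top_of_le_ne_top hKt ss)).trans ?_
  have hw := weightTail_nonneg hχ t
  calc _ ≤ ENNReal.ofReal (3 * C) * (ENNReal.ofReal (A * (1 / n) + A' * (1 / n) +
        weightTail χ t) * ENNReal.ofReal D * (1 + K + K) ^ (M - 1)) := by
        gcongr
        exact hX.seqNorm_obsPast_sub_le hp1 hpq hlip hχ hf.summable_weight
          hf.summable_weight_mul htn
    _ = ENNReal.ofReal (A * (1 / n) + A' * (1 / n) + weightTail χ t) * E := by rw [hE]; ring
    _ ≤ ENNReal.ofReal ((A + A' + 1) * (1 / n + weightTail χ t)) * ENNReal.ofReal E.toReal := by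
        rw [ENNReal.ofReal_toReal hEt]
        gcongr
        have : (0 : ℝ) ≤ 1 / n := by positivity
        nlinarith [mul_nonneg hA hw, mul_nonneg hA' hw]
    _ = _ := by
        rw [← ENNReal.ofReal_mul (by positivity)]
        congr 1; ring

theorem ClassH.memLp_obsPast [IsProbabilityMeasure μ]
    (hX : IsLocallyStationary μ (2 * M : ℕ) D X Xs) (hf : ClassH M χ C f) (hfm : Measurable f)
    {n t : ℕ} (htn : t ≤ n) : MemLp (fun ω => f (obsPast X n t ω)) 2 μ := by
  have hm := measurable_obsPast hX htn
  refine hf.memLp_comp (m := 2) two_ne_zero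
    (fun i => ((measurable_pi_apply i).comp hm).aemeasurable) (hfm.comp hm).aemeasurable ?_
  exact ne_top_of_le_ne_top (ENNReal.mul_ne_top hf.tsum_weight_ne_top ENNReal.ofReal_ne_top)
    (hX.seqNorm_obsPast_le htn)

end approximation

/-! ### The bias -/

section taylor

variable {F : Type*} [NormedAddCommGroup F] [NormedSpace ℝ F]

/-- Second order Taylor expansion, uniformly in the centre. -/
theorem exists_forall_norm_taylor_le {G : ℝ → F} (hG : ContDiffOn ℝ 2 G (Set.Icc 0 1)) {ε : ℝ}
    (hε : 0 < ε) : ∃ δ > 0, ∀ u ∈ Set.Icc (0 : ℝ) 1, ∀ v ∈ Set.Icc (0 : ℝ) 1, |v - u| < δ →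
      ‖G v - G u - (v - u) • iteratedDerivWithin 1 G (Set.Icc 0 1) u -
        ((v - u) ^ 2 / 2) • iteratedDerivWithin 2 G (Set.Icc 0 1) u‖ ≤ ε * (v - u) ^ 2 := by
  set I := Set.Icc (0 : ℝ) 1
  have hI := uniqueDiffOn_unitInterval
  have hc : ContinuousOn (iteratedDerivWithin 2 G I) I :=
    hG.continuousOn_iteratedDerivWithin (m := 2) (by norm_num) hI
  obtain ⟨δ, hδ, hu⟩ := Metric.uniformContinuousOn_iff.1
    (isCompact_Icc.uniformContinuousOn_of_continuous hc) ε hε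
  refine ⟨δ, hδ, fun u hu' v hv huv => ?_⟩
  set G₁ := iteratedDerivWithin 1 G I
  set G₂ := iteratedDerivWithin 2 G I
  set J := Set.uIcc u v
  have hJI : J ⊆ I := (Set.ordConnected_Icc).uIcc_subset hu' hv
  have hJ : ∀ w ∈ J, |w - u| ≤ |v - u| := fun w hw => Set.abs_sub_left_of_mem_uIcc hw
  have d₁ : ∀ w ∈ J, HasDerivWithinAt (fun w => G₁ w - w • G₂ u) (G₂ w - G₂ u) J w := by
    intro w hw
    have h1 := (hG.hasDerivWithinAt_iteratedDerivWithin hI (hJI hw)).2.mono hJI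
    have h2 := ((hasDerivAt_id w).smul_const (G₂ u)).hasDerivWithinAt (s := J)
    simp only [id, one_smul] at h2
    exact h1.sub h2
  have b₁ : ∀ w ∈ J, ‖G₂ w - G₂ u‖ ≤ ε := by
    intro w hw
    rw [← dist_eq_norm]
    refine (hu w (hJI hw) u hu' ?_).le
    rw [Real.dist_eq]
    exact (hJ w hw).trans_lt huv
  have b₂ : ∀ w ∈ J, ‖G₁ w - G₁ u - (w - u) • G₂ u‖ ≤ ε * |v - u| := by
    intro w hw
    have h := Convex.norm_image_sub_le_of_norm_hasDerivWithin_le d₁ b₁ (convex_uIcc _ _)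
      Set.left_mem_uIcc hw
    have e : G₁ w - w • G₂ u - (G₁ u - u • G₂ u) = G₁ w - G₁ u - (w - u) • G₂ u := by
      rw [sub_smul]; abel
    rw [e] at h
    exact h.trans (mul_le_mul_of_nonneg_left (hJ w hw) hε.le)
  have d₂ : ∀ w ∈ J, HasDerivWithinAt
      (fun w => G w - (w - u) • G₁ u - ((w - u) ^ 2 / 2) • G₂ u)
      (G₁ w - G₁ u - (w - u) • G₂ u) J w := by
    intro w hw
    have h1 := (hG.hasDerivWithinAt_iteratedDerivWithin hI (hJI hw)).1.mono hJI
    have h2 := (((hasDerivAt_id w).sub_const u).smul_const (G₁ u)).hasDerivWithinAt (s := J)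
    have h3 := ((((((hasDerivAt_id w).sub_const u).pow 2).div_const 2).smul_const
      (G₂ u))).hasDerivWithinAt (s := J)
    simp only [id, one_smul] at h2 h3
    exact (h1.sub h2).sub (h3.congr_deriv (by norm_num))
  have h := Convex.norm_image_sub_le_of_norm_hasDerivWithin_le d₂ b₂ (convex_uIcc _ _)
    Set.left_mem_uIcc Set.right_mem_uIcc
  have e : G v - (v - u) • G₁ u - ((v - u) ^ 2 / 2) • G₂ u -
      (G u - (u - u) • G₁ u - ((u - u) ^ 2 / 2) • G₂ u) =
      G v - G u - (v - u) • G₁ u - ((v - u) ^ 2 / 2) • G₂ u := by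
    simp; abel
  rw [e] at h
  refine h.trans_eq ?_
  rw [Real.norm_eq_abs, mul_assoc, ← sq, sq_abs]

/-- Kernel averages of values which are close to those of a twice continuously differentiable
function: the second order expansion of their bias. -/
theorem exists_norm_kernel_average_sub_le {K : ℝ → ℝ} (hK : IsKernel K) {G : ℝ → F}
    (hG : ContDiffOn ℝ 2 G (Set.Icc 0 1)) {m : ℕ → ℕ → F} {r : ℕ → ℝ} {c₀ R : ℝ} (hc₀ : 0 ≤ c₀)
    (hr : ∀ t, 0 ≤ r t) (hR : ∀ n, ∑ t ∈ Finset.Icc 1 n, r t ≤ R)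
    (hm : ∀ n t : ℕ, t ≤ n → ‖m n t - G ((t : ℝ) / n)‖ ≤ c₀ * (1 / n + r t)) :
    ∃ c : ℝ, 0 ≤ c ∧ ∀ ε > (0 : ℝ), ∃ δ > (0 : ℝ), δ ≤ 1 ∧ ∀ (n : ℕ) (h : ℝ),
      0 < h → h ≤ δ → 1 ≤ n → 1 ≤ n * h → ∀ u ∈ Set.Icc (h / 2) (1 - h / 2),
        ‖∑ t ∈ Finset.Icc 1 n, kernelWeight K n h u t • m n t - G u
            - (h ^ 2 / 2 * kernelSecondMoment K) • iteratedDerivWithin 2 G (Set.Icc 0 1) u‖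
          ≤ c / (n * h) + ε * h ^ 2 := by
  set I := Set.Icc (0 : ℝ) 1
  have hI := uniqueDiffOn_unitInterval
  set G₁ := iteratedDerivWithin 1 G I
  set G₂ := iteratedDerivWithin 2 G I
  obtain ⟨B₀, hB₀⟩ := isCompact_Icc.exists_bound_of_continuousOn hG.continuousOn
  obtain ⟨B₁, hB₁⟩ := isCompact_Icc.exists_bound_of_continuousOn
    (hG.continuousOn_iteratedDerivWithin (m := 1) (by norm_num) hI)
  obtain ⟨B₂, hB₂⟩ := isCompact_Icc.exists_bound_of_continuousOn
    (hG.continuousOn_iteratedDerivWithin (m := 2) (by norm_num) hI)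
  have h01 : (0 : ℝ) ∈ I := by simp [I]
  have hB₀0 : 0 ≤ B₀ := (norm_nonneg _).trans (hB₀ 0 h01)
  have hB₁0 : 0 ≤ B₁ := (norm_nonneg _).trans (hB₁ 0 h01)
  have hB₂0 : 0 ≤ B₂ := (norm_nonneg _).trans (hB₂ 0 h01)
  have hR0 : 0 ≤ R := by simpa using hR 0
  obtain ⟨a, ha1, ha⟩ := hK.exists_bounds
  refine ⟨a * (c₀ + c₀ * R + B₀ + B₁ + B₂), by positivity, fun ε hε => ?_⟩
  obtain ⟨δ, hδ, hT⟩ := exists_forall_norm_taylor_le hG (ε := ε / a) (by positivity)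
  refine ⟨min δ 1, lt_min hδ one_pos, min_le_right _ _, fun n h hh hhδ hn hnh u hu => ?_⟩
  have kb := ha n h u hn hh hnh hu
  have hn0 : (0 : ℝ) < n := by exact_mod_cast hn
  have hnh0 : 0 < n * h := by positivity
  have hh1 : h ≤ 1 := hhδ.trans (min_le_right _ _)
  have huI : u ∈ I := ⟨by linarith [hu.1], by linarith [hu.2]⟩
  set w : ℕ → ℝ := fun t => kernelWeight K n h u t
  have hw0 : ∀ t, 0 ≤ w t := fun t => kb.nonneg t
  set x : ℕ → ℝ := fun t => (t : ℝ) / n - u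
  set T : ℕ → F := fun t => G ((t : ℝ) / n) - G u - x t • G₁ u - (x t ^ 2 / 2) • G₂ u
  set s := Finset.Icc 1 n
  -- the mean is replaced by `G`, and the Taylor expansion of `G` at `u` is summed term by term
  have decomp : ∑ t ∈ s, w t • m n t - G u - (h ^ 2 / 2 * kernelSecondMoment K) • G₂ u =
      ∑ t ∈ s, w t • (m n t - G ((t : ℝ) / n)) + (∑ t ∈ s, w t - 1) • G u +
        (∑ t ∈ s, w t * x t) • G₁ u +
        (1 / 2 * (∑ t ∈ s, w t * x t ^ 2 - h ^ 2 * kernelSecondMoment K)) • G₂ u +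
        ∑ t ∈ s, w t • T t := by
    simp only [T, smul_sub, Finset.sum_sub_distrib, sub_smul, Finset.sum_smul, mul_sub,
      Finset.mul_sum, smul_smul, one_smul]
    have e : ∀ t, (w t * (x t ^ 2 / 2)) • G₂ u = (1 / 2 * (w t * x t ^ 2)) • G₂ u := fun t => by
      congr 1; ring
    simp only [e]
    rw [show h ^ 2 / 2 * kernelSecondMoment K = 1 / 2 * (h ^ 2 * kernelSecondMoment K) by ring]
    abel
  have e₁ : ‖∑ t ∈ s, w t • (m n t - G ((t : ℝ) / n))‖ ≤ a * (c₀ + c₀ * R) / (n * h) := by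
    calc _ ≤ ∑ t ∈ s, w t * (c₀ * (1 / n)) + ∑ t ∈ s, w t * (c₀ * r t) := by
          rw [← Finset.sum_add_distrib]
          refine norm_sum_le_of_le _ fun t ht => ?_
          rw [norm_smul, Real.norm_eq_abs, abs_of_nonneg (hw0 t), ← mul_add, ← mul_add]
          exact mul_le_mul_of_nonneg_left (hm n t (Finset.mem_Icc.1 ht).2) (hw0 t)
      _ ≤ a * (c₀ * (1 / (n * h))) + a / (n * h) * (c₀ * R) := by
          refine add_le_add ?_ ?_
          · rw [← Finset.sum_mul]
            have h1 : (1 : ℝ) / n ≤ 1 / (n * h) :=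
              one_div_le_one_div_of_le hnh0 (mul_le_of_le_one_right hn0.le hh1)
            exact mul_le_mul kb.sum_le (mul_le_mul_of_nonneg_left h1 hc₀) (by positivity)
              (by linarith)
          · calc _ ≤ ∑ t ∈ s, a / (n * h) * (c₀ * r t) := Finset.sum_le_sum fun t _ =>
                  mul_le_mul_of_nonneg_right (kb.le t) (mul_nonneg hc₀ (hr t))
              _ = a / (n * h) * (c₀ * ∑ t ∈ s, r t) := by
                  rw [← Finset.mul_sum, ← Finset.mul_sum]
              _ ≤ _ := by gcongr; exact hR n
      _ = _ := by ring
  have e₂ : ‖(∑ t ∈ s, w t - 1) • G u‖ ≤ a * B₀ / (n * h) := by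
    rw [norm_smul, Real.norm_eq_abs]
    refine (mul_le_mul kb.sum_zero (hB₀ u huI) (norm_nonneg _) (by positivity)).trans_eq ?_
    ring
  have e₃ : ‖(∑ t ∈ s, w t * x t) • G₁ u‖ ≤ a * B₁ / (n * h) := by
    rw [norm_smul, Real.norm_eq_abs]
    refine (mul_le_mul kb.sum_one (hB₁ u huI) (norm_nonneg _) (by positivity)).trans ?_
    have : a / (n * h) * h ≤ a / (n * h) * 1 := by gcongr
    calc _ ≤ a / (n * h) * 1 * B₁ := by gcongr
      _ = _ := by ring
  have e₄ : ‖(1 / 2 * (∑ t ∈ s, w t * x t ^ 2 - h ^ 2 * kernelSecondMoment K)) • G₂ u‖ ≤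
      a * B₂ / (n * h) := by
    rw [norm_smul, Real.norm_eq_abs, abs_mul, abs_of_pos (by norm_num : (0 : ℝ) < 1 / 2)]
    have h1 := kb.sum_two
    have h2 : a / (n * h) * h ^ 2 ≤ a / (n * h) * 1 := by
      gcongr; exact pow_le_one₀ hh.le hh1
    have h3 : 1 / 2 * |∑ t ∈ s, w t * x t ^ 2 - h ^ 2 * kernelSecondMoment K| ≤ a / (n * h) := by
      have := abs_nonneg (∑ t ∈ s, w t * x t ^ 2 - h ^ 2 * kernelSecondMoment K)
      linarith
    refine (mul_le_mul h3 (hB₂ u huI) (norm_nonneg _) (by positivity)).trans_eq ?_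
    ring
  have e₅ : ‖∑ t ∈ s, w t • T t‖ ≤ ε * h ^ 2 := by
    calc _ ≤ ∑ t ∈ s, w t * (ε / a * h ^ 2) := by
          refine norm_sum_le_of_le _ fun t ht => ?_
          rw [norm_smul, Real.norm_eq_abs, abs_of_nonneg (hw0 t)]
          rcases eq_or_ne (w t) 0 with h0 | h0
          · rw [h0]; simp
          · refine mul_le_mul_of_nonneg_left ?_ (hw0 t)
            have hnear : |x t| ≤ h / 2 := by simpa [x] using kb.near t h0
            refine (hT u huI _ (div_mem_unitInterval (Finset.mem_Icc.1 ht).2) ?_).trans ?_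
            · calc |x t| ≤ h / 2 := hnear
                _ < h := by linarith
                _ ≤ δ := hhδ.trans (min_le_left _ _)
            · refine mul_le_mul_of_nonneg_left ?_ (by positivity)
              rw [← sq_abs]
              exact pow_le_pow_left₀ (abs_nonneg _) (hnear.trans (by linarith)) 2
      _ ≤ a * (ε / a * h ^ 2) := by
          rw [← Finset.sum_mul]
          exact mul_le_mul_of_nonneg_right kb.sum_le (by positivity)
      _ = ε * h ^ 2 := by field_simp
  rw [decomp]
  refine (norm_add_le_of_le (norm_add_le_of_le (norm_add_le_of_le (norm_add_le_of_le e₁ e₂) e₃)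
    e₄) e₅).trans_eq ?_
  ring

end taylor

section bias

theorem estimator_eq {Ω : Type*} {d : ℕ} (K : ℝ → ℝ) (X : ℕ → ℕ → Ω → ℝ)
    (g : (ℕ → ℝ) → EuclideanSpace ℝ (Fin d)) (n : ℕ) (h u : ℝ) (ω : Ω) :
    estimator K X g n h u ω =
      ∑ t ∈ Finset.Icc 1 n, kernelWeight K n h u t • g (obsPast X n t ω) := by
  rw [estimator, Finset.smul_sum]
  refine Finset.sum_congr rfl fun t _ => ?_
  rw [smul_smul, inv_mul_scaledKernel]

variable {Ω : Type*} [MeasurableSpace Ω] {μ : Measure Ω} {M d : ℕ} {D C : ℝ} {χ : ℕ → ℝ}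
  {X : ℕ → ℕ → Ω → ℝ} {Xs : ℝ → ℤ → Ω → ℝ} {g : (ℕ → ℝ) → EuclideanSpace ℝ (Fin d)} {K : ℝ → ℝ}

theorem memLp_statPast [IsProbabilityMeasure μ] (hX : IsLocallyStationary μ (2 * M : ℕ) D X Xs)
    (hgm : Measurable g) (hg : ∀ j, SmoothClassH M χ C fun x => g x j) {u : ℝ}
    (hu : u ∈ Set.Icc (0 : ℝ) 1) (t : ℤ) : MemLp (fun ω => g (statPast Xs u t ω)) 2 μ :=
  MemLp.of_eval_piLp fun j => (hg j).mem.memLp_statPast hX (by fun_prop) hu t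

theorem memLp_obsPast [IsProbabilityMeasure μ] (hX : IsLocallyStationary μ (2 * M : ℕ) D X Xs)
    (hgm : Measurable g) (hg : ∀ j, SmoothClassH M χ C fun x => g x j) {n t : ℕ} (htn : t ≤ n) :
    MemLp (fun ω => g (obsPast X n t ω)) 2 μ :=
  MemLp.of_eval_piLp fun j => (hg j).mem.memLp_obsPast hX (by fun_prop) htn

theorem memLp_estimator [IsProbabilityMeasure μ] (hX : IsLocallyStationary μ (2 * M : ℕ) D X Xs)
    (hgm : Measurable g) (hg : ∀ j, SmoothClassH M χ C fun x => g x j) (n : ℕ) (h u : ℝ) :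
    MemLp (estimator K X g n h u) 2 μ := by
  have e : estimator K X g n h u =
      fun ω => ∑ t ∈ Finset.Icc 1 n, kernelWeight K n h u t • g (obsPast X n t ω) :=
    funext fun ω => estimator_eq K X g n h u ω
  rw [e]
  exact memLp_finsetSum _ fun t ht =>
    (memLp_obsPast hX hgm hg (Finset.mem_Icc.1 ht).2).const_smul (kernelWeight K n h u t)

theorem integral_estimator [IsProbabilityMeasure μ]
    (hX : IsLocallyStationary μ (2 * M : ℕ) D X Xs) (hgm : Measurable g)
    (hg : ∀ j, SmoothClassH M χ C fun x => g x j) (n : ℕ) (h u : ℝ) :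
    ∫ ω, estimator K X g n h u ω ∂μ =
      ∑ t ∈ Finset.Icc 1 n, kernelWeight K n h u t • ∫ ω, g (obsPast X n t ω) ∂μ := by
  simp only [estimator_eq]
  have hi : ∀ t ∈ Finset.Icc 1 n,
      Integrable (fun ω => kernelWeight K n h u t • g (obsPast X n t ω)) μ := fun t ht =>
    ((memLp_obsPast hX hgm hg (Finset.mem_Icc.1 ht).2).integrable one_le_two).smul
      (kernelWeight K n h u t)
  rw [integral_finsetSum _ hi]
  simp only [integral_smul]

theorem target_apply [IsProbabilityMeasure μ] (hX : IsLocallyStationary μ (2 * M : ℕ) D X Xs)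
    (hgm : Measurable g) (hg : ∀ j, SmoothClassH M χ C fun x => g x j) {u : ℝ}
    (hu : u ∈ Set.Icc (0 : ℝ) 1) (j : Fin d) (t : ℤ) :
    target μ Xs g u j = ∫ ω, g (statPast Xs u t ω) j ∂μ := by
  rw [target, eval_integral_piLp fun j =>
    ((hg j).mem.memLp_statPast hX (by fun_prop) hu 0).integrable one_le_two]
  have h := ((hX.identDistrib_statPast hu t t).comp (u := fun p => g p.1 j) (by fun_prop))
  simpa [Function.comp_def] using h.integral_eq.symm

theorem contDiffOn_target [IsProbabilityMeasure μ]
    (hX : IsLocallyStationary μ (2 * M : ℕ) D X Xs) (hpath : HasSmoothPaths μ M D Xs)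
    (hgm : Measurable g) (hg : ∀ j, SmoothClassH M χ C fun x => g x j) :
    ContDiffOn ℝ 2 (target μ Xs g) (Set.Icc 0 1) := by
  rw [contDiffOn_euclidean]
  intro j
  exact ((hg j).contDiffOn_integral_statPast hX hpath (by fun_prop)).congr
    fun u hu => target_apply hX hgm hg hu j 0

theorem norm_le_sum_abs (x : EuclideanSpace ℝ (Fin d)) : ‖x‖ ≤ ∑ j, |x j| := by
  refine abs_le_of_sq_le_sq' ?_ (Finset.sum_nonneg fun j _ => abs_nonneg _) |>.2
  rw [EuclideanSpace.norm_sq_eq]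
  simp only [Real.norm_eq_abs]
  exact Finset.sum_sq_le_sq_sum_of_nonneg fun j _ => abs_nonneg _

theorem exists_norm_integral_obsPast_sub_target_le [IsProbabilityMeasure μ]
    (hX : IsLocallyStationary μ (2 * M : ℕ) D X Xs) (hpath : HasSmoothPaths μ M D Xs)
    (hgm : Measurable g) (hg : ∀ j, SmoothClassH M χ C fun x => g x j) :
    ∃ c : ℝ, 0 ≤ c ∧ ∀ n t : ℕ, t ≤ n →
      ‖∫ ω, g (obsPast X n t ω) ∂μ - target μ Xs g ((t : ℝ) / n)‖ ≤
        c * (1 / n + weightTail χ t) := by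
  have hlip : ∀ t, ∀ u ∈ Set.Icc (0 : ℝ) 1, ∀ v ∈ Set.Icc (0 : ℝ) 1,
      eLpNorm (fun ω => Xs u t ω - Xs v t ω) (1 * M : ℕ) μ ≤
        ENNReal.ofReal |u - v| * ENNReal.ofReal D := fun t u hu v hv => by
    rw [one_mul]; exact hpath.eLpNorm_sub_le hX t hu hv
  choose c hc0 hc using fun j => (hg j).mem.exists_eLpNorm_obsPast_sub_le one_ne_zero
    one_le_two hX hlip
  refine ⟨∑ j, c j, Finset.sum_nonneg fun j _ => hc0 j, fun n t htn => ?_⟩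
  have hu := div_mem_unitInterval htn
  refine (norm_le_sum_abs _).trans ?_
  rw [Finset.sum_mul]
  refine Finset.sum_le_sum fun j _ => ?_
  have i₁ := ((hg j).mem.memLp_obsPast hX (by fun_prop) htn).integrable one_le_two
  have i₂ := ((hg j).mem.memLp_statPast hX (by fun_prop) hu t).integrable one_le_two
  have hw := weightTail_nonneg (hg j).mem.weight_nonneg t
  have h0 : 0 ≤ c j * (1 / n + weightTail χ t) := mul_nonneg (hc0 j) (by positivity)
  rw [PiLp.sub_apply, target_apply hX hgm hg hu j t, eval_integral_piLp fun j =>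
    ((hg j).mem.memLp_obsPast hX (by fun_prop) htn).integrable one_le_two, ← integral_sub i₁ i₂]
  rw [← Real.norm_eq_abs]
  refine (norm_integral_le_integral_norm _).trans ?_
  have h := hc j n t htn
  rw [Nat.cast_one, eLpNorm_one_eq_lintegral_enorm] at h
  refine (integral_norm_eq_lintegral_enorm (i₁.sub i₂).1).trans_le ?_
  exact ENNReal.toReal_le_of_le_ofReal h0 h

/-- The expansion of the bias. The constant `c` does not depend on `ε`. -/
theorem exists_bias_expansion [IsProbabilityMeasure μ]
    (hX : IsLocallyStationary μ (2 * M : ℕ) D X Xs) (hpath : HasSmoothPaths μ M D Xs)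
    (hgm : Measurable g) (hg : ∀ j, SmoothClassH M χ C fun x => g x j) (hK : IsKernel K) :
    ∃ c : ℝ, 0 ≤ c ∧ ∀ ε > (0 : ℝ), ∃ δ > (0 : ℝ), δ ≤ 1 ∧ ∀ (n : ℕ) (h : ℝ),
      0 < h → h ≤ δ → 1 ≤ n → 1 ≤ n * h → ∀ u ∈ Set.Icc (h / 2) (1 - h / 2),
        ‖(∫ ω, estimator K X g n h u ω ∂μ) - target μ Xs g u
            - (h ^ 2 / 2 * kernelSecondMoment K) • targetDeriv2 μ Xs g u‖
          ≤ c / (n * h) + ε * h ^ 2 := by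
  -- the weights are only constrained through the components of `g`, so `d = 0` is separate
  rcases Nat.eq_zero_or_pos d with rfl | hd
  · refine ⟨0, le_rfl, fun ε hε => ⟨1, one_pos, le_rfl, fun n h hh _ _ _ u _ => ?_⟩⟩
    rw [Subsingleton.elim ((∫ ω, estimator K X g n h u ω ∂μ) - target μ Xs g u
            - (h ^ 2 / 2 * kernelSecondMoment K) • targetDeriv2 μ Xs g u) 0, norm_zero]
    positivity
  have hχ := (hg ⟨0, hd⟩).mem
  obtain ⟨c₀, hc₀, hm⟩ := exists_norm_integral_obsPast_sub_target_le hX hpath hgm hg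
  obtain ⟨c, hc, h⟩ := exists_norm_kernel_average_sub_le hK (contDiffOn_target hX hpath hgm hg)
    (m := fun n t => ∫ ω, g (obsPast X n t ω) ∂μ) hc₀ (weightTail_nonneg hχ.weight_nonneg)
    (sum_weightTail_le hχ.weight_nonneg hχ.summable_weight hχ.summable_weight_mul) hm
  refine ⟨c, hc, fun ε hε => ?_⟩
  obtain ⟨δ, hδ, hδ1, H⟩ := h ε hε
  refine ⟨δ, hδ, hδ1, fun n h hh hhδ hn hnh u hu => ?_⟩
  rw [integral_estimator hX hgm hg]
  exact H n h hh hhδ hn hnh u hu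

end bias

/-! ### Covariances of functions of independent variables -/

section product

variable {ι κ E : Type*} [MeasurableSpace E] {ν : Measure E} [IsProbabilityMeasure ν]

theorem measurePreserving_comp_equiv (e : κ ≃ ι) :
    MeasurePreserving (fun x : ι → E => fun k => x (e k)) (Measure.infinitePi fun _ => ν)
      (Measure.infinitePi fun _ => ν) := by
  refine ⟨by fun_prop, Measure.eq_infinitePi _ fun s t ht => ?_⟩
  have hm : Measurable fun x : ι → E => fun k => x (e k) := by fun_prop
  rw [Measure.map_apply hm (MeasurableSet.pi s.countable_toSet fun i _ => ht i)]
  have : (fun x : ι → E => fun k => x (e k)) ⁻¹' (s : Set κ).pi t =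
      ((s.map e.toEmbedding : Finset ι) : Set ι).pi fun i => t (e.symm i) := by
    ext x
    simp only [Set.mem_preimage, Set.mem_pi, Finset.mem_coe, Finset.mem_map_equiv]
    exact ⟨fun h i hi => by simpa using h _ hi,
      fun h i hi => by simpa using h (e i) (by simpa using hi)⟩
  rw [this, Measure.infinitePi_pi _ fun i _ => ht _, Finset.prod_map]
  simp

/-- Two independent sequences of i.i.d. variables form one sequence of i.i.d. variables. -/
theorem measurePreserving_sumElim :
    MeasurePreserving (fun p : (ι → E) × (ι → E) => (Sum.elim p.1 p.2 : ι ⊕ ι → E))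
      ((Measure.infinitePi fun _ => ν).prod (Measure.infinitePi fun _ => ν))
      (Measure.infinitePi fun _ => ν) := by
  have hm : Measurable fun p : (ι → E) × (ι → E) => (Sum.elim p.1 p.2 : ι ⊕ ι → E) := by
    refine measurable_pi_lambda _ fun i => ?_
    cases i <;> simp <;> fun_prop
  refine ⟨hm, Measure.eq_infinitePi _ fun s t ht => ?_⟩
  rw [Measure.map_apply hm (MeasurableSet.pi s.countable_toSet fun i _ => ht i)]
  have : (fun p : (ι → E) × (ι → E) => (Sum.elim p.1 p.2 : ι ⊕ ι → E)) ⁻¹' (s : Set (ι ⊕ ι)).pi t =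
      ((s.toLeft : Set ι).pi fun i => t (Sum.inl i)) ×ˢ
        ((s.toRight : Set ι).pi fun i => t (Sum.inr i)) := by
    ext p; simp
  rw [this, Measure.prod_prod, Measure.infinitePi_pi _ fun i _ => ht _,
    Measure.infinitePi_pi _ fun i _ => ht _]
  conv_rhs => rw [← Finset.toLeft_disjSum_toRight (u := s)]
  rw [Finset.prod_disjSum]

open Classical in
/-- The sequence `p.1` with its coordinates in `J` replaced by those of `p.2`. -/
noncomputable def mix (J : Set ι) (p : (ι → E) × (ι → E)) : ι → E :=
  fun i => if i ∈ J then p.2 i else p.1 i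

theorem measurable_mix (J : Set ι) : Measurable (mix J : (ι → E) × (ι → E) → ι → E) := by
  refine measurable_pi_lambda _ fun i => ?_
  by_cases h : i ∈ J <;> simp only [mix, h, if_true, if_false] <;> fun_prop

/-- Exchanging the coordinates in `J` of two independent sequences with the same product law does
not change their joint law. -/
theorem measurePreserving_exchange (J : Set ι) :
    MeasurePreserving (fun p : (ι → E) × (ι → E) => (mix J p, mix J p.swap))
      ((Measure.infinitePi fun _ => ν).prod (Measure.infinitePi fun _ => ν))
      ((Measure.infinitePi fun _ => ν).prod (Measure.infinitePi fun _ => ν)) := by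
  classical
  have hS := measurePreserving_sumElim (ι := ι) (ν := ν)
  have hG : MeasurePreserving
      (fun q : ι ⊕ ι → E => ((fun i => q (Sum.inl i), fun i => q (Sum.inr i)) : (ι → E) × (ι → E)))
      (Measure.infinitePi fun _ => ν)
      ((Measure.infinitePi fun _ => ν).prod (Measure.infinitePi fun _ => ν)) := by
    refine ⟨by fun_prop, ?_⟩
    rw [← hS.map_eq, Measure.map_map (by fun_prop) hS.measurable]
    exact Measure.map_id
  have hinv : Function.Involutive (Sum.elim (fun i => if i ∈ J then Sum.inr i else Sum.inl i)
      (fun i => if i ∈ J then Sum.inl i else Sum.inr i) : ι ⊕ ι → ι ⊕ ι) := by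
    rintro (i | i) <;> by_cases h : i ∈ J <;> simp [h]
  have := hG.comp ((measurePreserving_comp_equiv (ν := ν) hinv.toPerm).comp hS)
  convert this using 1
  ext p i
  · by_cases h : i ∈ J <;> simp [mix, h]
  · by_cases h : i ∈ J <;> simp [mix, h]

theorem measurePreserving_mix (J : Set ι) :
    MeasurePreserving (mix J)
      ((Measure.infinitePi fun _ => ν).prod (Measure.infinitePi fun _ => ν))
      (Measure.infinitePi fun _ : ι => ν) :=
  measurePreserving_fst.comp (measurePreserving_exchange (ν := ν) J)

/-- The influence `‖a(x) - a(x^(j))‖_2` of the coordinate `j` on a function `a` of a sequence `x`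
of i.i.d. variables, where `x^(j)` has the coordinate `j` replaced by an independent copy. -/
noncomputable def influence (ν : Measure E) (a : (ι → E) → ℝ) (j : ι) : ℝ≥0∞ :=
  eLpNorm (fun p : (ι → E) × (ι → E) => a p.1 - a (mix {j} p)) 2
    ((Measure.infinitePi fun _ => ν).prod (Measure.infinitePi fun _ => ν))

/-- The Cauchy-Schwarz inequality. -/
theorem enorm_integral_mul_le {Ω : Type*} [MeasurableSpace Ω] {μ : Measure Ω} {f g : Ω → ℝ}
    (hf : AEStronglyMeasurable f μ) (hg : AEStronglyMeasurable g μ) :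
    ‖∫ ω, f ω * g ω ∂μ‖ₑ ≤ eLpNorm f 2 μ * eLpNorm g 2 μ := by
  refine (enorm_integral_le_lintegral_enorm _).trans ?_
  have h := eLpNorm_mul_pow_le (μ := μ) (m := 1) (M := 2) one_ne_zero one_le_two
    hf.aemeasurable.enorm hg.aemeasurable.enorm
  rw [Nat.cast_one, eLpNorm_one_eq_lintegral_enorm] at h
  simpa [eLpNorm_enorm] using h

/-- One step of the telescoping sum: the exchange of the coordinate `j` turns the increment
`b(mix J) - b(mix (insert j J))` into its negative, so that `a` may be replaced by half its
increment in the direction of `j`. -/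
theorem enorm_integral_mul_increment_le {a b : (ι → E) → ℝ}
    (ha : MemLp a 2 (Measure.infinitePi fun _ => ν))
    (hb : MemLp b 2 (Measure.infinitePi fun _ => ν)) {J : Set ι} {j : ι} (hj : j ∉ J) :
    ‖∫ p, a p.1 * (b (mix J p) - b (mix (insert j J) p))
      ∂((Measure.infinitePi fun _ => ν).prod (Measure.infinitePi fun _ => ν))‖ₑ ≤
      influence ν a j * influence ν b j := by
  classical
  set P : Measure (ι → E) := Measure.infinitePi fun _ => ν
  set Δ : (ι → E) × (ι → E) → ℝ := fun p => b (mix J p) - b (mix (insert j J) p) with hΔ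
  have mb : ∀ J', MemLp (fun p => b (mix J' p)) 2 (P.prod P) := fun J' =>
    hb.comp_measurePreserving (measurePreserving_mix J')
  have ma : MemLp (fun p : (ι → E) × (ι → E) => a p.1) 2 (P.prod P) :=
    ha.comp_measurePreserving measurePreserving_fst
  have ma' : MemLp (fun p => a (mix {j} p)) 2 (P.prod P) :=
    ha.comp_measurePreserving (measurePreserving_mix {j})
  have mΔ : MemLp Δ 2 (P.prod P) := (mb J).sub (mb (insert j J))
  have hne : ∀ i ∈ J, i ≠ j := fun i hi h => hj (h ▸ hi)
  have x₁ : ∀ p : (ι → E) × (ι → E),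
      mix J (mix {j} p, mix {j} p.swap) = mix (insert j J) p := by
    intro p; ext i
    by_cases hi : i ∈ J
    · simp [mix, hi, hne i hi]
    · by_cases hij : i = j
      · subst hij; simp [mix, hi]
      · simp [mix, hi, hij]
  have x₂ : ∀ p : (ι → E) × (ι → E),
      mix (insert j J) (mix {j} p, mix {j} p.swap) = mix J p := by
    intro p; ext i
    by_cases hi : i ∈ J
    · simp [mix, hi, hne i hi]
    · by_cases hij : i = j
      · subst hij; simp [mix, hi]
      · simp [mix, hi, hij]
  have y₁ : ∀ p : (ι → E) × (ι → E), mix J (mix J p, mix J p.swap) = p.1 := by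
    intro p; ext i
    by_cases hi : i ∈ J <;> simp [mix, hi]
  have y₂ : ∀ p : (ι → E) × (ι → E),
      mix (insert j J) (mix J p, mix J p.swap) = mix {j} p := by
    intro p; ext i
    by_cases hi : i ∈ J
    · simp [mix, hi, hne i hi]
    · by_cases hij : i = j
      · subst hij; simp [mix, hi]
      · simp [mix, hi, hij]
  have hex := measurePreserving_exchange (ν := ν) ({j} : Set ι)
  have i₁ : ∫ p, a p.1 * Δ p ∂(P.prod P) = -∫ p, a (mix {j} p) * Δ p ∂(P.prod P) := by
    have hm : AEStronglyMeasurable (fun p : (ι → E) × (ι → E) => a p.1 * Δ p) (P.prod P) :=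
      ma.1.mul mΔ.1
    rw [← hex.map_eq] at hm
    have h := integral_map hex.measurable.aemeasurable hm
    rw [hex.map_eq] at h
    rw [h, ← integral_neg]
    congr 1
    ext p
    simp only [hΔ, x₁, x₂]
    ring
  have i₂ : 2 * ∫ p, a p.1 * Δ p ∂(P.prod P) = ∫ p, (a p.1 - a (mix {j} p)) * Δ p ∂(P.prod P) := by
    have e₁ : Integrable (fun p : (ι → E) × (ι → E) => a p.1 * Δ p) (P.prod P) :=
      ma.integrable_mul mΔ
    have e₂ : Integrable (fun p => a (mix {j} p) * Δ p) (P.prod P) := ma'.integrable_mul mΔ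
    simp only [sub_mul]
    rw [integral_sub e₁ e₂]
    linarith
  have hnΔ : eLpNorm Δ 2 (P.prod P) = influence ν b j := by
    have hexJ := measurePreserving_exchange (ν := ν) J
    rw [← eLpNorm_comp_measurePreserving mΔ.1 hexJ]
    unfold influence
    congr 1
    ext p
    simp only [hΔ, Function.comp_apply, y₁, y₂]
  calc _ ≤ ‖2 * ∫ p, a p.1 * Δ p ∂(P.prod P)‖ₑ := by
        rw [enorm_mul]
        refine le_mul_of_one_le_left zero_le ?_
        rw [Real.enorm_eq_ofReal (by norm_num)]
        norm_num
    _ ≤ _ := by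
        rw [i₂, ← hnΔ]
        exact enorm_integral_mul_le (ma.sub ma').1 mΔ.1

/-- Replacing more and more coordinates by those of an independent copy, a square integrable
function converges to its value at the copy, because it is approximated by functions of finitely
many coordinates. -/
theorem tendsto_eLpNorm_mix_sub {J : ℕ → Set ι} (hJ : Monotone J) (hJu : ∀ i, ∃ m, i ∈ J m)
    {b : (ι → E) → ℝ} (hb : MemLp b 2 (Measure.infinitePi fun _ => ν)) :
    Tendsto (fun m => eLpNorm (fun p : (ι → E) × (ι → E) => b (mix (J m) p) - b p.2) 2
      ((Measure.infinitePi fun _ => ν).prod (Measure.infinitePi fun _ => ν))) atTop (𝓝 0) := by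
  classical
  set P : Measure (ι → E) := Measure.infinitePi fun _ => ν
  have hmix : ∀ m, MeasurePreserving (mix (J m)) (P.prod P) P := fun m => measurePreserving_mix _
  have hsnd : MeasurePreserving Prod.snd (P.prod P) P := measurePreserving_snd
  -- the distance at stage `m` of two functions is at most twice their distance
  have approx : ∀ f₁ f₂ : (ι → E) → ℝ, MemLp f₁ 2 P → MemLp f₂ 2 P → ∀ m,
      eLpNorm (fun p : (ι → E) × (ι → E) => f₁ (mix (J m) p) - f₁ p.2) 2 (P.prod P) ≤
        eLpNorm (f₁ - f₂) 2 P + eLpNorm (f₁ - f₂) 2 P +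
        eLpNorm (fun p : (ι → E) × (ι → E) => f₂ (mix (J m) p) - f₂ p.2) 2 (P.prod P) := by
    intro f₁ f₂ h₁ h₂ m
    have a₁ := h₁.comp_measurePreserving (hmix m)
    have a₂ := h₂.comp_measurePreserving (hmix m)
    have c₁ := h₁.comp_measurePreserving hsnd
    have c₂ := h₂.comp_measurePreserving hsnd
    have e : (fun p : (ι → E) × (ι → E) => f₁ (mix (J m) p) - f₁ p.2) =
        (((f₁ - f₂) ∘ mix (J m)) - ((f₁ - f₂) ∘ Prod.snd)) +
          fun p : (ι → E) × (ι → E) => f₂ (mix (J m) p) - f₂ p.2 := by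
      ext p
      simp only [Function.comp_apply, Pi.add_apply, Pi.sub_apply]
      ring
    rw [e]
    have n₁ := eLpNorm_comp_measurePreserving (p := 2) (h₁.sub h₂).1 (hmix m)
    have n₂ := eLpNorm_comp_measurePreserving (p := 2) (h₁.sub h₂).1 hsnd
    refine (eLpNorm_add_le ((a₁.sub a₂).sub (c₁.sub c₂)).1 (a₂.sub c₂).1 one_le_two).trans ?_
    refine add_le_add ?_ le_rfl
    refine (eLpNorm_sub_le (a₁.sub a₂).1 (c₁.sub c₂).1 one_le_two).trans ?_
    exact (add_le_add n₁.le n₂.le)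
  have ind : ∀ (c : ℝ) (S : Set (ι → E)), MeasurableSet S → Tendsto (fun m => eLpNorm
      (fun p : (ι → E) × (ι → E) => S.indicator (fun _ => c) (mix (J m) p) -
        S.indicator (fun _ => c) p.2) 2 (P.prod P)) atTop (𝓝 0) := by
    intro c S hS
    have hdense := Measure.MeasureDense.of_generateFrom_isSetAlgebra_finite P
      (isSetAlgebra_measurableCylinders (α := fun _ : ι => E))
      generateFrom_measurableCylinders.symm
    rw [ENNReal.tendsto_nhds_zero]
    intro ε hε
    obtain ⟨η, hη, hη2⟩ : ∃ η : ℝ, 0 < η ∧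
        ‖c‖ₑ * ENNReal.ofReal η ^ (1 / 2 : ℝ) + ‖c‖ₑ * ENNReal.ofReal η ^ (1 / 2 : ℝ) ≤ ε := by
      have hcont : Tendsto (fun η : ℝ => ‖c‖ₑ * ENNReal.ofReal η ^ (1 / 2 : ℝ) +
          ‖c‖ₑ * ENNReal.ofReal η ^ (1 / 2 : ℝ)) (𝓝[>] 0) (𝓝 0) := by
        have h1 : Tendsto (fun η : ℝ => ENNReal.ofReal η ^ (1 / 2 : ℝ)) (𝓝[>] 0) (𝓝 0) := by
          have : Tendsto (fun η : ℝ => ENNReal.ofReal η ^ (1 / 2 : ℝ)) (𝓝 0)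
              (𝓝 (ENNReal.ofReal 0 ^ (1 / 2 : ℝ))) :=
            ((ENNReal.continuous_rpow_const).comp ENNReal.continuous_ofReal).tendsto 0
          rw [ENNReal.ofReal_zero, ENNReal.zero_rpow_of_pos (by norm_num)] at this
          exact tendsto_nhdsWithin_of_tendsto_nhds this
        have h2 := ENNReal.Tendsto.const_mul (a := ‖c‖ₑ) h1 (Or.inr enorm_ne_top)
        simpa using h2.add h2
      obtain ⟨η, h1, h2⟩ := ((hcont.eventually_le_const hε).and self_mem_nhdsWithin).exists
      exact ⟨η, h2, h1⟩
    obtain ⟨T, hT, hST⟩ := hdense.approx S hS (measure_ne_top _ _) η hη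
    have hTm : MeasurableSet T := MeasurableSet.of_mem_measurableCylinders hT
    obtain ⟨s, T₀, -, rfl⟩ := (mem_measurableCylinders _).1 hT
    have hsub : ∀ s : Finset ι, ∃ m₀, ∀ m ≥ m₀, ∀ i ∈ s, i ∈ J m := by
      intro s
      choose k hk using hJu
      exact ⟨s.sup k, fun m hm i hi => hJ ((Finset.le_sup hi).trans hm) (hk i)⟩
    obtain ⟨m₀, hm₀⟩ := hsub s
    have m₁ : ∀ {S : Set (ι → E)}, MeasurableSet S → MemLp (S.indicator fun _ => c) 2 P :=
      fun hS => memLp_indicator_const 2 hS c (Or.inr (measure_ne_top _ _))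
    filter_upwards [eventually_ge_atTop m₀] with m hm
    refine (approx _ _ (m₁ hS) (m₁ hTm) m).trans ?_
    have hcyl : (fun p : (ι → E) × (ι → E) => (cylinder s T₀).indicator (fun _ => c) (mix (J m) p) -
        (cylinder s T₀).indicator (fun _ => c) p.2) = 0 := by
      ext p
      have : mix (J m) p ∈ cylinder s T₀ ↔ p.2 ∈ cylinder s T₀ := by
        rw [mem_cylinder, mem_cylinder]
        have : s.restrict (mix (J m) p) = s.restrict p.2 := by
          ext i
          simp [mix, hm₀ m hm i i.2]
        rw [this]
      by_cases h : p.2 ∈ cylinder s T₀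
      · simp [Set.indicator_of_mem h, Set.indicator_of_mem (this.2 h)]
      · simp [Set.indicator_of_notMem h, Set.indicator_of_notMem (fun h' => h (this.1 h'))]
    rw [hcyl, eLpNorm_zero, add_zero]
    have hd : eLpNorm ((S.indicator fun _ => c) - (cylinder s T₀).indicator fun _ => c) 2 P ≤
        ‖c‖ₑ * ENNReal.ofReal η ^ (1 / 2 : ℝ) := by
      rw [eLpNorm_indicator_sub_indicator, eLpNorm_indicator_const (hS.symmDiff hTm) (by simp)
        (by simp)]
      simp only [ENNReal.toReal_ofNat]
      gcongr
    exact (add_le_add hd hd).trans hη2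
  have simp_fun : ∀ φ : SimpleFunc (ι → E) ℝ, Tendsto (fun m => eLpNorm
      (fun p : (ι → E) × (ι → E) => φ (mix (J m) p) - φ p.2) 2 (P.prod P)) atTop (𝓝 0) := by
    intro φ
    induction φ using SimpleFunc.induction with
    | const c hs =>
      refine (ind c _ hs).congr fun m => ?_
      congr 1
    | add _ h₁ h₂ =>
      rename_i f₁ f₂ _
      have h := h₁.add h₂
      rw [add_zero] at h
      refine tendsto_of_tendsto_of_tendsto_of_le_of_le tendsto_const_nhds h
        (fun m => zero_le) fun m => ?_
      have s₁ : AEStronglyMeasurable (fun p : (ι → E) × (ι → E) => f₁ (mix (J m) p) - f₁ p.2)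
          (P.prod P) := ((f₁.measurable.comp (measurable_mix _)).sub
            (f₁.measurable.comp measurable_snd)).aestronglyMeasurable
      have s₂ : AEStronglyMeasurable (fun p : (ι → E) × (ι → E) => f₂ (mix (J m) p) - f₂ p.2)
          (P.prod P) := ((f₂.measurable.comp (measurable_mix _)).sub
            (f₂.measurable.comp measurable_snd)).aestronglyMeasurable
      refine le_trans (le_of_eq ?_) (eLpNorm_add_le s₁ s₂ one_le_two)
      congr 1
      ext p
      simp only [SimpleFunc.coe_add, Pi.add_apply]
      ring
  rw [ENNReal.tendsto_nhds_zero]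
  intro ε hε
  rcases eq_or_ne ε ∞ with rfl | hεt
  · exact Eventually.of_forall fun m => le_top
  have hε3 : ε / 3 ≠ 0 := by simp [hε.ne']
  obtain ⟨φ, hφ, hφm⟩ := hb.exists_simpleFunc_eLpNorm_sub_lt (by simp) hε3
  filter_upwards [(simp_fun φ).eventually_le_const (pos_iff_ne_zero.2 hε3)] with m hm
  refine (approx b φ hb hφm m).trans ?_
  calc _ ≤ ε / 3 + ε / 3 + ε / 3 := by gcongr
    _ = ε := ENNReal.add_thirds ε

/-- A covariance inequality of Efron-Stein type for functions of countably many i.i.d. variables: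
`E[a(x) b(y)]` is followed while the coordinates of `y` change one at a time from those of `x` to
those of an independent copy of `x`. -/
theorem enorm_covariance_le_tsum_influence [Denumerable ι] {a b : (ι → E) → ℝ}
    (ha : MemLp a 2 (Measure.infinitePi fun _ => ν))
    (hb : MemLp b 2 (Measure.infinitePi fun _ => ν)) :
    ‖cov[a, b; Measure.infinitePi fun _ => ν]‖ₑ ≤ ∑' j, influence ν a j * influence ν b j := by
  set P : Measure (ι → E) := Measure.infinitePi fun _ => ν
  set e := Denumerable.eqv ι
  set J : ℕ → Set ι := fun m => {i | e i < m} with hJ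
  set A : ℕ → ℝ := fun m => ∫ p, a p.1 * b (mix (J m) p) ∂(P.prod P) with hA
  have ma : MemLp (fun p : (ι → E) × (ι → E) => a p.1) 2 (P.prod P) :=
    ha.comp_measurePreserving measurePreserving_fst
  have mb : ∀ m, MemLp (fun p => b (mix (J m) p)) 2 (P.prod P) := fun m =>
    hb.comp_measurePreserving (measurePreserving_mix _)
  have mb' : MemLp (fun p : (ι → E) × (ι → E) => b p.2) 2 (P.prod P) :=
    hb.comp_measurePreserving measurePreserving_snd
  have ii : ∀ m, Integrable (fun p : (ι → E) × (ι → E) => a p.1 * b (mix (J m) p)) (P.prod P) :=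
    fun m => ma.integrable_mul (mb m)
  have ii' : Integrable (fun p : (ι → E) × (ι → E) => a p.1 * b p.2) (P.prod P) :=
    ma.integrable_mul mb'
  have hstep : ∀ m, ‖A m - A (m + 1)‖ₑ ≤ influence ν a (e.symm m) * influence ν b (e.symm m) := by
    intro m
    have hJs : J (m + 1) = insert (e.symm m) (J m) := by
      ext i
      simp only [hJ, Set.mem_ofPred_eq, Set.mem_insert_iff, Equiv.eq_symm_apply]
      omega
    have hj : e.symm m ∉ J m := by simp [hJ]
    refine le_trans (le_of_eq ?_) (enorm_integral_mul_increment_le ha hb hj)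
    simp only [hA, mul_sub]
    rw [← hJs, integral_sub (ii m) (ii (m + 1))]
  have hle : ∀ m, ‖A 0 - A m‖ₑ ≤ ∑' j, influence ν a j * influence ν b j := by
    intro m
    rw [← Finset.sum_range_sub']
    refine (enorm_sum_le _ _).trans ((Finset.sum_le_sum fun k _ => hstep k).trans ?_)
    rw [← e.symm.tsum_eq fun j => influence ν a j * influence ν b j]
    exact ENNReal.sum_le_tsum _
  have hA0 : A 0 = ∫ x, (a * b) x ∂P := by
    have : ∀ p : (ι → E) × (ι → E), mix (J 0) p = p.1 := fun p => by
      ext i; simp [mix, hJ]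
    simp only [hA, this]
    have h := integral_fun_fst (μ := P) (ν := P) (a * b)
    simpa using h
  have hlim : Tendsto A atTop (𝓝 ((∫ x, a x ∂P) * ∫ x, b x ∂P)) := by
    rw [← integral_prod_mul, tendsto_iff_edist_tendsto_0]
    have h0 := tendsto_eLpNorm_mix_sub (ν := ν) (J := J) (fun m k hmk i hi => lt_of_lt_of_le hi hmk)
      (fun i => ⟨e i + 1, Nat.lt_succ_self _⟩) hb
    have h1 := ENNReal.Tendsto.const_mul (a := eLpNorm (fun p : (ι → E) × (ι → E) => a p.1) 2
      (P.prod P)) h0 (Or.inr ma.2.ne)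
    rw [mul_zero] at h1
    refine tendsto_of_tendsto_of_tendsto_of_le_of_le tendsto_const_nhds h1
      (fun m => zero_le) fun m => ?_
    simp only [edist_eq_enorm_sub, hA]
    rw [← integral_sub (ii m) ii']
    simp only [← mul_sub]
    exact enorm_integral_mul_le ma.1 ((mb m).sub mb').1
  rw [covariance_eq_sub ha hb, ← hA0]
  exact le_of_tendsto' ((hlim.const_sub (A 0)).enorm) hle

end product

/-! ### Covariances of causal Bernoulli shifts -/

section bernoulli

variable {Ω E : Type*} [MeasurableSpace Ω] [MeasurableSpace E] {μ : Measure Ω}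
  {M : ℕ} {q : ℝ≥0∞} {D C : ℝ} {χ : ℕ → ℝ}
  {X : ℕ → ℕ → Ω → ℝ} {Xs : ℝ → ℤ → Ω → ℝ} {ζ : ℤ → Ω → E} {H : ℝ → (ℕ → E) → ℝ}

/-- The past `(x_s, x_{s-1}, …)` of a doubly infinite sequence `x` at time `s`. -/
def seqPast (s : ℤ) (x : ℤ → E) : ℕ → E := fun i => x (s - i)

/-- The sequence `(H(F_s, v), H(F_{s-1}, v), …)` as a function of the innovations. -/
def shiftPast (H : ℝ → (ℕ → E) → ℝ) (v : ℝ) (s : ℤ) (x : ℤ → E) : ℕ → ℝ :=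
  fun i => H v (seqPast (s - i) x)

theorem measurable_seqPast (s : ℤ) : Measurable (seqPast s : (ℤ → E) → ℕ → E) := by
  unfold seqPast; fun_prop

/-- The law of the innovations. -/
noncomputable def innovLaw (μ : Measure Ω) (ζ : ℤ → Ω → E) : Measure (ℤ → E) :=
  Measure.infinitePi fun _ => μ.map (ζ 0)

/-- The uniform functional dependence measure `sup_u δ_q(k)`, extended by zero to negative `k`. -/
noncomputable def supDep (μ : Measure Ω) (q : ℝ≥0∞) (ζ : ℤ → Ω → E) (H : ℝ → (ℕ → E) → ℝ)
    (k : ℤ) : ℝ≥0∞ :=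
  if 0 ≤ k then ⨆ u ∈ Set.Icc (0 : ℝ) 1, depMeasure μ q ζ H u k.toNat else 0

theorem tsum_supDep (μ : Measure Ω) (q : ℝ≥0∞) (ζ : ℤ → Ω → E) (H : ℝ → (ℕ → E) → ℝ) :
    ∑' k : ℤ, supDep μ q ζ H k =
      ∑' k : ℕ, ⨆ u ∈ Set.Icc (0 : ℝ) 1, depMeasure μ q ζ H u k := by
  have hinj : Function.Injective ((↑) : ℕ → ℤ) := Nat.cast_injective
  rw [← hinj.tsum_eq]
  · exact tsum_congr fun k => by simp [supDep]
  · intro k hk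
    have h0 : 0 ≤ k := by
      by_contra h
      exact hk (by simp [supDep, h])
    exact ⟨k.toNat, Int.toNat_of_nonneg h0⟩

variable [IsProbabilityMeasure μ]

theorem IsShortRangeShift.isProbabilityMeasure_map (hS : IsShortRangeShift μ q Xs ζ H) :
    IsProbabilityMeasure (μ.map (ζ 0)) :=
  Measure.isProbabilityMeasure_map (hS.measurable_innov 0).aemeasurable

theorem IsShortRangeShift.measurePreserving (hS : IsShortRangeShift μ q Xs ζ H) :
    MeasurePreserving (fun ω t => ζ t ω) μ (innovLaw μ ζ) := by
  refine ⟨measurable_pi_lambda _ hS.measurable_innov, ?_⟩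
  rw [hS.indep.map_fun_eq_infinitePi_map hS.measurable_innov, innovLaw]
  congr 1
  ext1 t
  exact (hS.ident t).map_eq

theorem IsShortRangeShift.measurePreserving_shift (hS : IsShortRangeShift μ q Xs ζ H) (s : ℤ) :
    MeasurePreserving (fun (x : ℤ → E) t => x (t + s)) (innovLaw μ ζ) (innovLaw μ ζ) := by
  have := hS.isProbabilityMeasure_map
  exact measurePreserving_comp_equiv (Equiv.addRight s)

theorem IsShortRangeShift.isProbabilityMeasure_innovLaw (hS : IsShortRangeShift μ q Xs ζ H) :
    IsProbabilityMeasure (innovLaw μ ζ) := by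
  have := hS.isProbabilityMeasure_map
  unfold innovLaw
  infer_instance

theorem IsShortRangeShift.ae_statPast_eq (hS : IsShortRangeShift μ q Xs ζ H) {v : ℝ}
    (hv : v ∈ Set.Icc (0 : ℝ) 1) (s : ℤ) :
    ∀ᵐ ω ∂μ, statPast Xs v s ω = shiftPast H v s fun t => ζ t ω := by
  filter_upwards [ae_all_iff.2 fun i : ℕ => hS.shift v hv (s - i)] with ω hω
  ext i
  exact hω i

theorem IsShortRangeShift.measurable_comp_seqPast (hS : IsShortRangeShift μ q Xs ζ H) {v : ℝ}
    (hv : v ∈ Set.Icc (0 : ℝ) 1) (s : ℤ) : Measurable fun x : ℤ → E => H v (seqPast s x) :=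
  (hS.measurable_shift v hv).comp (measurable_seqPast s)

theorem IsShortRangeShift.measurable_shiftPast (hS : IsShortRangeShift μ q Xs ζ H) {v : ℝ}
    (hv : v ∈ Set.Icc (0 : ℝ) 1) (s : ℤ) : Measurable (shiftPast H v s) :=
  measurable_pi_lambda _ fun i => hS.measurable_comp_seqPast hv (s - i)

theorem IsShortRangeShift.eLpNorm_comp_seqPast_le (hX : IsLocallyStationary μ q D X Xs)
    (hS : IsShortRangeShift μ q Xs ζ H) {v : ℝ} (hv : v ∈ Set.Icc (0 : ℝ) 1) (s : ℤ) :
    eLpNorm (fun x : ℤ → E => H v (seqPast s x)) q (innovLaw μ ζ) ≤ ENNReal.ofReal D := by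
  rw [← eLpNorm_comp_measurePreserving (hS.measurable_comp_seqPast hv s).aestronglyMeasurable
    hS.measurePreserving]
  refine le_trans (le_of_eq (eLpNorm_congr_ae ?_)) (hX.moment hv s)
  exact (hS.shift v hv s).symm

/-- The increments of the approximations in `u` have the same law at all times, because they are
functions of the stationary sequence of innovations. -/
theorem IsShortRangeShift.eLpNorm_sub_le (hX : IsLocallyStationary μ q D X Xs)
    (hS : IsShortRangeShift μ q Xs ζ H) (t : ℤ) {u v : ℝ} (hu : u ∈ Set.Icc (0 : ℝ) 1)
    (hv : v ∈ Set.Icc (0 : ℝ) 1) :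
    eLpNorm (fun ω => Xs u t ω - Xs v t ω) q μ ≤ ENNReal.ofReal |u - v| * ENNReal.ofReal D := by
  have m : ∀ s : ℤ, Measurable fun x : ℤ → E => H u (seqPast s x) - H v (seqPast s x) := fun s =>
    (hS.measurable_comp_seqPast hu s).sub (hS.measurable_comp_seqPast hv s)
  have e : ∀ s : ℤ, eLpNorm (fun ω => Xs u s ω - Xs v s ω) q μ =
      eLpNorm (fun x : ℤ → E => H u (seqPast s x) - H v (seqPast s x)) q (innovLaw μ ζ) := by
    intro s
    rw [← eLpNorm_comp_measurePreserving (m s).aestronglyMeasurable hS.measurePreserving]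
    refine eLpNorm_congr_ae ?_
    filter_upwards [hS.shift u hu s, hS.shift v hv s] with ω h₁ h₂
    rw [h₁, h₂]
    rfl
  have h := hX.lipschitz u hu v hv
  rw [e, ← eLpNorm_comp_measurePreserving (m 0).aestronglyMeasurable
    (hS.measurePreserving_shift t), mul_comm, ENNReal.ofReal_mul (abs_nonneg _)] at h
  rw [e]
  have hs : ∀ x : ℤ → E, seqPast 0 (fun r => x (r + t)) = seqPast t x := fun x => by
    ext i
    simp only [seqPast]
    congr 1
    ring
  simpa only [Function.comp_def, hs] using h

/-- The effect on `H(F_r, v)` of renewing the innovation at time `j` is the functional dependence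
measure at lag `r - j`. -/
theorem IsShortRangeShift.eLpNorm_sub_mix_le (hS : IsShortRangeShift μ q Xs ζ H) {v : ℝ}
    (hv : v ∈ Set.Icc (0 : ℝ) 1) (r j : ℤ) :
    eLpNorm (fun p : (ℤ → E) × (ℤ → E) => H v (seqPast r p.1) - H v (seqPast r (mix {j} p))) q
      ((innovLaw μ ζ).prod (innovLaw μ ζ)) ≤ supDep μ q ζ H (r - j) := by
  have := hS.isProbabilityMeasure_innovLaw
  rcases lt_or_ge (r - j) 0 with h | h
  · have : (fun p : (ℤ → E) × (ℤ → E) => H v (seqPast r p.1) - H v (seqPast r (mix {j} p))) =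
        0 := by
      ext p
      have : seqPast r (mix {j} p) = seqPast r p.1 := by
        ext i
        have : r - i ≠ j := by omega
        simp [seqPast, mix, this]
      simp [this]
    rw [this, eLpNorm_zero]
    exact zero_le
  · obtain ⟨k, hk⟩ := Int.eq_ofNat_of_zero_le h
    have hr : r = k + j := by omega
    have m : ∀ r j : ℤ, Measurable fun p : (ℤ → E) × (ℤ → E) =>
        H v (seqPast r p.1) - H v (seqPast r (mix {j} p)) := fun r j =>
      ((hS.measurable_comp_seqPast hv r).comp measurable_fst).sub
        ((hS.measurable_comp_seqPast hv r).comp (measurable_mix _))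
    have hT := (hS.measurePreserving_shift j).prod (hS.measurePreserving_shift j)
    have hZ := hS.measurePreserving.prod hS.measurePreserving
    have e₁ : (fun p : (ℤ → E) × (ℤ → E) => H v (seqPast r p.1) - H v (seqPast r (mix {j} p))) =
        (fun p : (ℤ → E) × (ℤ → E) => H v (seqPast k p.1) - H v (seqPast k (mix {0} p))) ∘
          Prod.map (fun (x : ℤ → E) t => x (t + j)) (fun (x : ℤ → E) t => x (t + j)) := by
      have e : ∀ x : ℤ → E, seqPast k (fun t => x (t + j)) = seqPast r x := fun x => by
        ext i
        simp only [seqPast, hr]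
        congr 1
        ring
      ext p
      have e' : mix {0} (Prod.map (fun (x : ℤ → E) t => x (t + j))
          (fun (x : ℤ → E) t => x (t + j)) p) = fun t => mix {j} p (t + j) := by
        ext t
        simp [mix]
      simp only [Function.comp_apply, e', e, Prod.map_fst]
    rw [e₁, eLpNorm_comp_measurePreserving (m _ _).aestronglyMeasurable hT,
      ← eLpNorm_comp_measurePreserving (m _ _).aestronglyMeasurable hZ]
    have e₂ : (fun p : (ℤ → E) × (ℤ → E) => H v (seqPast k p.1) - H v (seqPast k (mix {0} p))) ∘
        Prod.map (fun ω t => ζ t ω) (fun ω t => ζ t ω) =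
        fun p => H v (innovPast ζ k p.1) - H v (coupledPast ζ k p) := by
      ext p
      have : seqPast k (mix {0} (Prod.map (fun ω t => ζ t ω) (fun ω t => ζ t ω) p)) =
          coupledPast ζ k p := by
        ext i
        by_cases hi : i = k
        · simp [seqPast, mix, coupledPast, hi]
        · have : (k : ℤ) - i ≠ 0 := by omega
          simp [seqPast, mix, coupledPast, hi, this]
      simp only [Function.comp_apply, this]
      rfl
    rw [e₂, hk]
    have : supDep μ q ζ H (k : ℤ) = ⨆ u ∈ Set.Icc (0 : ℝ) 1, depMeasure μ q ζ H u k := by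
      simp [supDep]
    exact (le_iSup₂_of_le (f := fun u _ => depMeasure μ q ζ H u k) v hv le_rfl).trans_eq this.symm

/-- A bound for the influence on `f(Ỹ_s(v))` of the innovation `k` time units before `s`. -/
noncomputable def influenceBound (μ : Measure Ω) (M : ℕ) (D C : ℝ) (χ : ℕ → ℝ) (ζ : ℤ → Ω → E)
    (H : ℝ → (ℕ → E) → ℝ) (k : ℤ) : ℝ≥0∞ :=
  ENNReal.ofReal (3 * C) * ((∑' i : ℕ, ENNReal.ofReal (χ i) * supDep μ (2 * M : ℕ) ζ H (k - i)) *
    (1 + (∑' i, ENNReal.ofReal (χ i)) * ENNReal.ofReal D +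
      (∑' i, ENNReal.ofReal (χ i)) * ENNReal.ofReal D) ^ (M - 1))

theorem ClassH.influence_shiftPast_le {f : (ℕ → ℝ) → ℝ} (hf : ClassH M χ C f)
    (hX : IsLocallyStationary μ (2 * M : ℕ) D X Xs)
    (hS : IsShortRangeShift μ (2 * M : ℕ) Xs ζ H) {v : ℝ} (hv : v ∈ Set.Icc (0 : ℝ) 1) (s j : ℤ) :
    influence (μ.map (ζ 0)) (fun x => f (shiftPast H v s x)) j ≤
      influenceBound μ M D C χ ζ H (s - j) := by
  have hp := hS.isProbabilityMeasure_map
  have := hS.isProbabilityMeasure_innovLaw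
  set P := innovLaw μ ζ with hP
  have hm := hS.measurable_shiftPast hv s
  have hmix : MeasurePreserving (mix {j}) (P.prod P) P :=
    measurePreserving_mix (ν := μ.map (ζ 0)) {j}
  have hfst : MeasurePreserving Prod.fst (P.prod P) P := measurePreserving_fst
  have c₁ : ∀ i, AEMeasurable (fun p : (ℤ → E) × (ℤ → E) => shiftPast H v s p.1 i) (P.prod P) :=
    fun i => ((measurable_pi_apply i).comp (hm.comp measurable_fst)).aemeasurable
  have c₂ : ∀ i, AEMeasurable (fun p => shiftPast H v s (mix {j} p) i) (P.prod P) :=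
    fun i => ((measurable_pi_apply i).comp (hm.comp (measurable_mix _))).aemeasurable
  have hKt : (∑' i, ENNReal.ofReal (χ i)) * ENNReal.ofReal D ≠ ∞ :=
    ENNReal.mul_ne_top hf.tsum_weight_ne_top ENNReal.ofReal_ne_top
  have s₁ : seqNorm χ (2 * M : ℕ) (P.prod P) (fun p => shiftPast H v s p.1) ≤
      (∑' i, ENNReal.ofReal (χ i)) * ENNReal.ofReal D := seqNorm_le_mul fun i => by
    refine le_trans (le_of_eq ?_) (hS.eLpNorm_comp_seqPast_le hX hv (s - i))
    exact eLpNorm_comp_measurePreserving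
      (hS.measurable_comp_seqPast hv (s - i)).aestronglyMeasurable hfst
  have s₂ : seqNorm χ (2 * M : ℕ) (P.prod P) (fun p => shiftPast H v s (mix {j} p)) ≤
      (∑' i, ENNReal.ofReal (χ i)) * ENNReal.ofReal D := seqNorm_le_mul fun i => by
    refine le_trans (le_of_eq ?_) (hS.eLpNorm_comp_seqPast_le hX hv (s - i))
    exact eLpNorm_comp_measurePreserving
      (hS.measurable_comp_seqPast hv (s - i)).aestronglyMeasurable hmix
  have h := hf.eLpNorm_comp_sub_le (m := 2) (μ := P.prod P) two_ne_zero
    (x := fun p => shiftPast H v s p.1) (y := fun p => shiftPast H v s (mix {j} p)) c₁ c₂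
    (ne_top_of_le_ne_top hKt s₁) (ne_top_of_le_ne_top hKt s₂)
  rw [Nat.cast_ofNat] at h
  refine h.trans ?_
  unfold influenceBound
  gcongr
  refine ENNReal.tsum_le_tsum fun i => ?_
  gcongr
  refine (hS.eLpNorm_sub_mix_le hv (s - i) j).trans_eq ?_
  congr 1
  ring

theorem tsum_influenceBound_ne_top (hχ : ∑' i, ENNReal.ofReal (χ i) ≠ ∞)
    (hS : IsShortRangeShift μ (2 * M : ℕ) Xs ζ H) :
    ∑' k, influenceBound μ M D C χ ζ H k ≠ ∞ := by
  simp only [influenceBound]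
  rw [ENNReal.tsum_mul_left, ENNReal.tsum_mul_right, ENNReal.tsum_comm]
  have e : ∀ i : ℕ, ∑' k : ℤ, ENNReal.ofReal (χ i) * supDep μ (2 * M : ℕ) ζ H (k - i) =
      ENNReal.ofReal (χ i) * ∑' k : ℤ, supDep μ (2 * M : ℕ) ζ H k := fun i => by
    rw [ENNReal.tsum_mul_left, ← (Equiv.subRight (i : ℤ)).tsum_eq (supDep μ (2 * M : ℕ) ζ H)]
    rfl
  simp only [e]
  rw [ENNReal.tsum_mul_right, tsum_supDep]
  have h1 := hS.summable.ne
  have h2 : (∑' i, ENNReal.ofReal (χ i)) * ENNReal.ofReal D ≠ ∞ :=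
    ENNReal.mul_ne_top hχ ENNReal.ofReal_ne_top
  exact ENNReal.mul_ne_top ENNReal.ofReal_ne_top (ENNReal.mul_ne_top (ENNReal.mul_ne_top hχ h1)
    (ENNReal.pow_ne_top (by simp [h2])))

theorem covariance_congr {X X' Y Y' : Ω → ℝ} (hX : X =ᵐ[μ] X') (hY : Y =ᵐ[μ] Y') :
    cov[X, Y; μ] = cov[X', Y'; μ] := by
  rw [covariance, covariance, integral_congr_ae hX, integral_congr_ae hY]
  refine integral_congr_ae ?_
  filter_upwards [hX, hY] with ω h₁ h₂
  rw [h₁, h₂]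

/-- Covariances of smooth functions of the stationary approximations are summable in the lag,
uniformly in the rescaled times. -/
theorem exists_covariance_bound (hχ : ∑' i, ENNReal.ofReal (χ i) ≠ ∞)
    (hX : IsLocallyStationary μ (2 * M : ℕ) D X Xs)
    (hS : IsShortRangeShift μ (2 * M : ℕ) Xs ζ H) :
    ∃ ρ : ℤ → ℝ, (∀ k, 0 ≤ ρ k) ∧ Summable ρ ∧ ∀ f f' : (ℕ → ℝ) → ℝ, ClassH M χ C f →
      ClassH M χ C f' → Measurable f → Measurable f' → ∀ v ∈ Set.Icc (0 : ℝ) 1,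
      ∀ v' ∈ Set.Icc (0 : ℝ) 1, ∀ s t : ℤ,
        |cov[fun ω => f (statPast Xs v s ω), fun ω => f' (statPast Xs v' t ω); μ]| ≤ ρ (t - s) := by
  have hp := hS.isProbabilityMeasure_map
  set J := influenceBound μ M D C χ ζ H
  have hJ : ∑' k, J k ≠ ∞ := tsum_influenceBound_ne_top hχ hS
  -- the autocorrelation of the influences
  set R : ℤ → ℝ≥0∞ := fun k => ∑' j : ℤ, J j * J (j + k) with hR
  have hRs : ∑' k, R k ≠ ∞ := by
    have : ∑' k, R k = (∑' k, J k) * ∑' k, J k := by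
      simp only [hR]
      rw [ENNReal.tsum_comm, ← ENNReal.tsum_mul_right]
      refine tsum_congr fun j => ?_
      rw [ENNReal.tsum_mul_left, ← (Equiv.addLeft j).tsum_eq J]
      rfl
    rw [this]
    exact ENNReal.mul_ne_top hJ hJ
  refine ⟨fun k => (R k).toReal, fun k => ENNReal.toReal_nonneg, ENNReal.summable_toReal hRs,
    fun f f' hf hf' hfm hfm' v hv v' hv' s t => ?_⟩
  have hRt : R (t - s) ≠ ∞ := ENNReal.ne_top_of_tsum_ne_top hRs _
  have hZ := hS.measurePreserving
  set Z : Ω → ℤ → E := fun ω t => ζ t ω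
  have mf := hfm.comp (hS.measurable_shiftPast hv s)
  have mf' := hfm'.comp (hS.measurable_shiftPast hv' t)
  have ae : (fun ω => f (statPast Xs v s ω)) =ᵐ[μ] (f ∘ shiftPast H v s) ∘ Z := by
    filter_upwards [hS.ae_statPast_eq hv s] with ω h
    rw [h]; rfl
  have ae' : (fun ω => f' (statPast Xs v' t ω)) =ᵐ[μ] (f' ∘ shiftPast H v' t) ∘ Z := by
    filter_upwards [hS.ae_statPast_eq hv' t] with ω h
    rw [h]; rfl
  have L : MemLp (f ∘ shiftPast H v s) 2 (innovLaw μ ζ) := by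
    rw [← hZ.map_eq, memLp_map_measure_iff mf.aestronglyMeasurable hZ.measurable.aemeasurable]
    exact (memLp_congr_ae ae).1 (hf.memLp_statPast hX hfm hv s)
  have L' : MemLp (f' ∘ shiftPast H v' t) 2 (innovLaw μ ζ) := by
    rw [← hZ.map_eq, memLp_map_measure_iff mf'.aestronglyMeasurable hZ.measurable.aemeasurable]
    exact (memLp_congr_ae ae').1 (hf'.memLp_statPast hX hfm' hv' t)
  rw [covariance_congr ae ae', ← covariance_map mf.aestronglyMeasurable mf'.aestronglyMeasurable
    hZ.measurable.aemeasurable, hZ.map_eq, ← Real.norm_eq_abs, ← toReal_enorm]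
  refine ENNReal.toReal_mono hRt ((enorm_covariance_le_tsum_influence L L').trans ?_)
  calc _ ≤ ∑' j : ℤ, J (s - j) * J (t - j) := ENNReal.tsum_le_tsum fun j =>
        mul_le_mul' (hf.influence_shiftPast_le hX hS hv s j)
          (hf'.influence_shiftPast_le hX hS hv' t j)
    _ = R (t - s) := by
        simp only [hR]
        rw [← (Equiv.subLeft s).tsum_eq fun j => J j * J (j + (t - s))]
        refine tsum_congr fun j => ?_
        simp only [Equiv.subLeft_apply]
        congr 2
        ring

/-- The variables `f(Ỹ_t(u))` depend on `u` in a Lipschitz continuous way in `L²`. -/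
theorem ClassH.exists_eLpNorm_statPast_sub_le {f : (ℕ → ℝ) → ℝ} (hf : ClassH M χ C f)
    (hX : IsLocallyStationary μ (2 * M : ℕ) D X Xs)
    (hS : IsShortRangeShift μ (2 * M : ℕ) Xs ζ H) :
    ∃ c : ℝ, 0 ≤ c ∧ ∀ u ∈ Set.Icc (0 : ℝ) 1, ∀ v ∈ Set.Icc (0 : ℝ) 1, ∀ t,
      eLpNorm (fun ω => f (statPast Xs u t ω) - f (statPast Xs v t ω)) 2 μ ≤
        ENNReal.ofReal (c * |u - v|) := by
  set S := ∑' i, ENNReal.ofReal (χ i) with hSdef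
  have hSt : S ≠ ∞ := hf.tsum_weight_ne_top
  have hKt : S * ENNReal.ofReal D ≠ ∞ := ENNReal.mul_ne_top hSt ENNReal.ofReal_ne_top
  set B := ENNReal.ofReal (3 * C) * (S * ENNReal.ofReal D *
    (1 + S * ENNReal.ofReal D + S * ENNReal.ofReal D) ^ (M - 1)) with hB
  have hBt : B ≠ ∞ := ENNReal.mul_ne_top ENNReal.ofReal_ne_top (ENNReal.mul_ne_top hKt
    (ENNReal.pow_ne_top (by simp [hKt])))
  refine ⟨B.toReal, ENNReal.toReal_nonneg, fun u hu v hv t => ?_⟩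
  have c : ∀ {u}, u ∈ Set.Icc (0 : ℝ) 1 → ∀ i, AEMeasurable (fun ω => statPast Xs u t ω i) μ :=
    fun hu i => ((measurable_pi_apply i).comp (measurable_statPast hX hu t)).aemeasurable
  have su := hX.seqNorm_statPast_le (χ := χ) hu t
  have sv := hX.seqNorm_statPast_le (χ := χ) hv t
  have h := hf.eLpNorm_comp_sub_le (m := 2) two_ne_zero (x := statPast Xs u t)
    (y := statPast Xs v t) (c hu) (c hv) (ne_top_of_le_ne_top hKt su) (ne_top_of_le_ne_top hKt sv)
  have hd : seqNorm χ (2 * M : ℕ) μ (fun ω => statPast Xs u t ω - statPast Xs v t ω) ≤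
      S * (ENNReal.ofReal |u - v| * ENNReal.ofReal D) :=
    seqNorm_le_mul fun i => hS.eLpNorm_sub_le hX (t - i) hu hv
  refine h.trans ?_
  rw [ENNReal.ofReal_mul ENNReal.toReal_nonneg, ENNReal.ofReal_toReal hBt]
  calc _ ≤ ENNReal.ofReal (3 * C) * (S * (ENNReal.ofReal |u - v| * ENNReal.ofReal D) *
        (1 + S * ENNReal.ofReal D + S * ENNReal.ofReal D) ^ (M - 1)) := by gcongr
    _ = _ := by rw [hB]; ring

end bernoulli

/-! ### Asymptotics of kernel-weighted double sums -/

/-- The asymptotic regime `h → 0`, `n h → ∞` for pairs `(n, h)` with `h > 0`. -/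
def bandwidthRegime : Filter (ℕ × ℝ) :=
  comap Prod.snd (𝓝[>] 0) ⊓ comap (fun p => (p.1 : ℝ) * p.2) atTop

theorem eventually_bandwidthRegime_iff {P : ℕ × ℝ → Prop} :
    (∀ᶠ p in bandwidthRegime, P p) ↔ ∃ δ > (0 : ℝ), ∃ N : ℝ, ∀ (n : ℕ) (h : ℝ),
      0 < h → h ≤ δ → N ≤ n * h → P (n, h) := by
  have b := ((nhdsGT_basis_Ioc (0 : ℝ)).comap (Prod.snd : ℕ × ℝ → ℝ)).inf
    ((atTop_basis (α := ℝ)).comap fun p : ℕ × ℝ => (p.1 : ℝ) * p.2)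
  rw [bandwidthRegime, b.eventually_iff]
  constructor
  · rintro ⟨⟨δ, N⟩, ⟨hδ, -⟩, H⟩
    exact ⟨δ, hδ, N, fun n h h0 h1 h2 => H ⟨⟨h0, h1⟩, h2⟩⟩
  · rintro ⟨δ, hδ, N, H⟩
    exact ⟨⟨δ, N⟩, ⟨hδ, trivial⟩, fun p hp => H p.1 p.2 hp.1.1 hp.1.2 hp.2⟩

theorem eventually_pos_bandwidthRegime : ∀ᶠ p : ℕ × ℝ in bandwidthRegime, 0 < p.2 :=
  eventually_bandwidthRegime_iff.2 ⟨1, one_pos, 0, fun _ _ h _ _ => h⟩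

theorem eventually_le_bandwidthRegime {δ : ℝ} (hδ : 0 < δ) :
    ∀ᶠ p : ℕ × ℝ in bandwidthRegime, p.2 ≤ δ :=
  eventually_bandwidthRegime_iff.2 ⟨δ, hδ, 0, fun _ _ _ h _ => h⟩

theorem eventually_ge_bandwidthRegime (N : ℝ) :
    ∀ᶠ p : ℕ × ℝ in bandwidthRegime, N ≤ p.1 * p.2 :=
  eventually_bandwidthRegime_iff.2 ⟨1, one_pos, N, fun _ _ _ _ h => h⟩

theorem eventually_one_le_bandwidthRegime : ∀ᶠ p : ℕ × ℝ in bandwidthRegime, 1 ≤ p.1 := by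
  filter_upwards [eventually_ge_bandwidthRegime 1] with p hp
  refine Nat.one_le_iff_ne_zero.2 fun h => ?_
  rw [h, Nat.cast_zero, zero_mul] at hp
  linarith

theorem tendsto_bandwidth : Tendsto (fun p : ℕ × ℝ => p.2) bandwidthRegime (𝓝 0) :=
  (tendsto_nhdsWithin_iff.1 (tendsto_comap.mono_left inf_le_left)).1

theorem tendsto_inv_bandwidth :
    Tendsto (fun p : ℕ × ℝ => 1 / ((p.1 : ℝ) * p.2)) bandwidthRegime (𝓝 0) := by
  simp only [one_div]
  exact tendsto_inv_atTop_zero.comp (tendsto_comap.mono_left inf_le_right)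

/-- The modulus which controls the replacement of the weights and covariances by their values at a
common point; it tends to zero with `θ`. -/
noncomputable def lagModulus (ρ : ℤ → ℝ) (b θ : ℝ) : ℝ :=
  ∑' k : ℤ, min (2 * ρ k) ((b + |(k : ℝ)| * ρ k) * θ)

theorem summable_lagModulus {ρ : ℤ → ℝ} (hρ : ∀ k, 0 ≤ ρ k) (hs : Summable ρ) {b θ : ℝ}
    (hb : 0 ≤ b) (hθ : 0 ≤ θ) :
    Summable fun k : ℤ => min (2 * ρ k) ((b + |(k : ℝ)| * ρ k) * θ) := by
  refine Summable.of_nonneg_of_le (fun k => ?_) (fun k => min_le_left _ _) (hs.mul_left 2)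
  have := hρ k
  exact le_min (by positivity) (by positivity)

theorem tendsto_lagModulus {ρ : ℤ → ℝ} (hρ : ∀ k, 0 ≤ ρ k) (hs : Summable ρ) {b : ℝ}
    (hb : 0 ≤ b) {α : Type*} {l : Filter α} {θ : α → ℝ} (hθ : Tendsto θ l (𝓝 0))
    (hθ0 : ∀ᶠ p in l, 0 ≤ θ p) : Tendsto (fun p => lagModulus ρ b (θ p)) l (𝓝 0) := by
  have h := tendsto_tsum_of_dominated_convergence (𝓕 := l)
    (f := fun p (k : ℤ) => min (2 * ρ k) ((b + |(k : ℝ)| * ρ k) * θ p)) (g := fun _ => 0)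
    (bound := fun k => 2 * ρ k) (hs.mul_left 2) (fun k => ?_) ?_
  · simpa only [lagModulus, tsum_zero] using h
  · have h1 := (tendsto_const_nhds (x := 2 * ρ k)).min (hθ.const_mul (b + |(k : ℝ)| * ρ k))
    have := hρ k
    rwa [mul_zero, min_eq_right (by positivity)] at h1
  · filter_upwards [hθ0] with p hp k
    have := hρ k
    rw [Real.norm_eq_abs, abs_of_nonneg (le_min (by positivity) (by positivity))]
    exact min_le_left _ _

/-- The sum over `1 ≤ t ≤ n` as a sum over all integer lags `k = t - s`; the weights vanish at the
additional times. -/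
theorem KernelWeightBounds.hasSum_mul {K : ℝ → ℝ} {c : ℝ} {n : ℕ} {h u : ℝ}
    (hw : KernelWeightBounds K c n h u) (F : ℤ → ℝ) (s : ℤ) :
    HasSum (fun k : ℤ => kernelWeight K n h u (s + k) * F (s + k))
      (∑ t ∈ Finset.Icc 1 n, kernelWeight K n h u t * F t) := by
  have h1 : HasSum (fun t : ℤ => kernelWeight K n h u t * F t)
      (∑ t ∈ Finset.Icc 1 n, kernelWeight K n h u t * F t) := by
    have hinj : Function.Injective ((↑) : ℕ → ℤ) := Nat.cast_injective
    rw [← hinj.hasSum_iff]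
    · refine hasSum_sum_of_ne_finset_zero fun t ht => ?_
      by_contra hne
      have := hw.range t (left_ne_zero_of_mul hne)
      exact ht (Finset.mem_Icc.2 ⟨by omega, by omega⟩)
    · intro t ht
      by_contra hne
      have := hw.range t (left_ne_zero_of_mul hne)
      exact ht ⟨t.toNat, Int.toNat_of_nonneg (by omega)⟩
  exact (Equiv.addLeft s).hasSum_iff.2 h1

/-- In a double sum of covariances `κ s t` which are close to `γ (t - s)` near the centre of the
kernel, the weight at `t` may be replaced by the weight at `s`. For fixed `s` the terms at lag `k`
differ by at most `c / (nh)` times the `k`-th term of `lagModulus`. -/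
theorem KernelWeightBounds.abs_double_sum_sub_le {K : ℝ → ℝ} {c : ℝ} {n : ℕ} {h u : ℝ}
    (hw : KernelWeightBounds K c n h u) (hc : 0 ≤ c) (hT : 0 < n * h) {κ : ℤ → ℤ → ℝ}
    {γ ρ : ℤ → ℝ} (hs : Summable ρ)
    (hκ : ∀ s t : ℕ, s ∈ Finset.Icc 1 n → t ∈ Finset.Icc 1 n → |κ s t| ≤ ρ (t - s))
    (hγ : ∀ k, |γ k| ≤ ρ k) {b θ : ℝ} (hb : 0 ≤ b) (hθ : 1 / (n * h) ≤ θ)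
    (hκγ : ∀ s t, kernelWeight K n h u s ≠ 0 → kernelWeight K n h u t ≠ 0 →
      |κ s t - γ (t - s)| ≤ b * θ) :
    |∑ s ∈ Finset.Icc 1 n, ∑ t ∈ Finset.Icc 1 n,
        kernelWeight K n h u s * kernelWeight K n h u t * κ s t -
      (∑ s ∈ Finset.Icc 1 n, kernelWeight K n h u s ^ 2) * ∑' k, γ k| ≤
      c ^ 2 * lagModulus ρ b θ * (1 / (n * h)) := by
  set w := kernelWeight K n h u with hwdef
  have hρ : ∀ k, 0 ≤ ρ k := fun k => (abs_nonneg _).trans (hγ k)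
  have hγs : Summable γ := Summable.of_norm_bounded hs fun k => by simpa using hγ k
  have hB : 0 ≤ c / (n * h) := div_nonneg hc hT.le
  have hθ0 : 0 ≤ θ := le_trans (by positivity) hθ
  have hsum := summable_lagModulus hρ hs hb hθ0
  have inner : ∀ s ∈ Finset.Icc 1 n,
      |w s * (∑ t ∈ Finset.Icc 1 n, w t * κ s t - w s * ∑' k, γ k)| ≤
        w s * (c / (n * h) * lagModulus ρ b θ) := by
    intro s hsn
    rcases eq_or_ne (w s) 0 with h0 | h0
    · simp [h0]
    rw [abs_mul, abs_of_nonneg (hw.nonneg s)]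
    refine mul_le_mul_of_nonneg_left ?_ (hw.nonneg s)
    have h1 := (hw.hasSum_mul (κ s) s).sub (hγs.hasSum.mul_left (w s))
    rw [← h1.tsum_eq, ← Real.norm_eq_abs, lagModulus, ← tsum_mul_left]
    refine tsum_of_norm_bounded (hsum.mul_left _).hasSum fun k => ?_
    have hk := hρ k
    have e : w (s + k) * κ s (s + k) - w s * γ k =
        w (s + k) * (κ s (s + k) - γ k) + (w (s + k) - w s) * γ k := by ring
    have hlag : ((s : ℤ) + k) - s = k := by ring
    have hws : |w (s + k)| ≤ c / (n * h) := by
      rw [abs_of_nonneg (hw.nonneg _)]; exact hw.le _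
    have hws' : |w s| ≤ c / (n * h) := by
      rw [abs_of_nonneg (hw.nonneg _)]; exact hw.le _
    rw [mul_min_of_nonneg _ _ hB, Real.norm_eq_abs]
    refine le_min ?_ ?_
    · have b₁ : |w (s + k) * κ s (s + k)| ≤ c / (n * h) * ρ k := by
        rcases eq_or_ne (w (s + k)) 0 with h2 | h2
        · rw [h2, zero_mul, abs_zero]; positivity
        · have hr := hw.range _ h2
          obtain ⟨m, hm⟩ := Int.eq_ofNat_of_zero_le (show 0 ≤ (s : ℤ) + k by omega)
          rw [abs_mul]
          refine mul_le_mul hws ?_ (abs_nonneg _) hB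
          rw [hm]
          refine (hκ s m hsn (Finset.mem_Icc.2 ⟨by omega, by omega⟩)).trans_eq ?_
          rw [← hm, hlag]
      have b₂ : |w s * γ k| ≤ c / (n * h) * ρ k := by
        rw [abs_mul]
        exact mul_le_mul hws' (hγ k) (abs_nonneg _) hB
      refine (abs_sub _ _).trans ?_
      linarith
    · rw [e]
      have b₁ : |w (s + k) * (κ s (s + k) - γ k)| ≤ c / (n * h) * (b * θ) := by
        rcases eq_or_ne (w (s + k)) 0 with h2 | h2
        · rw [h2, zero_mul, abs_zero]; positivity
        · rw [abs_mul]
          refine mul_le_mul hws ?_ (abs_nonneg _) hB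
          have := hκγ s (s + k) h0 h2
          rwa [hlag] at this
      have b₂ : |(w (s + k) - w s) * γ k| ≤ c / (n * h) * (|(k : ℝ)| * θ) * ρ k := by
        rw [abs_mul]
        refine mul_le_mul ((hw.sub_le s (s + k)).trans ?_) (hγ k) (abs_nonneg _) (by positivity)
        rw [hlag, div_eq_mul_one_div _ ((n : ℝ) * h), div_eq_mul_one_div ((|k| : ℤ) : ℝ),
          Int.cast_abs]
        gcongr
      refine (abs_add_le _ _).trans ((add_le_add b₁ b₂).trans_eq ?_)
      ring
  have e : ∑ s ∈ Finset.Icc 1 n, ∑ t ∈ Finset.Icc 1 n, w s * w t * κ s t -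
      (∑ s ∈ Finset.Icc 1 n, w s ^ 2) * ∑' k, γ k =
      ∑ s ∈ Finset.Icc 1 n, w s * (∑ t ∈ Finset.Icc 1 n, w t * κ s t - w s * ∑' k, γ k) := by
    rw [Finset.sum_mul, ← Finset.sum_sub_distrib]
    refine Finset.sum_congr rfl fun s _ => ?_
    rw [mul_sub, Finset.mul_sum]
    congr 1
    · exact Finset.sum_congr rfl fun t _ => by ring
    · ring
  rw [e]
  refine (Finset.abs_sum_le_sum_abs _ _).trans ((Finset.sum_le_sum inner).trans ?_)
  rw [← Finset.sum_mul]
  have hφ : 0 ≤ lagModulus ρ b θ := tsum_nonneg fun k => by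
    have := hρ k
    exact le_min (by positivity) (by positivity)
  refine (mul_le_mul_of_nonneg_right hw.sum_le (by positivity)).trans_eq ?_
  ring

/-! ### Variance inequalities -/

section variance

variable {Ω : Type*} [MeasurableSpace Ω] {μ : Measure Ω} [IsProbabilityMeasure μ] {A B : Ω → ℝ}

/-- The Cauchy-Schwarz inequality, from the discriminant of `x ↦ Var(A + x B)`. -/
theorem sq_covariance_le (hA : MemLp A 2 μ) (hB : MemLp B 2 μ) :
    cov[A, B; μ] ^ 2 ≤ Var[A; μ] * Var[B; μ] := by
  have h : ∀ x : ℝ, 0 ≤ Var[B; μ] * (x * x) + 2 * cov[A, B; μ] * x + Var[A; μ] := fun x => by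
    have h1 := variance_nonneg (fun ω => A ω + x * B ω) μ
    rw [variance_fun_add hA (hB.const_mul x), covariance_const_mul_right, variance_const_mul] at h1
    linarith
  have := discrim_le_zero h
  rw [discrim] at this
  linarith

theorem abs_covariance_le {a b : ℝ} (hA : MemLp A 2 μ) (hB : MemLp B 2 μ) (ha : 0 ≤ a)
    (hb : 0 ≤ b) (hA' : Var[A; μ] ≤ a ^ 2) (hB' : Var[B; μ] ≤ b ^ 2) : |cov[A, B; μ]| ≤ a * b := by
  refine abs_le_of_sq_le_sq ?_ (mul_nonneg ha hb)
  rw [mul_pow]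
  exact (sq_covariance_le hA hB).trans
    (mul_le_mul hA' hB' (variance_nonneg _ _) (sq_nonneg _))

theorem variance_le_sq_of_eLpNorm_le {r : ℝ} (hA : MemLp A 2 μ) (hr : 0 ≤ r)
    (h : eLpNorm A 2 μ ≤ ENNReal.ofReal r) : Var[A; μ] ≤ r ^ 2 := by
  refine (variance_le_expectation_sq hA.1).trans ?_
  rw [hA.eLpNorm_eq_integral_rpow_norm (by simp) (by simp), ENNReal.ofReal_le_ofReal_iff hr] at h
  simp only [ENNReal.toReal_ofNat, Real.rpow_ofNat, Real.norm_eq_abs, sq_abs, ← one_div,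
    ← Real.sqrt_eq_rpow] at h
  simpa using (Real.sqrt_le_left hr).1 h

/-- The variances of two random variables which are close in `L²` are close: the covariance of the
difference with `B` is split by the inequality between arithmetic and geometric means with
weight `θ`. -/
theorem abs_variance_sub_variance_le {r θ : ℝ} (hA : MemLp A 2 μ) (hB : MemLp B 2 μ) (hr : 0 ≤ r)
    (hθ : 0 < θ) (h : eLpNorm (fun ω => A ω - B ω) 2 μ ≤ ENNReal.ofReal r) :
    |Var[A; μ] - Var[B; μ]| ≤ (1 + 1 / θ) * r ^ 2 + θ * Var[B; μ] := by
  set W : Ω → ℝ := fun ω => A ω - B ω with hWdef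
  have hW : MemLp W 2 μ := hA.sub hB
  have e : Var[A; μ] = Var[W; μ] + 2 * cov[W, B; μ] + Var[B; μ] := by
    rw [← variance_fun_add hW hB]
    congr 1
    ext ω
    simp [hWdef]
  have h1 := variance_le_sq_of_eLpNorm_le hW hr h
  have h2 := sq_covariance_le hW hB
  have hW0 := variance_nonneg W μ
  have hB0 := variance_nonneg B μ
  have h3 : |2 * cov[W, B; μ]| ≤ 1 / θ * r ^ 2 + θ * Var[B; μ] := by
    refine abs_le_of_sq_le_sq ?_ (by positivity)
    have h4 : Var[W; μ] * Var[B; μ] ≤ r ^ 2 * Var[B; μ] := mul_le_mul_of_nonneg_right h1 hB0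
    have h5 : (1 / θ * r ^ 2) * (θ * Var[B; μ]) = r ^ 2 * Var[B; μ] := by field_simp
    nlinarith [sq_nonneg (1 / θ * r ^ 2 - θ * Var[B; μ])]
  rw [e, add_sub_cancel_right]
  refine (abs_add_le _ _).trans ?_
  rw [abs_of_nonneg hW0]
  linarith

end variance

/-! ### The variance of the kernel estimator -/

section estimator

variable {Ω E : Type*} [MeasurableSpace Ω] [MeasurableSpace E] {μ : Measure Ω}
  [IsProbabilityMeasure μ] {M d : ℕ} {D C : ℝ} {χ : ℕ → ℝ} {f : (ℕ → ℝ) → ℝ} {K : ℝ → ℝ}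
  {X : ℕ → ℕ → Ω → ℝ} {Xs : ℝ → ℤ → Ω → ℝ} {ζ : ℤ → Ω → E} {H : ℝ → (ℕ → E) → ℝ}
  {g : (ℕ → ℝ) → EuclideanSpace ℝ (Fin d)}

theorem IsLocallyStationary.covariance_statPast {q : ℝ≥0∞} (hX : IsLocallyStationary μ q D X Xs)
    (hfm : Measurable f) {u : ℝ} (hu : u ∈ Set.Icc (0 : ℝ) 1) (s t : ℤ) :
    cov[fun ω => f (statPast Xs u s ω), fun ω => f (statPast Xs u t ω); μ] =
      cov[fun ω => f (statPast Xs u 0 ω), fun ω => f (statPast Xs u (t - s) ω); μ] := by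
  have h := hX.identDistrib_statPast hu s t
  have m₁ : Measurable fun p : (ℕ → ℝ) × (ℕ → ℝ) => f p.1 := hfm.comp measurable_fst
  have m₂ : Measurable fun p : (ℕ → ℝ) × (ℕ → ℝ) => f p.2 := hfm.comp measurable_snd
  have h₁ := covariance_map m₁.aestronglyMeasurable m₂.aestronglyMeasurable h.aemeasurable_fst
  have h₂ := covariance_map m₁.aestronglyMeasurable m₂.aestronglyMeasurable h.aemeasurable_snd
  rw [h.map_eq, h₂] at h₁
  exact h₁.symm

theorem intCast_div_mem_unitInterval {n : ℕ} {t : ℤ} (h : 1 ≤ t ∧ t ≤ n) :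
    (t : ℝ) / n ∈ Set.Icc (0 : ℝ) 1 := by
  obtain ⟨m, rfl⟩ := Int.eq_ofNat_of_zero_le (show 0 ≤ t by omega)
  simpa using div_mem_unitInterval (show m ≤ n by omega)

theorem mem_unitInterval_of_mem_Icc {h u : ℝ} (hh : 0 < h) (hu : u ∈ Set.Icc (h / 2) (1 - h / 2)) :
    u ∈ Set.Icc (0 : ℝ) 1 :=
  ⟨by linarith [hu.1], by linarith [hu.2]⟩

theorem kernelSq_nonneg (K : ℝ → ℝ) : 0 ≤ kernelSq K := integral_nonneg fun _ => sq_nonneg _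

/-- The variance of the weighted sum of the stationary approximations: near `u` both the weights
and the approximations are almost constant, so that the double sum of covariances factorizes into
the squared weights and the long-run variance at `u`. -/
theorem ClassH.eventually_abs_variance_statPast_sub_le (hf : ClassH M χ C f) (hfm : Measurable f)
    (hX : IsLocallyStationary μ (2 * M : ℕ) D X Xs)
    (hS : IsShortRangeShift μ (2 * M : ℕ) Xs ζ H) (hK : IsKernel K) {ε : ℝ} (hε : 0 < ε) :
    ∀ᶠ p : ℕ × ℝ in bandwidthRegime, ∀ u ∈ Set.Icc (p.2 / 2) (1 - p.2 / 2),
      |Var[fun ω => ∑ t ∈ Finset.Icc 1 p.1, kernelWeight K p.1 p.2 u t *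
          f (statPast Xs ((t : ℝ) / p.1) t ω); μ] - kernelSq K / (p.1 * p.2) *
        ∑' k : ℤ, cov[fun ω => f (statPast Xs u 0 ω), fun ω => f (statPast Xs u k ω); μ]| ≤
      ε * (1 / (p.1 * p.2)) := by
  obtain ⟨c, hc1, hc⟩ := hK.exists_bounds
  obtain ⟨ρ, hρ, hρs, hcov⟩ := exists_covariance_bound (C := C) hf.tsum_weight_ne_top hX hS
  obtain ⟨c₁, hc₁, hlip⟩ := hf.exists_eLpNorm_statPast_sub_le hX hS
  have hc0 : 0 ≤ c := by linarith
  -- a common bound for the standard deviations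
  set r := √(ρ 0) with hr
  have hr0 : 0 ≤ r := Real.sqrt_nonneg _
  have hr2 : r ^ 2 = ρ 0 := Real.sq_sqrt (hρ 0)
  set b := c₁ * r with hb
  have hb0 : 0 ≤ b := mul_nonneg hc₁ hr0
  have hθ : Tendsto (fun p : ℕ × ℝ => p.2 + 1 / ((p.1 : ℝ) * p.2)) bandwidthRegime (𝓝 0) := by
    simpa using tendsto_bandwidth.add tendsto_inv_bandwidth
  have hθ0 : ∀ᶠ p : ℕ × ℝ in bandwidthRegime, 0 ≤ p.2 + 1 / ((p.1 : ℝ) * p.2) := by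
    filter_upwards [eventually_pos_bandwidthRegime] with p hp
    positivity
  have hlim : Tendsto (fun p : ℕ × ℝ => c ^ 2 * lagModulus ρ b (p.2 + 1 / ((p.1 : ℝ) * p.2)) +
      c * (1 / ((p.1 : ℝ) * p.2)) * ∑' k, ρ k) bandwidthRegime (𝓝 0) := by
    have h1 := (tendsto_lagModulus hρ hρs hb0 hθ hθ0).const_mul (c ^ 2)
    have h2 := (tendsto_inv_bandwidth.const_mul c).mul_const (∑' k, ρ k)
    simpa using h1.add h2
  filter_upwards [eventually_pos_bandwidthRegime, eventually_one_le_bandwidthRegime,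
    eventually_ge_bandwidthRegime 1, hlim.eventually_le_const hε]
  rintro ⟨n, h⟩ hh hn hT hε' u hu
  simp only at hh hn hT hε' hu ⊢
  have hT0 : 0 < (n : ℝ) * h := by linarith
  have hw := hc n h u hn hh hT hu
  have hu' := mem_unitInterval_of_mem_Icc hh hu
  set w := kernelWeight K n h u
  set η : ℤ → Ω → ℝ := fun t ω => f (statPast Xs ((t : ℝ) / n) t ω) with hη
  set α : ℤ → Ω → ℝ := fun t ω => f (statPast Xs u t ω) with hα
  set γ : ℤ → ℝ := fun k => cov[α 0, α k; μ] with hγ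
  have Lα : ∀ t, MemLp (α t) 2 μ := fun t => hf.memLp_statPast hX hfm hu' t
  have Lη : ∀ t : ℤ, 1 ≤ t ∧ t ≤ n → MemLp (η t) 2 μ := fun t ht =>
    hf.memLp_statPast hX hfm (intCast_div_mem_unitInterval ht) t
  have hγρ : ∀ k, |γ k| ≤ ρ k := fun k => by
    simpa using hcov f f hf hf hfm hfm u hu' u hu' 0 k
  have hvar : Var[fun ω => ∑ t ∈ Finset.Icc 1 n, w t * f (statPast Xs ((t : ℝ) / n) t ω); μ] =
      ∑ s ∈ Finset.Icc 1 n, ∑ t ∈ Finset.Icc 1 n, w s * w t * cov[η s, η t; μ] := by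
    rw [variance_fun_sum' (X := fun (t : ℕ) ω => w t * f (statPast Xs ((t : ℝ) / n) t ω))]
    · refine Finset.sum_congr rfl fun s _ => Finset.sum_congr rfl fun t _ => ?_
      rw [covariance_const_mul_left, covariance_const_mul_right]
      simp only [hη, Int.cast_natCast]
      ring
    · intro t ht
      have := Finset.mem_Icc.1 ht
      have h1 := (Lη t ⟨by omega, by omega⟩).const_mul (w t)
      simpa only [hη, Int.cast_natCast] using h1
  have vη : ∀ t : ℤ, 1 ≤ t ∧ t ≤ n → Var[η t; μ] ≤ r ^ 2 := fun t ht => by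
    have hv := intCast_div_mem_unitInterval ht
    rw [← covariance_self (Lη t ht).1.aemeasurable, hr2]
    have := hcov f f hf hf hfm hfm _ hv _ hv t t
    rw [sub_self] at this
    exact (le_abs_self _).trans this
  have vα : ∀ t : ℤ, Var[α t; μ] ≤ r ^ 2 := fun t => by
    rw [← covariance_self (Lα t).1.aemeasurable, hr2]
    have := hcov f f hf hf hfm hfm _ hu' _ hu' t t
    rw [sub_self] at this
    exact (le_abs_self _).trans this
  have vd : ∀ t : ℤ, w t ≠ 0 → Var[η t - α t; μ] ≤ (c₁ * (h / 2)) ^ 2 := fun t ht => by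
    have hrg := hw.range t ht
    refine variance_le_sq_of_eLpNorm_le ((Lη t hrg).sub (Lα t)) (by positivity) ?_
    refine (hlip _ (intCast_div_mem_unitInterval hrg) u hu' t).trans ?_
    gcongr
    exact hw.near t ht
  have main := hw.abs_double_sum_sub_le hc0 hT0 (κ := fun s t => cov[η s, η t; μ]) (γ := γ) hρs
    (fun s t hs ht => hcov f f hf hf hfm hfm _
      (intCast_div_mem_unitInterval (by have := Finset.mem_Icc.1 hs; omega)) _
      (intCast_div_mem_unitInterval (by have := Finset.mem_Icc.1 ht; omega)) s t) hγρ
    (b := b) (θ := h + 1 / (n * h)) hb0 (by linarith) fun s t hs ht => by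
      have hrs := hw.range s hs
      have hrt := hw.range t ht
      have e : cov[η s, η t; μ] - γ (t - s) =
          cov[η s - α s, η t; μ] + cov[α s, η t - α t; μ] := by
        rw [covariance_sub_left (Lη s hrs) (Lα s) (Lη t hrt),
          covariance_sub_right (Lα s) (Lη t hrt) (Lα t)]
        have : cov[α s, α t; μ] = γ (t - s) := hX.covariance_statPast hfm hu' s t
        rw [this]
        ring
      rw [e]
      have b₁ := abs_covariance_le ((Lη s hrs).sub (Lα s)) (Lη t hrt) (by positivity) hr0
        (vd s hs) (vη t hrt)
      have b₂ := abs_covariance_le (Lα s) ((Lη t hrt).sub (Lα t)) hr0 (by positivity)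
        (vα s) (vd t ht)
      refine (abs_add_le _ _).trans ((add_le_add b₁ b₂).trans ?_)
      have : 0 ≤ b * (1 / ((n : ℝ) * h)) := by positivity
      calc _ = b * h := by rw [hb]; ring
        _ ≤ _ := by linarith
  have hΓ : |∑' k, γ k| ≤ ∑' k, ρ k := by
    rw [← Real.norm_eq_abs]
    exact tsum_of_norm_bounded hρs.hasSum hγρ
  have hsq : |(∑ s ∈ Finset.Icc 1 n, w s ^ 2 - kernelSq K / (n * h)) * ∑' k, γ k| ≤
      c / (n * h) / (n * h) * ∑' k, ρ k := by
    rw [abs_mul]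
    exact mul_le_mul hw.sum_sq hΓ (abs_nonneg _) (by positivity)
  rw [hvar]
  set S := ∑ s ∈ Finset.Icc 1 n, ∑ t ∈ Finset.Icc 1 n, w s * w t * cov[η s, η t; μ]
  calc |S - kernelSq K / (n * h) * ∑' k, γ k|
      = |(S - (∑ s ∈ Finset.Icc 1 n, w s ^ 2) * ∑' k, γ k) +
          (∑ s ∈ Finset.Icc 1 n, w s ^ 2 - kernelSq K / (n * h)) * ∑' k, γ k| := by
        congr 1; ring
    _ ≤ c ^ 2 * lagModulus ρ b (h + 1 / (n * h)) * (1 / (n * h)) +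
          c / (n * h) / (n * h) * ∑' k, ρ k := (abs_add_le _ _).trans (add_le_add main hsq)
    _ = (c ^ 2 * lagModulus ρ b (h + 1 / (n * h)) + c * (1 / (n * h)) * ∑' k, ρ k) *
          (1 / (n * h)) := by ring
    _ ≤ _ := by gcongr

/-- The weighted sums of the observations and of the approximations differ by `O(1/(nh))` in `L²`,
since the weights are `O(1/(nh))` and the distances of the terms have bounded sums. -/
theorem ClassH.exists_eLpNorm_sum_obsPast_sub_le (hf : ClassH M χ C f) (hfm : Measurable f)
    (hX : IsLocallyStationary μ (2 * M : ℕ) D X Xs)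
    (hS : IsShortRangeShift μ (2 * M : ℕ) Xs ζ H) {c : ℝ} (hc0 : 0 ≤ c) :
    ∃ r : ℝ, 0 ≤ r ∧ ∀ (n : ℕ) (h u : ℝ), 1 ≤ n → 0 < h → KernelWeightBounds K c n h u →
      eLpNorm (fun ω => ∑ t ∈ Finset.Icc 1 n, kernelWeight K n h u t * f (obsPast X n t ω) -
        ∑ t ∈ Finset.Icc 1 n, kernelWeight K n h u t * f (statPast Xs ((t : ℝ) / n) t ω)) 2 μ ≤
      ENNReal.ofReal (r * (1 / (n * h))) := by
  obtain ⟨c₂, hc₂, hobs⟩ := hf.exists_eLpNorm_obsPast_sub_le (m := 2) two_ne_zero le_rfl hX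
    (fun t u hu v hv => hS.eLpNorm_sub_le hX t hu hv)
  have hχ := hf.weight_nonneg
  have hS0 : 0 ≤ ∑' i : ℕ, χ i * i := tsum_nonneg fun i => mul_nonneg (hχ i) (by positivity)
  refine ⟨c * c₂ * (1 + ∑' i : ℕ, χ i * i), by positivity, fun n h u hn hh hw => ?_⟩
  have hn0 : (0 : ℝ) < n := by exact_mod_cast hn
  set w := kernelWeight K n h u
  have L : ∀ t ∈ Finset.Icc 1 n,
      MemLp (fun ω => f (obsPast X n t ω) - f (statPast Xs ((t : ℝ) / n) t ω)) 2 μ := fun t ht =>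
    (hf.memLp_obsPast hX hfm (Finset.mem_Icc.1 ht).2).sub
      (hf.memLp_statPast hX hfm (div_mem_unitInterval (Finset.mem_Icc.1 ht).2) t)
  have e : (fun ω => ∑ t ∈ Finset.Icc 1 n, w t * f (obsPast X n t ω) -
      ∑ t ∈ Finset.Icc 1 n, w t * f (statPast Xs ((t : ℝ) / n) t ω)) =
      ∑ t ∈ Finset.Icc 1 n,
        w t • fun ω => f (obsPast X n t ω) - f (statPast Xs ((t : ℝ) / n) t ω) := by
    ext ω
    rw [Finset.sum_apply, ← Finset.sum_sub_distrib]
    exact Finset.sum_congr rfl fun t _ => by simp [mul_sub]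
  rw [e]
  calc _ ≤ ∑ t ∈ Finset.Icc 1 n, ENNReal.ofReal (w t * (c₂ * (1 / n + weightTail χ t))) := by
        refine (eLpNorm_sum_le (fun t ht => ((L t ht).const_smul (w t)).1) one_le_two).trans ?_
        refine Finset.sum_le_sum fun t ht => ?_
        rw [eLpNorm_const_smul, Real.enorm_eq_ofReal (hw.nonneg t),
          ENNReal.ofReal_mul (hw.nonneg t)]
        gcongr
        exact hobs n t (Finset.mem_Icc.1 ht).2
    _ = ENNReal.ofReal (∑ t ∈ Finset.Icc 1 n, w t * (c₂ * (1 / n + weightTail χ t))) := by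
        refine (ENNReal.ofReal_sum_of_nonneg fun t _ => ?_).symm
        have := weightTail_nonneg hχ t
        have := hw.nonneg t
        positivity
    _ ≤ _ := by
        refine ENNReal.ofReal_le_ofReal ?_
        calc _ ≤ ∑ t ∈ Finset.Icc 1 n, c / (n * h) * (c₂ * (1 / n + weightTail χ t)) := by
              refine Finset.sum_le_sum fun t _ => ?_
              have := weightTail_nonneg hχ t
              exact mul_le_mul_of_nonneg_right (hw.le t) (by positivity)
          _ = c / (n * h) * (c₂ * (1 + ∑ t ∈ Finset.Icc 1 n, weightTail χ t)) := by
              rw [← Finset.mul_sum, ← Finset.mul_sum, Finset.sum_add_distrib, Finset.sum_const,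
                Nat.card_Icc, Nat.add_sub_cancel, nsmul_eq_mul, mul_one_div_cancel hn0.ne']
          _ ≤ c / (n * h) * (c₂ * (1 + ∑' i : ℕ, χ i * i)) := by
              gcongr
              exact sum_weightTail_le hχ hf.summable_weight hf.summable_weight_mul n
          _ = _ := by ring

theorem ClassH.eventually_abs_variance_obsPast_sub_le (hf : ClassH M χ C f) (hfm : Measurable f)
    (hX : IsLocallyStationary μ (2 * M : ℕ) D X Xs)
    (hS : IsShortRangeShift μ (2 * M : ℕ) Xs ζ H) (hK : IsKernel K) {ε : ℝ} (hε : 0 < ε) :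
    ∀ᶠ p : ℕ × ℝ in bandwidthRegime, ∀ u ∈ Set.Icc (p.2 / 2) (1 - p.2 / 2),
      |Var[fun ω => ∑ t ∈ Finset.Icc 1 p.1, kernelWeight K p.1 p.2 u t *
          f (obsPast X p.1 t ω); μ] - kernelSq K / (p.1 * p.2) *
        ∑' k : ℤ, cov[fun ω => f (statPast Xs u 0 ω), fun ω => f (statPast Xs u k ω); μ]| ≤
      ε * (1 / (p.1 * p.2)) := by
  obtain ⟨c, hc1, hc⟩ := hK.exists_bounds
  obtain ⟨ρ, hρ, hρs, hcov⟩ := exists_covariance_bound (C := C) hf.tsum_weight_ne_top hX hS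
  obtain ⟨r, hr, hUV⟩ := hf.exists_eLpNorm_sum_obsPast_sub_le (K := K) hfm hX hS
    (show 0 ≤ c by linarith)
  have hρ0 : 0 ≤ ∑' k, ρ k := tsum_nonneg hρ
  have hk0 := kernelSq_nonneg K
  -- a bound for `n h` times the variance of the sum of the stationary approximations
  set B := kernelSq K * ∑' k, ρ k + ε / 2 with hB
  have hB0 : 0 < B := by positivity
  set θ := ε / (4 * B) with hθ
  have hθ0 : 0 < θ := by positivity
  have hlim : Tendsto (fun p : ℕ × ℝ => (1 + 1 / θ) * r ^ 2 * (1 / ((p.1 : ℝ) * p.2)))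
      bandwidthRegime (𝓝 0) := by
    simpa using tendsto_inv_bandwidth.const_mul ((1 + 1 / θ) * r ^ 2)
  filter_upwards [eventually_pos_bandwidthRegime, eventually_one_le_bandwidthRegime,
    eventually_ge_bandwidthRegime 1, hlim.eventually_le_const (show (0 : ℝ) < ε / 4 by positivity),
    hf.eventually_abs_variance_statPast_sub_le hfm hX hS hK (half_pos hε)]
  rintro ⟨n, h⟩ hh hn hT hsmall hV u hu
  simp only at hh hn hT hsmall hV hu ⊢
  have hu' := mem_unitInterval_of_mem_Icc hh hu
  have hV := hV u hu
  have hw := hc n h u hn hh hT hu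
  set V : Ω → ℝ := fun ω =>
    ∑ t ∈ Finset.Icc 1 n, kernelWeight K n h u t * f (statPast Xs ((t : ℝ) / n) t ω) with hVdef
  set U : Ω → ℝ := fun ω => ∑ t ∈ Finset.Icc 1 n, kernelWeight K n h u t * f (obsPast X n t ω)
    with hUdef
  set Γ := ∑' k : ℤ, cov[fun ω => f (statPast Xs u 0 ω), fun ω => f (statPast Xs u k ω); μ]
  have LV : MemLp V 2 μ := memLp_finsetSum _ fun t ht => (hf.memLp_statPast hX hfm
    (div_mem_unitInterval (Finset.mem_Icc.1 ht).2) t).const_mul _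
  have LU : MemLp U 2 μ := memLp_finsetSum _ fun t ht =>
    (hf.memLp_obsPast hX hfm (Finset.mem_Icc.1 ht).2).const_mul _
  set T := (n : ℝ) * h
  have hT0 : 0 < T := by linarith
  have hΓ : |Γ| ≤ ∑' k, ρ k := by
    rw [← Real.norm_eq_abs]
    exact tsum_of_norm_bounded hρs.hasSum fun k => by
      simpa using hcov f f hf hf hfm hfm u hu' u hu' 0 k
  have hVB : Var[V; μ] ≤ B * (1 / T) := by
    have h1 := (abs_le.1 hV).2
    have h2 : kernelSq K / T * Γ ≤ kernelSq K / T * ∑' k, ρ k :=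
      mul_le_mul_of_nonneg_left ((le_abs_self _).trans hΓ) (by positivity)
    calc _ ≤ kernelSq K / T * ∑' k, ρ k + ε / 2 * (1 / T) := by linarith
      _ = _ := by rw [hB]; ring
  have hd := abs_variance_sub_variance_le LU LV (by positivity) hθ0 (hUV n h u hn hh hw)
  have h3 : θ * Var[V; μ] ≤ ε / 4 * (1 / T) :=
    (mul_le_mul_of_nonneg_left hVB hθ0.le).trans_eq (by rw [hθ]; field_simp)
  have h4 : (1 + 1 / θ) * (r * (1 / T)) ^ 2 ≤ ε / 4 * (1 / T) := by
    calc _ = (1 + 1 / θ) * r ^ 2 * (1 / T) * (1 / T) := by ring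
      _ ≤ _ := mul_le_mul_of_nonneg_right hsmall (by positivity)
  refine (_root_.abs_sub_le _ Var[V; μ] _).trans ?_
  linarith

/-! ### The mean squared error -/

/-- The decomposition of the mean squared error into variance and squared bias. -/
theorem integral_norm_sub_sq_eq {A : Ω → EuclideanSpace ℝ (Fin d)} (hA : MemLp A 2 μ)
    (a : EuclideanSpace ℝ (Fin d)) :
    ∫ ω, ‖A ω - a‖ ^ 2 ∂μ = ∑ j, Var[fun ω => A ω j; μ] + ‖∫ ω, A ω ∂μ - a‖ ^ 2 := by
  have hj : ∀ j, MemLp (fun ω => A ω j) 2 μ := fun j => hA.eval_piLp j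
  have hj' : ∀ j, MemLp (fun ω => A ω j - a j) 2 μ := fun j => (hj j).sub (memLp_const _)
  simp only [EuclideanSpace.norm_sq_eq, Real.norm_eq_abs, sq_abs, PiLp.sub_apply]
  rw [integral_finsetSum _ fun j _ => (hj' j).integrable_sq, ← Finset.sum_add_distrib]
  refine Finset.sum_congr rfl fun j _ => ?_
  have h := variance_eq_sub (hj' j)
  rw [variance_sub_const (hj j).1, integral_sub ((hj j).integrable one_le_two)
    (integrable_const _)] at h
  rw [eval_integral_piLp fun j => (hj j).integrable one_le_two]
  simp only [Pi.pow_apply, integral_const, probReal_univ, one_smul] at h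
  linarith

theorem abs_norm_sq_sub_norm_sq_le {F : Type*} [SeminormedAddCommGroup F] {x y : F} {e m : ℝ}
    (h : ‖x - y‖ ≤ e) (hy : ‖y‖ ≤ m) : |‖x‖ ^ 2 - ‖y‖ ^ 2| ≤ e * (e + 2 * m) := by
  have h1 := abs_norm_sub_norm_le x y
  have h2 := norm_nonneg y
  have h3 := norm_nonneg x
  have h4 : ‖x‖ ≤ e + m := by
    have := norm_le_norm_add_norm_sub y x
    rw [norm_sub_rev] at this
    linarith
  rw [sq_sub_sq, abs_mul, mul_comm]
  refine mul_le_mul (h1.trans h) ?_ (abs_nonneg _) ((norm_nonneg _).trans h)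
  rw [abs_of_nonneg (by positivity)]
  linarith

theorem summable_lagCov (hX : IsLocallyStationary μ (2 * M : ℕ) D X Xs) (hgm : Measurable g)
    (hg : ∀ j, SmoothClassH M χ C fun x => g x j) (hS : IsShortRangeShift μ (2 * M : ℕ) Xs ζ H)
    {u : ℝ} (hu : u ∈ Set.Icc (0 : ℝ) 1) (i j : Fin d) : Summable (lagCov μ Xs g u i j) := by
  obtain ⟨ρ, hρ, hρs, hcov⟩ :=
    exists_covariance_bound (C := C) (hg i).mem.tsum_weight_ne_top hX hS
  refine Summable.of_norm_bounded hρs fun k => ?_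
  simpa [lagCov] using hcov _ _ (hg i).mem (hg j).mem (by fun_prop) (by fun_prop) u hu u hu 0 k

theorem eventually_abs_sum_variance_estimator_sub_le
    (hX : IsLocallyStationary μ (2 * M : ℕ) D X Xs) (hgm : Measurable g)
    (hg : ∀ j, SmoothClassH M χ C fun x => g x j) (hS : IsShortRangeShift μ (2 * M : ℕ) Xs ζ H)
    (hK : IsKernel K) {ε : ℝ} (hε : 0 < ε) :
    ∀ᶠ p : ℕ × ℝ in bandwidthRegime, ∀ u ∈ Set.Icc (p.2 / 2) (1 - p.2 / 2),
      |∑ j, Var[fun ω => estimator K X g p.1 p.2 u ω j; μ] - kernelSq K / (p.1 * p.2) *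
        (longRunCov μ Xs g u).trace| ≤ ε * (1 / (p.1 * p.2)) := by
  have hd : (0 : ℝ) < d + 1 := by positivity
  have h := eventually_all.2 fun j => (hg j).mem.eventually_abs_variance_obsPast_sub_le
    (by fun_prop) hX hS hK (div_pos hε hd)
  filter_upwards [h, eventually_pos_bandwidthRegime]
  rintro ⟨n, h⟩ hj hh u hu
  simp only at hj hh hu ⊢
  have e : ∀ j, (fun ω => estimator K X g n h u ω j) =
      fun ω => ∑ t ∈ Finset.Icc 1 n, kernelWeight K n h u t * g (obsPast X n t ω) j := fun j => by
    ext ω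
    simp [estimator_eq]
  have etr : (longRunCov μ Xs g u).trace = ∑ j, ∑' k : ℤ, lagCov μ Xs g u j j k := by
    simp [Matrix.trace, longRunCov]
  simp only [e]
  rw [etr, Finset.mul_sum, ← Finset.sum_sub_distrib]
  refine (Finset.abs_sum_le_sum_abs _ _).trans
    ((Finset.sum_le_sum fun j _ => hj j u hu).trans ?_)
  rw [Finset.sum_const, Finset.card_univ, Fintype.card_fin, nsmul_eq_mul, ← mul_assoc]
  refine mul_le_mul_of_nonneg_right ?_ (by positivity)
  rw [mul_div_assoc', div_le_iff₀ hd]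
  nlinarith

theorem eventually_abs_sq_norm_bias_sub_le
    (hX : IsLocallyStationary μ (2 * M : ℕ) D X Xs) (hpath : HasSmoothPaths μ M D Xs)
    (hgm : Measurable g) (hg : ∀ j, SmoothClassH M χ C fun x => g x j)
    (hK : IsKernel K) {ε : ℝ} (hε : 0 < ε) :
    ∀ᶠ p : ℕ × ℝ in bandwidthRegime, ∀ u ∈ Set.Icc (p.2 / 2) (1 - p.2 / 2),
      |‖∫ ω, estimator K X g p.1 p.2 u ω ∂μ - target μ Xs g u‖ ^ 2 -
        p.2 ^ 4 / 4 * kernelSecondMoment K ^ 2 * ‖targetDeriv2 μ Xs g u‖ ^ 2| ≤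
      ε * (1 / (p.1 * p.2) + p.2 ^ 4) := by
  obtain ⟨c, hc, hbias⟩ := exists_bias_expansion hX hpath hgm hg hK
  have hcont : ContinuousOn (targetDeriv2 μ Xs g) (Set.Icc 0 1) :=
    (contDiffOn_target hX hpath hgm hg).continuousOn_iteratedDerivWithin (m := 2) (by norm_num)
      uniqueDiffOn_unitInterval
  obtain ⟨m₀, hm₀⟩ := isCompact_Icc.exists_bound_of_continuousOn hcont
  have hm₀0 : 0 ≤ m₀ := (norm_nonneg _).trans (hm₀ 0 (by simp))
  set m := |kernelSecondMoment K| / 2 * m₀ with hm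
  have hm0 : 0 ≤ m := by positivity
  -- the contribution `2 ε₁ (ε₁ + m) h⁴` of the remainder of the bias is at most `(ε / 2) h⁴`
  set ε₁ := min 1 (ε / (4 * (1 + m))) with hε₁
  have hε₁0 : 0 < ε₁ := lt_min one_pos (by positivity)
  have hε₁m : 2 * ε₁ * (1 + m) ≤ ε / 2 := by
    have : ε₁ * (4 * (1 + m)) ≤ ε := by
      rw [← le_div_iff₀ (by positivity)]
      exact min_le_right _ _
    linarith
  obtain ⟨δ, hδ, hδ1, hb⟩ := hbias ε₁ hε₁0
  have l₁ : Tendsto (fun p : ℕ × ℝ => 2 * c ^ 2 * (1 / ((p.1 : ℝ) * p.2))) bandwidthRegime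
      (𝓝 0) := by
    simpa using tendsto_inv_bandwidth.const_mul (2 * c ^ 2)
  have l₂ : Tendsto (fun p : ℕ × ℝ => 2 * m * c * p.2 ^ 2) bandwidthRegime (𝓝 0) := by
    simpa using (tendsto_bandwidth.pow 2).const_mul (2 * m * c)
  filter_upwards [eventually_pos_bandwidthRegime, eventually_one_le_bandwidthRegime,
    eventually_ge_bandwidthRegime 1, eventually_le_bandwidthRegime hδ,
    l₁.eventually_le_const (show (0 : ℝ) < ε / 2 by positivity),
    l₂.eventually_le_const (show (0 : ℝ) < ε / 2 by positivity)]
  rintro ⟨n, h⟩ hh hn hT hhδ h₁ h₂ u hu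
  simp only at hh hn hT hhδ h₁ h₂ hu ⊢
  have hB := hb n h hh hhδ hn hT u hu
  have hu' := mem_unitInterval_of_mem_Icc hh hu
  set T := (n : ℝ) * h
  have hT0 : 0 < 1 / T := by positivity
  have hy : ‖(h ^ 2 / 2 * kernelSecondMoment K) • targetDeriv2 μ Xs g u‖ ≤ h ^ 2 * m := by
    rw [norm_smul, Real.norm_eq_abs, abs_mul, abs_of_nonneg (by positivity : 0 ≤ h ^ 2 / 2)]
    calc _ ≤ h ^ 2 / 2 * |kernelSecondMoment K| * m₀ := by gcongr; exact hm₀ u hu'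
      _ = _ := by rw [hm]; ring
  have key := abs_norm_sq_sub_norm_sq_le hB hy
  have e : ‖(h ^ 2 / 2 * kernelSecondMoment K) • targetDeriv2 μ Xs g u‖ ^ 2 =
      h ^ 4 / 4 * kernelSecondMoment K ^ 2 * ‖targetDeriv2 μ Xs g u‖ ^ 2 := by
    rw [norm_smul, mul_pow, Real.norm_eq_abs, sq_abs]
    ring
  rw [e] at key
  refine key.trans ?_
  have hε₁1 : ε₁ ≤ 1 := min_le_left _ _
  rw [div_eq_mul_one_div c T]
  have s₁ : (c * (1 / T) + ε₁ * h ^ 2) ^ 2 ≤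
      2 * c ^ 2 * (1 / T) * (1 / T) + 2 * ε₁ * h ^ 4 := by
    have h5 : ε₁ ^ 2 * h ^ 4 ≤ ε₁ * h ^ 4 :=
      mul_le_mul_of_nonneg_right (by nlinarith) (by positivity)
    nlinarith [sq_nonneg (c * (1 / T) - ε₁ * h ^ 2)]
  have s₂ : 2 * c ^ 2 * (1 / T) * (1 / T) ≤ ε / 2 * (1 / T) :=
    mul_le_mul_of_nonneg_right h₁ hT0.le
  have s₃ : 2 * m * c * h ^ 2 * (1 / T) ≤ ε / 2 * (1 / T) := mul_le_mul_of_nonneg_right h₂ hT0.le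
  have s₄ : 2 * ε₁ * (1 + m) * h ^ 4 ≤ ε / 2 * h ^ 4 :=
    mul_le_mul_of_nonneg_right hε₁m (by positivity)
  have h4 : 0 ≤ ε / 2 * h ^ 4 := by positivity
  calc _ = (c * (1 / T) + ε₁ * h ^ 2) ^ 2 + 2 * m * c * h ^ 2 * (1 / T) +
        2 * ε₁ * m * h ^ 4 := by ring
    _ ≤ _ := by linarith

theorem eventually_abs_mse_sub_le (hX : IsLocallyStationary μ (2 * M : ℕ) D X Xs)
    (hpath : HasSmoothPaths μ M D Xs) (hgm : Measurable g)
    (hg : ∀ j, SmoothClassH M χ C fun x => g x j) (hS : IsShortRangeShift μ (2 * M : ℕ) Xs ζ H)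
    (hK : IsKernel K) {ε : ℝ} (hε : 0 < ε) :
    ∀ᶠ p : ℕ × ℝ in bandwidthRegime, ∀ u ∈ Set.Icc (p.2 / 2) (1 - p.2 / 2),
      |∫ ω, ‖estimator K X g p.1 p.2 u ω - target μ Xs g u‖ ^ 2 ∂μ -
        (kernelSq K / (p.1 * p.2) * (longRunCov μ Xs g u).trace +
          p.2 ^ 4 / 4 * kernelSecondMoment K ^ 2 * ‖targetDeriv2 μ Xs g u‖ ^ 2)| ≤
      ε * (1 / (p.1 * p.2) + p.2 ^ 4) := by
  filter_upwards [eventually_abs_sum_variance_estimator_sub_le hX hgm hg hS hK (half_pos hε),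
    eventually_abs_sq_norm_bias_sub_le hX hpath hgm hg hK (half_pos hε)] with p h₁ h₂ u hu
  have h₁ := h₁ u hu
  have h₂ := h₂ u hu
  rw [integral_norm_sub_sq_eq (memLp_estimator hX hgm hg _ _ _), add_sub_add_comm]
  refine (abs_add_le _ _).trans ((add_le_add h₁ h₂).trans ?_)
  have : 0 ≤ ε / 2 * p.2 ^ 4 := by positivity
  linarith

end estimator

end LocStat

theorem mainTheorem5 {Ω : Type*} [MeasurableSpace Ω] (μ : Measure Ω) [IsProbabilityMeasure μ]
    {d : ℕ} (M : ℕ) (χ : ℕ → ℝ) (C D : ℝ)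
    (X : ℕ → ℕ → Ω → ℝ) (Xs : ℝ → ℤ → Ω → ℝ)
    (g : (ℕ → ℝ) → EuclideanSpace ℝ (Fin d)) (K : ℝ → ℝ)
    (hM : 1 ≤ M)
    (hX : LocStat.IsLocallyStationary μ ((2 * M : ℕ) : ℝ≥0∞) D X Xs)
    (hpath : LocStat.HasSmoothPaths μ M D Xs)
    (hg_meas : Measurable g)
    (hg : ∀ j, LocStat.SmoothClassH M χ C (fun x => g x j))
    (hK : LocStat.IsKernel K) :
    -- the expectations below exist
    (∀ u ∈ Set.Icc (0 : ℝ) 1, ∀ t, MemLp (fun ω => g (LocStat.statPast Xs u t ω)) 2 μ) ∧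
    (∀ n h u, MemLp (LocStat.estimator K X g n h u) 2 μ) ∧
    -- `G` is twice continuously differentiable
    ContDiffOn ℝ 2 (LocStat.target μ Xs g) (Set.Icc 0 1) ∧
    -- bias expansion
    (∃ c : ℝ, ∀ ε > (0 : ℝ), ∃ δ > (0 : ℝ), ∃ N : ℝ, ∀ (n : ℕ) (h : ℝ),
      0 < h → h ≤ δ → 1 ≤ n → N ≤ n * h → ∀ u ∈ Set.Icc (h / 2) (1 - h / 2),
        ‖(∫ ω, LocStat.estimator K X g n h u ω ∂μ) - LocStat.target μ Xs g u
            - (h ^ 2 / 2 * LocStat.kernelSecondMoment K) • LocStat.targetDeriv2 μ Xs g u‖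
          ≤ c / (n * h) + ε * h ^ 2) ∧
    -- decomposition of the mean squared error, for short-range dependent approximations
    (∀ {E : Type*} [MeasurableSpace E] (ζ : ℤ → Ω → E) (H : ℝ → (ℕ → E) → ℝ),
      LocStat.IsShortRangeShift μ ((2 * M : ℕ) : ℝ≥0∞) Xs ζ H →
      (∀ u ∈ Set.Icc (0 : ℝ) 1, ∀ i j, Summable (LocStat.lagCov μ Xs g u i j)) ∧
      (∀ ε > (0 : ℝ), ∃ δ > (0 : ℝ), ∃ N : ℝ, ∀ (n : ℕ) (h : ℝ),
        0 < h → h ≤ δ → 1 ≤ n → N ≤ n * h → ∀ u ∈ Set.Icc (h / 2) (1 - h / 2),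
          |(∫ ω, ‖LocStat.estimator K X g n h u ω - LocStat.target μ Xs g u‖ ^ 2 ∂μ)
              - (LocStat.kernelSq K / (n * h) * (LocStat.longRunCov μ Xs g u).trace
                + h ^ 4 / 4 * LocStat.kernelSecondMoment K ^ 2
                  * ‖LocStat.targetDeriv2 μ Xs g u‖ ^ 2)|
            ≤ ε * (1 / (n * h) + h ^ 4))) := by
  refine ⟨fun u hu t => LocStat.memLp_statPast hX hg_meas hg hu t,
    fun n h u => LocStat.memLp_estimator hX hg_meas hg n h u,
    LocStat.contDiffOn_target hX hpath hg_meas hg, ?_, fun ζ H hS =>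
    ⟨fun u hu i j => LocStat.summable_lagCov hX hg_meas hg hS hu i j, fun ε hε => ?_⟩⟩
  · obtain ⟨c, -, hc⟩ := LocStat.exists_bias_expansion hX hpath hg_meas hg hK
    refine ⟨c, fun ε hε => ?_⟩
    obtain ⟨δ, hδ, -, h⟩ := hc ε hε
    exact ⟨δ, hδ, 1, h⟩
  · obtain ⟨δ, hδ, N, h⟩ := LocStat.eventually_bandwidthRegime_iff.1
      (LocStat.eventually_abs_mse_sub_le hX hpath hg_meas hg hS hK hε)
    exact ⟨δ, hδ, N, fun n b hb0 hbδ _ hN => h n b hb0 hbδ hN⟩
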